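/- **Setting.** Let $\mathcal P$ be an additive category with small coproducts which is bounded: for some regular cardinal $\kappa$ there is an essentially small collection $\mathcal P_0$ of objects of $\mathcal P$, closed under $\kappa$-small coproducts, such that every map from an object of $\mathcal P_0$ to a coproduct factors through a $\kappa$-small subcoproduct, and such that every object of $\mathcal P$ is a retract of a coproduct of objects of $\mathcal P_0$. Let $\mathrm{LMod}_{\mathcal P}$ be the category of presheaves of abelian groups on $\mathcal P$ that send coproducts to products (equivalently, product-preserving presheaves of sets); $\mathcal P$ embeds in it by the Yoneda embedding. Assume that $\mathrm{LMod}_{\mathcal P}$ carries a symmetric monoidal structure $(\otimes,\mathbb 1)$ whose tensor product preserves small colimits in each variable and for which $\mathbb 1$ and the tensor products of representables are representable. Write $\mathrm{CRing}_{\mathcal P}$ for the category of commutative monoids in $\mathrm{LMod}_{\mathcal P}$. A $\mathcal P$-plethory $\Lambda$ is a monad on $\mathrm{CRing}_{\mathcal P}$ whose underlying functor is a left adjoint; its algebras are the $\Lambda$-rings, forming a category $\mathrm{Ring}_\Lambda$. The initial ring $\mathbb 1$ is uniquely a $\Lambda$-ring, and $\mathrm{Ring}_\Lambda^{\mathrm{aug}}=\mathrm{Ring}_\Lambda/\mathbb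 1$. Write $\mathrm{Ab}(\mathcal C)$ for the category of abelian group objects in $\mathcal C$. For an augmented ring $A\to B$ with augmentation ideal $I=\ker(A\to B)$ put $Q_B(A)=\operatorname{coker}(I\otimes I\to I)$. The forgetful functor $\mathrm{Ab}(\mathrm{Ring}_\Lambda/B)\to\mathrm{LMod}_B$ sends $G\to B$ to $\ker(G\to B)$, on which $B$ acts through the zero section and the multiplication of $G$; composing with $\mathrm{LMod}_B\to\mathrm{LMod}_{\mathcal P}$ gives $W_B\colon \mathrm{Ab}(\mathrm{Ring}_\Lambda/B)\to\mathrm{LMod}_{\mathcal P}$. For $M\in\mathrm{LMod}_{\mathcal P}$ let $\Lambda_M$ be the free $\Lambda$-ring on $M$, augmented by $\Lambda_M\to\Lambda_0=\mathbb 1$, and let $\Delta(\Lambda)\colon\mathcal P\to\mathrm{LMod}_{\mathcal P}$ be $P\mapsto Q_{\mathbb 1}(\Lambda_P)$. For a $\Lambda$-ring $B$ let $(B\otimes\Lambda)_M$ be the free object on $M$ in $B/\mathrm{Ring}_\Lambda\simeq\mathrm{Ring}_{B\otimes\Lambda}$, augmented over $B$ by the $B$-map adjoint to $0\colon M\to B$,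 and put $\Delta_B(B\otimes\Lambda)_P=Q_B((B\otimes\Lambda)_P)$. A functor is plethystic if it is monadic and comonadic. A square of functors $U V'\cong V U'$, with $V'\colon\mathcal D'\to\mathcal D$, $U'\colon\mathcal D'\to\mathcal C'$, $V\colon\mathcal C'\to\mathcal C$, $U\colon\mathcal D\to\mathcal C$, is distributive if $U',U$ have left adjoints $T',T$ and the mate $TV\to V'T'$ is an isomorphism. A composition of monads $T,F$ is a monad structure on $TF$ such that $T\eta_F\colon T\to TF$ and $\eta_TF\colon F\to TF$ are maps of monads and $TF\xrightarrow{T\eta_F\eta_TF}TFTF\to TF$ is the identity; equivalently, it is given by a distributive law $FT\to TF$. **Theorem.** Let $\Lambda$ be a $\mathcal P$-plethory. 1. The forgetful functor $\mathrm{Ab}(\mathrm{Ring}_\Lambda^{\mathrm{aug}})\to\mathrm{Ring}_\Lambda^{\mathrm{aug}}$ is fully faithful, with essential image the augmented $\Lambda$-rings whose underlying augmented $\mathcal P$-ring is isomorphic to a square-zero extension $\mathbb 1\ltimes M$ with $M\in\mathrm{LMod}_{\mathcal P}$. Moreover the square $$\begin{array}{ccc}\mathrm{Ab}(\mathrm{Ring}_\Lambda^{\mathrm{aug}})&\xrightarrow{\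 W_{\mathbb 1}\ }&\mathrm{LMod}_{\mathcal P}\\ \downarrow&&\downarrow{\scriptstyle M\mapsto\mathbb 1\ltimes M}\\ \mathrm{Ring}_\Lambda^{\mathrm{aug}}&\longrightarrow&\mathrm{CRing}_{\mathcal P}^{\mathrm{aug}}\end{array}$$ commutes up to an isomorphism for which it is distributive. 2. $W_{\mathbb 1}$ is plethystic, free $\Lambda$-rings exist, and the restriction to $\mathcal P$ of the monad of $W_{\mathbb 1}$ (the underlying $\mathcal P$-bimodule) is naturally isomorphic to $\Delta(\Lambda)$. Thus $\Delta(\Lambda)$ is a $\mathcal P$-algebra and $\mathrm{Ab}(\mathrm{Ring}_\Lambda^{\mathrm{aug}})$ is its category of modules. 3. Let $B$ be a $\Lambda$-ring. Then $W_B$ and $\mathrm{Ab}(\mathrm{Ring}_\Lambda/B)\to\mathrm{LMod}_B$ are plethystic, free objects of $B/\mathrm{Ring}_\Lambda$ exist, and the restriction to $\mathcal P$ of the monad of $W_B$ is naturally isomorphic to $\Delta_B(B\otimes\Lambda)$. The monad of $W_B$ is isomorphic, as a monad, to a composition of the monad $B\otimes-$ with the monad $\Delta(\Lambda)$ of $W_{\mathbb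 1}$. Under this isomorphism, for each $G\in\mathrm{Ab}(\mathrm{Ring}_\Lambda/B)$, the action of $B\otimes-$ on $W_B(G)$ is its $B$-module structure, and the action of $\Delta(\Lambda)$ on $W_B(G)$ is compatible with the one on $W_{\mathbb 1}(G\times_B\mathbb 1)$ along the natural map $W_{\mathbb 1}(G\times_B\mathbb 1)\to W_B(G)$. Moreover the square $$\begin{array}{ccc}\mathrm{Ab}(\mathrm{Ring}_\Lambda/B)&\longrightarrow&\mathrm{Ab}(\mathrm{CRing}_{\mathcal P}/B)\\ \downarrow&&\downarrow\\ \mathrm{Ring}_\Lambda/B&\longrightarrow&\mathrm{CRing}_{\mathcal P}/B\end{array}$$ is distributive. -/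

import Mathlib

open CategoryTheory Limits MonoidalCategory Opposite

universe w v u

set_option linter.unusedSectionVars false

noncomputable section

namespace Plethysm

section Theory

variable (P : Type w) [Category.{v} P]

/-- A category `P` with small coproducts is bounded: for some regular cardinal `κ` there is an
essentially small collection `P₀` of objects, closed under `κ`-small coproducts, which are
`κ`-compact (every map from one of them into a coproduct factors through the inclusion of a
`κ`-small subcoproduct) and generate: every object is a retract of a coproduct of objects of `P₀`. -/
structure IsBounded [HasCoproducts.{v} P] : Prop where
  exists_compact_generators : ∃ (κ : Cardinal.{v}) (P₀ : ObjectProperty P),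
    κ.IsRegular ∧ ObjectProperty.EssentiallySmall.{v} P₀ ∧
    (∀ (I : Type v) (Y : I → P), Cardinal.mk I < κ → (∀ i, P₀ (Y i)) → P₀ (∐ Y)) ∧
    (∀ (X : P), P₀ X → ∀ (I : Type v) (Y : I → P) (f : X ⟶ ∐ Y),
      ∃ (F : Set I) (g : X ⟶ ∐ fun i : F => Y i), Cardinal.mk F < κ ∧
        g ≫ Sigma.desc (fun i : F => Sigma.ι Y i) = f) ∧
    (∀ X : P, ∃ (I : Type v) (Y : I → P), (∀ i, P₀ (Y i)) ∧ Nonempty (Retract X (∐ Y)))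

/-- A presheaf of abelian groups on `P` is a model if it sends small coproducts of `P` to
products. For additive `P`, a product-preserving presheaf of sets takes values in abelian groups
in a unique way, so these are the same as the product-preserving presheaves of sets. -/
def isModel : ObjectProperty (Pᵒᵖ ⥤ AddCommGrpCat.{v}) :=
  fun X => ∀ J : Type v, PreservesLimitsOfShape (Discrete J) X

instance (K : Type) [SmallCategory K] [FinCategory K] :
    (isModel P).IsClosedUnderLimitsOfShape K where
  limitsOfShape_le := by
    rintro G ⟨h⟩ J
    have := fun k => h.prop_diag_obj k J
    have : PreservesLimitsOfShape (Discrete J) h.diag.flip := ⟨fun {F} ↦ ⟨fun {c} hc ↦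
      ⟨evaluationJointlyReflectsLimits _
        (fun k' ↦ isLimitOfPreserves (h.diag.obj k') hc)⟩⟩⟩
    have : PreservesLimitsOfShape (Discrete J) (lim (J := K) (C := AddCommGrpCat.{v})) :=
      (constLimAdj (J := K) (C := AddCommGrpCat.{v})).rightAdjoint_preservesLimits.preservesLimitsOfShape
    let e : h.diag.flip ⋙ lim ≅ G :=
      NatIso.ofComponents
        (fun j ↦ (limit.isLimit (h.diag.flip.obj j)).conePointUniqueUpToIso
          (isLimitOfPreserves ((evaluation _ _).obj j) h.isLimit)) (by
          intro X Y f
          apply (isLimitOfPreserves ((evaluation _ _).obj Y) h.isLimit).hom_ext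
          intro k
          have h1 := (limit.isLimit (h.diag.flip.obj Y)).conePointUniqueUpToIso_hom_comp
            (isLimitOfPreserves ((evaluation _ _).obj Y) h.isLimit) k
          have h2 := (limit.isLimit (h.diag.flip.obj X)).conePointUniqueUpToIso_hom_comp
            (isLimitOfPreserves ((evaluation _ _).obj X) h.isLimit) k
          have h3 : G.map f ≫ (h.π.app k).app Y =
            (h.π.app k).app X ≫ (h.diag.obj k).map f := (h.π.app k).naturality f
          simp only [Functor.mapCone_π_app, evaluation_obj_map] at h1 h2 ⊢
          rw [Category.assoc, h1, Category.assoc, h3, reassoc_of% h2]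
          simp)
    exact preservesLimitsOfShape_of_natIso e

variable [HasCoproducts.{v} P]

instance : (isModel P).IsClosedUnderColimitsOfShape WalkingParallelPair where
  colimitsOfShape_le := by
    rintro G ⟨h⟩ J
    have hd := fun k => h.prop_diag_obj k J
    refine ⟨fun {F} => ?_⟩
    have : HasLimit F := by
      have : HasLimitsOfShape (Discrete J) Pᵒᵖ := hasProductsOfShape_opposite J
      infer_instance
    let τ : (evaluation Pᵒᵖ AddCommGrpCat.{v}).obj (limit F) ⟶
        (Functor.whiskeringLeft _ _ _).obj F ⋙ lim :=
      { app X := limit.post F X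
        naturality X Y f := by
          apply limit.hom_ext
          intro j
          simp }
    have : PreservesColimitsOfShape WalkingParallelPair
        ((Functor.whiskeringLeft _ _ AddCommGrpCat.{v}).obj F ⋙ lim) := inferInstance
    have (k : WalkingParallelPair) : IsIso (τ.app (h.diag.obj k)) :=
      inferInstanceAs (IsIso (limit.post F (h.diag.obj k)))
    have : IsIso (Functor.whiskerLeft h.diag τ) := NatTrans.isIso_iff_isIso_app _ |>.2 this
    have key := isIso_app_coconePt_of_preservesColimit h.diag τ _ h.isColimit
    have : IsIso (limit.post F G) := key
    exact preservesLimit_of_isIso_post _ _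

/-- The category of left modules over the theory `P`: the models of `P`. -/
def LMod := (isModel P).FullSubcategory

instance : Category (LMod P) := inferInstanceAs (Category (isModel P).FullSubcategory)
instance : Preadditive (LMod P) := inferInstanceAs (Preadditive (isModel P).FullSubcategory)

instance : HasFiniteLimits (LMod P) where
  out K _ _ := inferInstanceAs (HasLimitsOfShape K (isModel P).FullSubcategory)

instance : HasCokernels (LMod P) where
  has_colimit f := by
    have : HasColimitsOfShape WalkingParallelPair (LMod P) :=
      inferInstanceAs (HasColimitsOfShape WalkingParallelPair (isModel P).FullSubcategory)
    infer_instance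

instance : HasBinaryBiproducts (LMod P) := HasBinaryBiproducts.of_hasBinaryProducts

variable [Preadditive P]

/-- The embedding of `P` in its category of modules, `X ↦ Hom(-, X)`. -/
def yonedaLMod : P ⥤ LMod P :=
  ObjectProperty.lift (isModel P) preadditiveYoneda fun X _ =>
    have : PreservesLimitsOfSize.{v, v} (preadditiveYoneda.obj X) := inferInstance
    inferInstance

/-- The symmetric monoidal structure on modules makes `P` a symmetric monoidal theory: the
tensor product preserves small colimits in each variable, and the representable modules contain the
unit and are closed under tensor products, so the structure restricts to `P` and is recovered
from `P` by extension along colimits. -/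
class SymmetricMonoidalTheory [MonoidalCategory (LMod P)] [SymmetricCategory (LMod P)] :
    Prop where
  tensorLeft_preservesColimits (X : LMod P) : PreservesColimitsOfSize.{v, v} (tensorLeft X)
  tensorRight_preservesColimits (X : LMod P) : PreservesColimitsOfSize.{v, v} (tensorRight X)
  unit_mem : (yonedaLMod P).essImage (𝟙_ (LMod P))
  tensor_mem (X Y : P) : (yonedaLMod P).essImage ((yonedaLMod P).obj X ⊗ (yonedaLMod P).obj Y)

end Theory

instance (P : Type w) [Category.{v} P] [HasCoproducts.{v} P] [Preadditive P]
    [MonoidalCategory (LMod P)] [SymmetricCategory (LMod P)] [h : SymmetricMonoidalTheory P] :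
    MonoidalPreadditive (LMod P) := by
  have add (F : LMod P ⥤ LMod P) [PreservesColimitsOfSize.{v, v} F] : F.Additive := by
    have : PreservesColimitsOfSize.{0, 0} F := preservesColimitsOfSize_shrink.{0, v, 0, v} F
    have : HasFiniteBiproducts (LMod P) := HasFiniteBiproducts.of_hasFiniteProducts
    have : HasZeroObject (LMod P) := inferInstance
    have : PreservesBinaryBiproducts F := preservesBinaryBiproducts_of_preservesBinaryCoproducts F
    exact Functor.additive_of_preservesBinaryBiproducts F
  have hl (X : LMod P) : (tensorLeft X).Additive :=
    have := h.tensorLeft_preservesColimits X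
    add _
  have hr (X : LMod P) : (tensorRight X).Additive :=
    have := h.tensorRight_preservesColimits X
    add _
  exact
    { whiskerLeft_zero := fun {X Y Z} => (tensorLeft X).map_zero Y Z
      zero_whiskerRight := fun {X Y Z} => (tensorRight X).map_zero Y Z
      whiskerLeft_add := fun {X Y Z} f g => (tensorLeft X).map_add (f := f) (g := g)
      add_whiskerRight := fun {X Y Z} f g => (tensorRight X).map_add (f := f) (g := g) }


section Rings

variable {A : Type u} [Category.{v} A] [MonoidalCategory A] [BraidedCategory A]

section
variable {J : Type w} [SmallCategory J] [HasLimitsOfShape J A] (F : J ⥤ CommMon A)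

instance isCommMonObj_limit : IsCommMonObj (limit (F ⋙ CommMon.forget₂Mon A)).X where
  mul_comm := by
    refine (isLimitOfPreserves (Mon.forget A)
      (limit.isLimit (F ⋙ CommMon.forget₂Mon A))).hom_ext fun j => ?_
    have h : IsMonHom (limit.π (F ⋙ CommMon.forget₂Mon A) j).hom := inferInstance
    have hc : IsCommMonObj ((F ⋙ CommMon.forget₂Mon A).obj j).X := (F.obj j).comm
    change (_ ≫ _) ≫ (limit.π (F ⋙ CommMon.forget₂Mon A) j).hom =
      _ ≫ (limit.π (F ⋙ CommMon.forget₂Mon A) j).hom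
    rw [Category.assoc, IsMonHom.mul_hom, ← BraidedCategory.braiding_naturality_assoc,
      IsCommMonObj.mul_comm]

instance : CreatesLimitsOfShape J (CommMon.forget₂Mon A) where
  CreatesLimit {F} := createsLimitOfFullyFaithfulOfIso
    ⟨(limit (F ⋙ CommMon.forget₂Mon A)).X⟩ (Iso.refl _)

instance commMonHasLimitsOfShape : HasLimitsOfShape J (CommMon A) :=
  hasLimitsOfShape_of_hasLimitsOfShape_createsLimitsOfShape (CommMon.forget₂Mon A)

end

instance [HasFiniteLimits A] : HasFiniteLimits (CommMon A) where
  out _ _ _ := inferInstance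

end Rings

section AbOver

open scoped MonObj

attribute [local instance] Over.cartesianMonoidalCategory Over.braidedCategory

variable {C D : Type*} [Category* C] [Category* D] [HasPullbacks C] [HasPullbacks D]

/-- Abelian group objects in the slice category `C / X`. -/
abbrev AbOver (X : C) := CommGrp (Over X)

/-- The underlying object over `X` of an abelian group object. -/
abbrev AbOver.forget (X : C) : AbOver X ⥤ Over X := CommGrp.forget (Over X)

/-- A functor that preserves finite limits carries abelian group objects over `X` to abelian
group objects over `F X`. -/
def AbOver.post (F : C ⥤ D) [PreservesFiniteLimits F] (X : C) : AbOver X ⥤ AbOver (F.obj X) :=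
  letI : (Over.post F (X := X)).Braided := .ofChosenFiniteProducts _
  (Over.post F (X := X)).mapCommGrp

/-- The square formed by `AbOver.post F X` and the two forgetful functors commutes. -/
def AbOver.postForgetIso (F : C ⥤ D) [PreservesFiniteLimits F] (X : C) :
    AbOver.forget X ⋙ Over.post F ≅ AbOver.post F X ⋙ AbOver.forget (F.obj X) :=
  Iso.refl _

/-- Pullback of abelian group objects along `f : X ⟶ Y`. -/
def AbOver.pullback {X Y : C} (f : X ⟶ Y) : AbOver Y ⥤ AbOver X :=
  (Over.pullback f).mapCommGrp

/-- The object over `X` underlying an abelian group object. -/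
def AbOver.toOver {X : C} (G : AbOver X) : Over X := G.X

/-- The map over `X` underlying a homomorphism of abelian group objects. -/
def AbOver.homOver {X : C} {G H : AbOver X} (f : G ⟶ H) : G.toOver ⟶ H.toOver := f.hom.hom.hom

/-- The zero section of an abelian group object over `X`. -/
def AbOver.zero {X : C} (G : AbOver X) : X ⟶ G.toOver.left := (η[G.X] : 𝟙_ (Over X) ⟶ G.X).left

lemma AbOver.zero_hom {X : C} (G : AbOver X) : G.zero ≫ G.toOver.hom = 𝟙 X :=
  Over.w (η[G.X] : 𝟙_ (Over X) ⟶ G.X)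

lemma AbOver.zero_map {X : C} {G H : AbOver X} (f : G ⟶ H) :
    G.zero ≫ (AbOver.homOver f).left = H.zero := by
  have h : η[G.X] ≫ f.hom.hom.hom = η[H.X] := IsMonHom.one_hom _
  exact congrArg CommaMorphism.left h

end AbOver

section Square

open scoped MonObj

variable {A : Type u} [Category.{v} A] [MonoidalCategory A] [SymmetricCategory A]

/-- The map of underlying objects of a map of commutative monoids. -/
def und {R S : CommMon A} (f : R ⟶ S) : R.X ⟶ S.X := f.hom.hom

@[simp] lemma und_id (R : CommMon A) : und (𝟙 R) = 𝟙 R.X := rfl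

@[simp]
lemma und_comp {R S T : CommMon A} (f : R ⟶ S) (g : S ⟶ T) :
    und (f ≫ g) = und f ≫ und g := rfl

instance {R S : CommMon A} (f : R ⟶ S) : IsMonHom (und f) :=
  inferInstanceAs (IsMonHom f.hom.hom)

lemma unitors_assoc₁ {X Y Z M : A} (f : X ⟶ 𝟙_ A) (g : Y ⟶ 𝟙_ A) (h : Z ⟶ M) :
    ((f ⊗ₘ g) ≫ (λ_ (𝟙_ A)).hom ⊗ₘ h) ≫ (λ_ M).hom =
      (α_ X Y Z).hom ≫ (f ⊗ₘ (g ⊗ₘ h) ≫ (λ_ M).hom) ≫ (λ_ M).hom := by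
  have h1 : ((f ⊗ₘ g) ≫ (λ_ (𝟙_ A)).hom ⊗ₘ h) = ((f ⊗ₘ g) ⊗ₘ h) ≫ ((λ_ (𝟙_ A)).hom ▷ M) := by
    simp only [← tensorHom_id, tensorHom_comp_tensorHom, Category.comp_id]
  have h2 : (f ⊗ₘ (g ⊗ₘ h) ≫ (λ_ M).hom) = (f ⊗ₘ (g ⊗ₘ h)) ≫ (𝟙_ A ◁ (λ_ M).hom) := by
    simp only [← id_tensorHom, tensorHom_comp_tensorHom, Category.comp_id]
  rw [h1, h2, Category.assoc, Category.assoc, ← associator_naturality_assoc]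
  congr 1
  monoidal

lemma unitors_assoc₂ {X Y Z M : A} (f : X ⟶ 𝟙_ A) (g : Y ⟶ M) (h : Z ⟶ 𝟙_ A) :
    ((f ⊗ₘ g) ≫ (λ_ M).hom ⊗ₘ h) ≫ (ρ_ M).hom =
      (α_ X Y Z).hom ≫ (f ⊗ₘ (g ⊗ₘ h) ≫ (ρ_ M).hom) ≫ (λ_ M).hom := by
  have h1 : ((f ⊗ₘ g) ≫ (λ_ M).hom ⊗ₘ h) = ((f ⊗ₘ g) ⊗ₘ h) ≫ ((λ_ M).hom ▷ 𝟙_ A) := by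
    simp only [← tensorHom_id, tensorHom_comp_tensorHom, Category.comp_id]
  have h2 : (f ⊗ₘ (g ⊗ₘ h) ≫ (ρ_ M).hom) = (f ⊗ₘ (g ⊗ₘ h)) ≫ (𝟙_ A ◁ (ρ_ M).hom) := by
    simp only [← id_tensorHom, tensorHom_comp_tensorHom, Category.comp_id]
  rw [h1, h2, Category.assoc, Category.assoc, ← associator_naturality_assoc]
  congr 1
  monoidal

lemma unitors_assoc₃ {X Y Z M : A} (f : X ⟶ M) (g : Y ⟶ 𝟙_ A) (h : Z ⟶ 𝟙_ A) :
    ((f ⊗ₘ g) ≫ (ρ_ M).hom ⊗ₘ h) ≫ (ρ_ M).hom =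
      (α_ X Y Z).hom ≫ (f ⊗ₘ (g ⊗ₘ h) ≫ (λ_ (𝟙_ A)).hom) ≫ (ρ_ M).hom := by
  have h1 : ((f ⊗ₘ g) ≫ (ρ_ M).hom ⊗ₘ h) = ((f ⊗ₘ g) ⊗ₘ h) ≫ ((ρ_ M).hom ▷ 𝟙_ A) := by
    simp only [← tensorHom_id, tensorHom_comp_tensorHom, Category.comp_id]
  have h2 : (f ⊗ₘ (g ⊗ₘ h) ≫ (λ_ (𝟙_ A)).hom) = (f ⊗ₘ (g ⊗ₘ h)) ≫ (M ◁ (λ_ (𝟙_ A)).hom) := by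
    simp only [← id_tensorHom, tensorHom_comp_tensorHom, Category.comp_id]
  rw [h1, h2, Category.assoc, Category.assoc, ← associator_naturality_assoc]
  congr 1
  monoidal

variable [Preadditive A] [HasFiniteLimits A]

/-- The augmentation ideal of a ring over `R`: the kernel of the structure map to `R`. -/
def ideal {R : CommMon A} (X : Over R) : A := kernel (und X.hom)

/-- The inclusion of the augmentation ideal. -/
def idealι {R : CommMon A} (X : Over R) : ideal X ⟶ X.left.X := kernel.ι (und X.hom)

instance {R : CommMon A} (X : Over R) : Mono (idealι X) :=
  inferInstanceAs (Mono (kernel.ι (und X.hom)))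

@[simp]
lemma idealι_und {R : CommMon A} (X : Over R) : idealι X ≫ und X.hom = 0 :=
  kernel.condition _

@[simp]
lemma idealι_und_assoc {R : CommMon A} (X : Over R) {Z : A} (h : R.X ⟶ Z) :
    idealι X ≫ und X.hom ≫ h = 0 := by
  rw [← Category.assoc, idealι_und, zero_comp]

/-- The universal property of the augmentation ideal. -/
def idealLift {R : CommMon A} (X : Over R) {M : A} (f : M ⟶ X.left.X)
    (hf : f ≫ und X.hom = 0) : M ⟶ ideal X :=
  kernel.lift _ f hf

@[simp]
lemma idealLift_ι {R : CommMon A} (X : Over R) {M : A} (f : M ⟶ X.left.X)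
    (hf : f ≫ und X.hom = 0) : idealLift X f hf ≫ idealι X = f :=
  kernel.lift_ι _ _ _

/-- The map of augmentation ideals induced by a commutative square of rings. -/
def idealMap {R S : CommMon A} {X : Over R} {Y : Over S} (f : X.left ⟶ Y.left) (g : R ⟶ S)
    (h : f ≫ Y.hom = X.hom ≫ g) : ideal X ⟶ ideal Y :=
  idealLift Y (idealι X ≫ und f) (by
    rw [Category.assoc, ← und_comp, h, und_comp, idealι_und_assoc])

@[simp]
lemma idealMap_ι {R S : CommMon A} {X : Over R} {Y : Over S} (f : X.left ⟶ Y.left)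
    (g : R ⟶ S) (h : f ≫ Y.hom = X.hom ≫ g) :
    idealMap f g h ≫ idealι Y = idealι X ≫ und f :=
  idealLift_ι _ _ _

@[simp]
lemma idealMap_ι_assoc {R S : CommMon A} {X : Over R} {Y : Over S} (f : X.left ⟶ Y.left)
    (g : R ⟶ S) (h : f ≫ Y.hom = X.hom ≫ g) {Z : A} (k : Y.left.X ⟶ Z) :
    idealMap f g h ≫ idealι Y ≫ k = idealι X ≫ und f ≫ k := by
  rw [← Category.assoc, idealMap_ι, Category.assoc]

@[simp]
lemma idealMap_id {R : CommMon A} (X : Over R) (h) :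
    idealMap (X := X) (Y := X) (𝟙 X.left) (𝟙 R) h = 𝟙 (ideal X) := by
  rw [← cancel_mono (idealι X)]
  simp

lemma idealMap_comp {R : CommMon A} {X Y Z : Over R} (f : X.left ⟶ Y.left)
    (g : Y.left ⟶ Z.left) (hf hg hfg) :
    idealMap (X := X) (Y := Z) (f ≫ g) (𝟙 R) hfg =
      idealMap (X := X) (Y := Y) f (𝟙 R) hf ≫ idealMap g (𝟙 R) hg := by
  rw [← cancel_mono (idealι Z)]
  simp

/-- The map of augmentation ideals induced by a map over `R`. -/
def idealOverMap {R : CommMon A} {X Y : Over R} (f : X ⟶ Y) : ideal X ⟶ ideal Y :=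
  idealMap f.left (𝟙 R) (by simp)

lemma idealOverMap_ι {R : CommMon A} {X Y : Over R} (f : X ⟶ Y) :
    idealOverMap f ≫ idealι Y = idealι X ≫ und f.left :=
  idealMap_ι _ _ _

/-- The augmentation ideal `I(X)` as a functor on rings over `R`. -/
def augIdeal (R : CommMon A) : Over R ⥤ A where
  obj X := ideal X
  map f := idealOverMap f
  map_id X := idealMap_id X _
  map_comp _ _ := idealMap_comp _ _ _ _ _

variable [MonoidalPreadditive A]

/-- The multiplication `I ⊗ I ⟶ I` of the augmentation ideal. -/
def idealMul {R : CommMon A} (X : Over R) : ideal X ⊗ ideal X ⟶ ideal X :=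
  idealLift X ((idealι X ⊗ₘ idealι X) ≫ μ[X.left.X]) (by
    rw [Category.assoc, IsMonHom.mul_hom (und X.hom), tensorHom_comp_tensorHom_assoc]
    simp)

@[simp]
lemma idealMul_ι {R : CommMon A} (X : Over R) :
    idealMul X ≫ idealι X = (idealι X ⊗ₘ idealι X) ≫ μ[X.left.X] :=
  idealLift_ι _ _ _

@[simp]
lemma idealMul_ι_assoc {R : CommMon A} (X : Over R) {Z : A} (k : X.left.X ⟶ Z) :
    idealMul X ≫ idealι X ≫ k = (idealι X ⊗ₘ idealι X) ≫ μ[X.left.X] ≫ k := by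
  rw [← Category.assoc, idealMul_ι, Category.assoc]

lemma idealMul_naturality {R : CommMon A} {X Y : Over R} (f : X.left ⟶ Y.left)
    (h : f ≫ Y.hom = X.hom ≫ 𝟙 R) :
    idealMul X ≫ idealMap f (𝟙 R) h =
      (idealMap f (𝟙 R) h ⊗ₘ idealMap f (𝟙 R) h) ≫ idealMul Y := by
  rw [← cancel_mono (idealι Y)]
  simp only [Category.assoc, idealMul_ι, idealMap_ι, idealMul_ι_assoc,
    tensorHom_comp_tensorHom_assoc]
  rw [IsMonHom.mul_hom (und f), tensorHom_comp_tensorHom_assoc]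

/-- The indecomposables `I/I²` of a ring over `R`, the cokernel of `I ⊗ I ⟶ I`. -/
def indecomposables [HasCokernels A] (R : CommMon A) : Over R ⥤ A where
  obj X := cokernel (idealMul X)
  map {X Y} f := cokernel.map (idealMul X) (idealMul Y)
    (idealMap f.left (𝟙 R) (by simp) ⊗ₘ idealMap f.left (𝟙 R) (by simp))
    (idealMap f.left (𝟙 R) (by simp)) (idealMul_naturality _ _)
  map_id X := by
    rw [← cancel_epi (cokernel.π (idealMul X))]
    simp
  map_comp {X Y Z} f g := by
    rw [← cancel_epi (cokernel.π (idealMul X))]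
    simp [idealMap_comp f.left g.left (by simp) (by simp)]

variable [HasBinaryBiproducts A]

/-- The multiplication of the square-zero extension `𝟙 ⊕ M`: `(a, m) (a', m') = (a a', a m' + m a')`. -/
def sqZeroMul (M : A) : (𝟙_ A ⊞ M) ⊗ (𝟙_ A ⊞ M) ⟶ 𝟙_ A ⊞ M :=
  biprod.lift ((biprod.fst ⊗ₘ biprod.fst) ≫ (λ_ (𝟙_ A)).hom)
    ((biprod.fst ⊗ₘ biprod.snd) ≫ (λ_ M).hom + (biprod.snd ⊗ₘ biprod.fst) ≫ (ρ_ M).hom)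

@[simp]
lemma sqZeroMul_fst (M : A) :
    sqZeroMul M ≫ biprod.fst = (biprod.fst ⊗ₘ biprod.fst) ≫ (λ_ (𝟙_ A)).hom :=
  biprod.lift_fst _ _

@[simp]
lemma sqZeroMul_fst_assoc (M : A) {Z : A} (k : 𝟙_ A ⟶ Z) :
    sqZeroMul M ≫ biprod.fst ≫ k =
      (biprod.fst ⊗ₘ biprod.fst) ≫ (λ_ (𝟙_ A)).hom ≫ k := by
  rw [← Category.assoc, sqZeroMul_fst, Category.assoc]

@[simp]
lemma sqZeroMul_snd (M : A) :
    sqZeroMul M ≫ biprod.snd = (biprod.fst ⊗ₘ biprod.snd) ≫ (λ_ M).hom +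
      (biprod.snd ⊗ₘ biprod.fst) ≫ (ρ_ M).hom :=
  biprod.lift_snd _ _

@[simp]
lemma sqZeroMul_snd_assoc (M : A) {Z : A} (k : M ⟶ Z) :
    sqZeroMul M ≫ biprod.snd ≫ k = ((biprod.fst ⊗ₘ biprod.snd) ≫ (λ_ M).hom +
      (biprod.snd ⊗ₘ biprod.fst) ≫ (ρ_ M).hom) ≫ k := by
  rw [← Category.assoc, sqZeroMul_snd]

instance sqZeroMon (M : A) : MonObj (𝟙_ A ⊞ M) where
  one := biprod.inl
  mul := sqZeroMul M
  one_mul := by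
    apply biprod.hom_ext <;>
    simp [← tensorHom_id, tensorHom_comp_tensorHom_assoc]
  mul_one := by
    apply biprod.hom_ext
    · simp [← id_tensorHom, tensorHom_comp_tensorHom_assoc, unitors_equal]
    · simp [← id_tensorHom, tensorHom_comp_tensorHom_assoc]
  mul_assoc := by
    apply biprod.hom_ext
    · simp [← id_tensorHom, ← tensorHom_id, tensorHom_comp_tensorHom_assoc, unitors_assoc₁]
    · simp [← id_tensorHom, ← tensorHom_id, tensorHom_comp_tensorHom_assoc,
        MonoidalPreadditive.tensor_add, MonoidalPreadditive.add_tensor, unitors_assoc₁,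
        unitors_assoc₂, unitors_assoc₃]
      abel

instance (M : A) : IsCommMonObj (𝟙_ A ⊞ M) where
  mul_comm := by
    change (β_ _ _).hom ≫ sqZeroMul M = sqZeroMul M
    apply biprod.hom_ext
    · rw [Category.assoc, sqZeroMul_fst, ← BraidedCategory.braiding_naturality_assoc]
      simp [← unitors_equal]
    · rw [Category.assoc, sqZeroMul_snd, Preadditive.comp_add,
        ← BraidedCategory.braiding_naturality_assoc, ← BraidedCategory.braiding_naturality_assoc]
      simp [add_comm]

/-- The square-zero extension `𝟙 ⋉ M` as a commutative monoid. -/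
def sqZeroRing (M : A) : CommMon A := ⟨𝟙_ A ⊞ M⟩

/-- The square-zero extension is functorial. -/
def sqZeroMap {M N : A} (f : M ⟶ N) : sqZeroRing M ⟶ sqZeroRing N :=
  CommMon.homMk
    { hom := (biprod.map (𝟙 _) f : 𝟙_ A ⊞ M ⟶ 𝟙_ A ⊞ N)
      isMonHom_hom :=
        { one_hom := by
            change biprod.inl ≫ biprod.map (𝟙 _) f = biprod.inl
            simp
          mul_hom := by
            change sqZeroMul M ≫ biprod.map (𝟙 _) f =
              (biprod.map (𝟙 _) f ⊗ₘ biprod.map (𝟙 _) f) ≫ sqZeroMul N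
            apply biprod.hom_ext
            · simp [tensorHom_comp_tensorHom_assoc]
            · simp only [Category.assoc, biprod.map_snd, sqZeroMul_snd_assoc, sqZeroMul_snd,
                Preadditive.add_comp, Preadditive.comp_add, tensorHom_comp_tensorHom_assoc,
                biprod.map_fst, Category.comp_id]
              rw [← leftUnitor_naturality, ← rightUnitor_naturality]
              simp [← id_tensorHom, ← tensorHom_id, tensorHom_comp_tensorHom_assoc] } }

/-- The augmentation `𝟙 ⋉ M ⟶ 𝟙`. -/
def sqZeroAug (M : A) : sqZeroRing M ⟶ CommMon.trivial A :=
  CommMon.homMk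
    { hom := (biprod.fst : 𝟙_ A ⊞ M ⟶ 𝟙_ A)
      isMonHom_hom :=
        { one_hom := by
            change biprod.inl ≫ biprod.fst = 𝟙 _
            simp
          mul_hom := by
            change sqZeroMul M ≫ biprod.fst = (biprod.fst ⊗ₘ biprod.fst) ≫ (λ_ (𝟙_ A)).hom
            simp } }

/-- The functor `M ↦ 𝟙 ⋉ M` to augmented rings. -/
def sqZero : A ⥤ Over (CommMon.trivial A) where
  obj M := Over.mk (sqZeroAug M)
  map f := Over.homMk (sqZeroMap f) (by
    apply CommMon.hom_ext
    change biprod.map (𝟙 _) f ≫ biprod.fst = biprod.fst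
    simp)
  map_id M := by
    ext
    change biprod.map (𝟙 _) (𝟙 M) = 𝟙 _
    apply biprod.hom_ext <;> simp
  map_comp f g := by
    ext
    change biprod.map (𝟙 _) (f ≫ g) = biprod.map (𝟙 _) f ≫ biprod.map (𝟙 _) g
    apply biprod.hom_ext <;> simp

end Square

section Modules

variable {A : Type u} [Category.{v} A] [MonoidalCategory A] [SymmetricCategory A]

/-- The monad `R ⊗ -`, whose algebras are the modules over `R`. -/
def tensorMonad (R : CommMon A) : Monad A where
  toFunctor := tensorLeft R.X
  η :=
    { app M := (λ_ M).inv ≫ MonObj.one (X := R.X) ▷ M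
      naturality M N f := by simp [← whisker_exchange] }
  μ :=
    { app M := (α_ R.X R.X M).inv ≫ MonObj.mul (X := R.X) ▷ M
      naturality M N f := by simp [← whisker_exchange] }
  assoc M := by
    change R.X ◁ ((α_ R.X R.X M).inv ≫ MonObj.mul (X := R.X) ▷ M) ≫
        (α_ R.X R.X M).inv ≫ MonObj.mul (X := R.X) ▷ M =
      ((α_ R.X R.X (R.X ⊗ M)).inv ≫ MonObj.mul (X := R.X) ▷ (R.X ⊗ M)) ≫
        (α_ R.X R.X M).inv ≫ MonObj.mul (X := R.X) ▷ M
    rw [whiskerLeft_comp, Category.assoc, Category.assoc, associator_inv_naturality_left_assoc,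
      ← comp_whiskerRight, associator_inv_naturality_middle_assoc, ← comp_whiskerRight,
      MonObj.mul_assoc_flip, comp_whiskerRight, pentagon_inv_assoc]
  left_unit M := by
    change ((λ_ (R.X ⊗ M)).inv ≫ MonObj.one (X := R.X) ▷ (R.X ⊗ M)) ≫
      (α_ R.X R.X M).inv ≫ MonObj.mul (X := R.X) ▷ M = 𝟙 (R.X ⊗ M)
    rw [Category.assoc, associator_inv_naturality_left_assoc, ← comp_whiskerRight,
      MonObj.one_mul]
    monoidal
  right_unit M := by
    change R.X ◁ ((λ_ M).inv ≫ MonObj.one (X := R.X) ▷ M) ≫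
      (α_ R.X R.X M).inv ≫ MonObj.mul (X := R.X) ▷ M = 𝟙 (R.X ⊗ M)
    rw [whiskerLeft_comp, Category.assoc, associator_inv_naturality_middle_assoc,
      ← comp_whiskerRight, MonObj.mul_one]
    monoidal

variable [Preadditive A] [HasFiniteLimits A] [MonoidalPreadditive A]

/-- The action of `R` on the augmentation ideal of an abelian group object over `R`: elements of `R`
act by multiplication after the zero section. -/
def idealAction {R : CommMon A} (G : AbOver R) : R.X ⊗ ideal G.toOver ⟶ ideal G.toOver :=
  idealLift G.toOver ((und G.zero ⊗ₘ idealι G.toOver) ≫ MonObj.mul (X := G.toOver.left.X)) (by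
    rw [Category.assoc, IsMonHom.mul_hom (und G.toOver.hom), tensorHom_comp_tensorHom_assoc]
    simp)

@[simp]
lemma idealAction_ι {R : CommMon A} (G : AbOver R) :
    idealAction G ≫ idealι G.toOver =
      (und G.zero ⊗ₘ idealι G.toOver) ≫ MonObj.mul (X := G.toOver.left.X) :=
  idealLift_ι _ _ _

@[simp]
lemma idealAction_ι_assoc {R : CommMon A} (G : AbOver R) {Z : A} (k : G.toOver.left.X ⟶ Z) :
    idealAction G ≫ idealι G.toOver ≫ k =
      (und G.zero ⊗ₘ idealι G.toOver) ≫ MonObj.mul (X := G.toOver.left.X) ≫ k := by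
  rw [← Category.assoc, idealAction_ι, Category.assoc]

lemma idealAction_unit {R : CommMon A} (G : AbOver R) :
    ((λ_ (ideal G.toOver)).inv ≫ MonObj.one (X := R.X) ▷ ideal G.toOver) ≫ idealAction G =
      𝟙 (ideal G.toOver) := by
  rw [← cancel_mono (idealι G.toOver), Category.assoc, idealAction_ι, Category.assoc,
    ← tensorHom_id, tensorHom_comp_tensorHom_assoc, IsMonHom.one_hom (und G.zero),
    Category.id_comp, tensorHom_def', Category.assoc, MonObj.one_mul,
    leftUnitor_naturality, Iso.inv_hom_id_assoc]

lemma idealAction_assoc {R : CommMon A} (G : AbOver R) :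
    ((α_ R.X R.X (ideal G.toOver)).inv ≫ MonObj.mul (X := R.X) ▷ ideal G.toOver) ≫
      idealAction G = R.X ◁ idealAction G ≫ idealAction G := by
  rw [← cancel_mono (idealι G.toOver)]
  simp only [Category.assoc, idealAction_ι]
  rw [← tensorHom_id, tensorHom_comp_tensorHom_assoc, IsMonHom.mul_hom (und G.zero),
    ← id_tensorHom, tensorHom_comp_tensorHom_assoc, idealAction_ι, Category.id_comp,
    Category.id_comp]
  have h1 : ((und G.zero ⊗ₘ und G.zero) ≫ MonObj.mul ⊗ₘ idealι G.toOver) ≫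
        MonObj.mul (X := G.toOver.left.X) =
      ((und G.zero ⊗ₘ und G.zero) ⊗ₘ idealι G.toOver) ≫ MonObj.mul ▷ _ ≫ MonObj.mul := by
    rw [← tensorHom_id, tensorHom_comp_tensorHom_assoc, Category.comp_id]
  have h2 : (und G.zero ⊗ₘ (und G.zero ⊗ₘ idealι G.toOver) ≫ MonObj.mul) ≫
        MonObj.mul (X := G.toOver.left.X) =
      (und G.zero ⊗ₘ (und G.zero ⊗ₘ idealι G.toOver)) ≫ _ ◁ MonObj.mul ≫ MonObj.mul := by
    rw [← id_tensorHom, tensorHom_comp_tensorHom_assoc, Category.comp_id]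
  rw [h1, h2, MonObj.mul_assoc, associator_naturality_assoc, Iso.inv_hom_id_assoc]

lemma idealAction_naturality {R : CommMon A} {G H : AbOver R} (f : G ⟶ H) :
    R.X ◁ idealOverMap (AbOver.homOver f) ≫ idealAction H =
      idealAction G ≫ idealOverMap (AbOver.homOver f) := by
  rw [← cancel_mono (idealι H.toOver)]
  simp only [Category.assoc, idealAction_ι, idealOverMap_ι, idealAction_ι_assoc]
  rw [← id_tensorHom, tensorHom_comp_tensorHom_assoc, idealOverMap_ι, Category.id_comp,
    IsMonHom.mul_hom (und (AbOver.homOver f).left), tensorHom_comp_tensorHom_assoc,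
    ← und_comp, AbOver.zero_map]

/-- The augmentation ideal of an abelian group object over `R`, as an `R`-module. -/
def idealModule (R : CommMon A) : AbOver R ⥤ (tensorMonad R).Algebra where
  obj G :=
    { A := ideal G.toOver
      a := idealAction G
      unit := idealAction_unit G
      assoc := idealAction_assoc G }
  map {G H} f :=
    { f := idealOverMap (AbOver.homOver f)
      h := idealAction_naturality f }
  map_id G := by
    ext
    exact (augIdeal R).map_id _
  map_comp f g := by
    ext
    exact (augIdeal R).map_comp _ _

end Modules

section Composition

variable {C : Type u} [Category.{v} C]

/-- A composition of the monad `T` with the monad `F`: a monad structure on the composite `TF` such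
that `T η_F` and `η_T F` are maps of monads and the composite
`TF ⟶ TFTF ⟶ TF` of `T η_F η_T F` with the multiplication is the identity. Such structures
correspond to distributive laws `FT ⟶ TF`. -/
structure MonadComposition (T F : Monad C) where
  η : 𝟭 C ⟶ F.toFunctor ⋙ T.toFunctor
  μ : (F.toFunctor ⋙ T.toFunctor) ⋙ F.toFunctor ⋙ T.toFunctor ⟶ F.toFunctor ⋙ T.toFunctor
  assoc (X : C) : T.map (F.map (μ.app X)) ≫ μ.app X = μ.app (T.obj (F.obj X)) ≫ μ.app X
  left_unit (X : C) : η.app (T.obj (F.obj X)) ≫ μ.app X = 𝟙 (T.obj (F.obj X))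
  right_unit (X : C) : T.map (F.map (η.app X)) ≫ μ.app X = 𝟙 (T.obj (F.obj X))
  inl_unit (X : C) : T.η.app X ≫ T.map (F.η.app X) = η.app X
  inl_mul (X : C) : T.μ.app X ≫ T.map (F.η.app X) =
    T.map (T.map (F.η.app X)) ≫ T.map (F.η.app (T.obj (F.obj X))) ≫ μ.app X
  inr_unit (X : C) : F.η.app X ≫ T.η.app (F.obj X) = η.app X
  inr_mul (X : C) : F.μ.app X ≫ T.η.app (F.obj X) =
    F.map (T.η.app (F.obj X)) ≫ T.η.app (F.obj (T.obj (F.obj X))) ≫ μ.app X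
  middle_unit (X : C) :
    T.map (F.η.app (F.obj X)) ≫ T.map (F.map (T.η.app (F.obj X))) ≫ μ.app X =
      𝟙 (T.obj (F.obj X))

variable {T F : Monad C}

/-- The monad `TF`. -/
def MonadComposition.monad (c : MonadComposition T F) : Monad C where
  toFunctor := F.toFunctor ⋙ T.toFunctor
  η := c.η
  μ := c.μ
  assoc := c.assoc
  left_unit := c.left_unit
  right_unit := c.right_unit

/-- The map of monads `T ⟶ TF`. -/
def MonadComposition.inl (c : MonadComposition T F) : T ⟶ c.monad where
  app X := T.map (F.η.app X)
  naturality X Y f := by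
    change T.map f ≫ T.map (F.η.app Y) = T.map (F.η.app X) ≫ T.map (F.map f)
    rw [← T.map_comp, ← T.map_comp, F.unit_naturality]
  app_η X := c.inl_unit X
  app_μ X := (c.inl_mul X).trans (Category.assoc _ _ _).symm

/-- The map of monads `F ⟶ TF`. -/
def MonadComposition.inr (c : MonadComposition T F) : F ⟶ c.monad where
  app X := T.η.app (F.obj X)
  naturality _ _ f := T.η.naturality (F.map f)
  app_η X := c.inr_unit X
  app_μ X := (c.inr_mul X).trans (Category.assoc _ _ _).symm

variable {C' D D' : Type*} [Category* C'] [Category* D] [Category* D']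

/-- A functor is plethystic if it is both monadic and comonadic. -/
def IsPlethystic {D : Type*} [Category* D] (U : D ⥤ C) : Prop :=
  Nonempty (MonadicRightAdjoint U) ∧ Nonempty (ComonadicLeftAdjoint U)

/-- The square `U' ⋙ V ≅ V' ⋙ U` is distributive: `U'` and `U` have left adjoints `T'` and
`T`, and the mate `T V ⟶ V' T'` is an isomorphism. -/
def IsDistributiveSquare {U' : D' ⥤ C'} {V' : D' ⥤ D} {V : C' ⥤ C} {U : D ⥤ C}
    (e : U' ⋙ V ≅ V' ⋙ U) : Prop :=
  ∃ (T' : C' ⥤ D') (T : C ⥤ D) (adj' : T' ⊣ U') (adj : T ⊣ U),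
    IsIso ((mateEquiv adj' adj).symm (TwoSquare.mk U' V' V U e.hom)).natTrans

end Composition

section FreeAug
variable {C D : Type*} [Category* C] [Category* D] [HasZeroMorphisms C] {U : D ⥤ C} {Fr : C ⥤ D}

/-- For `Fr ⊣ U`, the free object on `M` regarded as an object over `E` through the map
`Fr M ⟶ E` adjoint to the zero map. If `E` is the initial object this is `Fr (M ⟶ 0)`. -/
def freeAug (adj : Fr ⊣ U) (E : D) : C ⥤ Over E where
  obj M := Over.mk ((adj.homEquiv M E).symm 0)
  map f := Over.homMk (Fr.map f) (by
    simp [← Adjunction.homEquiv_naturality_left_symm])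

end FreeAug

section Plethory

variable (A : Type u) [Category.{v} A] [MonoidalCategory A] [SymmetricCategory A]

/-- A plethory: a monad on the category of commutative rings in `A` whose underlying functor has
a right adjoint. -/
structure Plethory where
  /-- The monad whose algebras are the rings over the plethory. -/
  monad : Monad (CommMon A)
  isLeftAdjoint : monad.toFunctor.IsLeftAdjoint

namespace Plethory
variable {A} (Λ : Plethory A)

/-- `Λ`-rings: the algebras of the monad. -/
abbrev Ring := Λ.monad.Algebra

/-- The ring underlying a `Λ`-ring. -/
abbrev toCommMon : Λ.Ring ⥤ CommMon A := Λ.monad.forget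

/-- The object of `A` underlying a `Λ`-ring. -/
abbrev forget : Λ.Ring ⥤ A := Λ.toCommMon ⋙ CommMon.forget A

/-- The monoidal unit is the initial ring. -/
def trivialIsInitial : IsInitial (CommMon.trivial A) := IsInitial.ofUnique _

/-- The monad of a plethory preserves the initial ring. -/
def monadTrivialIsInitial : IsInitial (Λ.monad.obj (CommMon.trivial A)) :=
  have := Λ.isLeftAdjoint
  IsInitial.isInitialObj Λ.monad.toFunctor _ trivialIsInitial

/-- The unit `𝟙` with its unique structure of a `Λ`-ring. -/
def unit : Λ.Ring where
  A := CommMon.trivial A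
  a := Λ.monadTrivialIsInitial.to _
  unit := trivialIsInitial.hom_ext _ _
  assoc := by
    have := Λ.isLeftAdjoint
    exact (IsInitial.isInitialObj Λ.monad.toFunctor _ Λ.monadTrivialIsInitial).hom_ext _ _

/-- The unique map of `Λ`-rings from the unit. -/
def fromUnit (B : Λ.Ring) : Λ.unit ⟶ B where
  f := trivialIsInitial.to B.A
  h := Λ.monadTrivialIsInitial.hom_ext _ _

variable [HasFiniteLimits A]

instance : HasPullbacks Λ.Ring :=
  hasLimitsOfShape_of_hasLimitsOfShape_createsLimitsOfShape Λ.toCommMon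

instance : PreservesFiniteLimits Λ.toCommMon :=
  have := Λ.monad.adj.rightAdjoint_preservesLimits
  inferInstance

variable [Preadditive A] [MonoidalPreadditive A]

/-- The category `Ab(Ring_Λ / B)` of abelian group objects over `B`. -/
abbrev Ab (B : Λ.Ring) := AbOver B

/-- The forgetful functor `Ab(Ring_Λ / B) ⥤ LMod_B`: the augmentation ideal of the underlying
abelian group object in rings over `B`. -/
def abToModule (B : Λ.Ring) : Λ.Ab B ⥤ (tensorMonad B.A).Algebra :=
  AbOver.post Λ.toCommMon B ⋙ idealModule B.A

/-- The forgetful functor from `Ab(Ring_Λ / B)` to `A`. -/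
def abForget (B : Λ.Ring) : Λ.Ab B ⥤ A := Λ.abToModule B ⋙ (tensorMonad B.A).forget

/-- Pullback of abelian group objects over `B` along `𝟙 ⟶ B`. -/
def abPullbackToUnit (B : Λ.Ring) : Λ.Ab B ⥤ Λ.Ab Λ.unit := AbOver.pullback (Λ.fromUnit B)

/-- The map of augmentation ideals induced by the projection `G ×_B 𝟙 ⟶ G`. -/
def abPullbackComparison (B : Λ.Ring) (G : Λ.Ab B) :
    (Λ.abForget Λ.unit).obj ((Λ.abPullbackToUnit B).obj G) ⟶ (Λ.abForget B).obj G :=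
  idealMap (X := ((AbOver.post Λ.toCommMon Λ.unit).obj ((Λ.abPullbackToUnit B).obj G)).toOver)
    (Y := ((AbOver.post Λ.toCommMon B).obj G).toOver)
    (Λ.toCommMon.map (pullback.fst G.toOver.hom (Λ.fromUnit B)))
    (Λ.toCommMon.map (Λ.fromUnit B))
    ((Λ.toCommMon.map_comp _ _).symm.trans
      ((congrArg Λ.toCommMon.map pullback.condition).trans (Λ.toCommMon.map_comp _ _)))

variable [HasCokernels A]

/-- The cotangent functor `M ↦ Q(Λ_M)`: the indecomposables of the free `Λ`-ring on `M`, augmented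
over the unit by `Λ_M ⟶ Λ_0 = 𝟙`. On representable `M` this is the cotangent algebra
`Δ(Λ)`. -/
def cotangent {Fr : A ⥤ Λ.Ring} (adj : Fr ⊣ Λ.forget) : A ⥤ A :=
  freeAug adj Λ.unit ⋙ Over.post Λ.toCommMon ⋙ indecomposables Λ.unit.A

/-- The forgetful functor from `Λ`-rings under `B`, that is from rings over `B ⊗ Λ`. -/
abbrev underForget (B : Λ.Ring) : Under B ⥤ A := Under.forget B ⋙ Λ.forget

/-- The cotangent functor `M ↦ Q_B((B ⊗ Λ)_M)` relative to `B`: the indecomposables of the free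
`Λ`-ring under `B` on `M`, augmented over `B`. -/
def cotangentUnder (B : Λ.Ring) {Fr : A ⥤ Under B} (adj : Fr ⊣ Λ.underForget B) : A ⥤ A :=
  freeAug adj (Under.mk (𝟙 B)) ⋙ Over.post (Under.forget B ⋙ Λ.toCommMon) ⋙ indecomposables B.A

end Plethory
end Plethory
end Plethysm

end

open Plethysm

/-! Everything rests on reading abelian group objects through derivations. For an abelian group
object `G` over a commutative ring `R`, the elements `(x, 0)` and `(0, y)` of `G ×_R G`, with `x`
and `y` in the augmentation ideal, have product zero; applying the group law, a ring map, shows that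
the ideal squares to zero (`idealMul_toOver`). Hence `G` is the square-zero extension of `R` by its
ideal, maps into `G` over `R` are derivations into that ideal, and `idealModule R` is an equivalence
between Ab(CRing/R) and `R`-modules. Differentials represent derivations, so free abelian group
objects exist; for a ring with a section, the derivations vanishing on the section are represented
by I/I² (`cotangentEquiv`).

The passage to `Λ`-rings uses that the forgetful functor to rings has adjoints on both sides: a
right adjoint of the monad's functor lifts to a right adjoint of the forgetful functor. As it also
preserves finite limits and is conservative, it induces comonadic functors on abelian group objects,
whose right adjoints lie over those on slices. This compatibility of right adjoints is the
bijectivity of `squareHom`. Passing to left adjoints turns it into distributivity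
(`isDistributiveSquare_of_bijective`), and comonadic descent produces the free abelian group objects
themselves (`isRightAdjoint_of_bijective`). So a free abelian group object in `Λ`-rings stays free
on underlying rings (`IsFreeAb.post`), where derivations compute it: its ideal is the module of
indecomposables. Beck's theorem in both directions makes `W_B` and its lift to modules plethystic.

Over the unit ring a map of augmented rings preserves zero sections because the unit is initial, and
a map preserving zero is additive; this gives full faithfulness. Distributivity identifies the
underlying map of the unit of the reflection with the unit for square-zero extensions, so the
essential image can be tested on underlying rings.

For the composition of monads, let `Λ_M` be the free `Λ`-ring on `M`. Its zero augmentation to `B`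
factors through the unit ring. Therefore maps in the base category from the free augmented object to
a `B`-module `N`, and `B`-linear maps from the free object over `B` to `N`, are both the derivations
of `Λ_M` into `N` (`pullbackApp_bijective`). Thus the second object is the free `B`-module on the
first, which is the invertibility required by `exists_monadComposition`.

Boundedness supplies a small separating family in the abelian, complete and cocomplete category of
modules. The special adjoint functor theorem then gives right adjoints to tensoring, and the general
one gives free commutative monoids, with quotients of sums of tensor powers as the solution set. -/

noncomputable section

namespace Plethysm

/-! ### Cofree algebras for a monad with a right adjoint -/

section MonadWithRightAdjoint

variable {C : Type u} [Category.{v} C] (T : Monad C)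

/-- The forgetful functor of a monad whose underlying functor has a right adjoint has a right
adjoint. -/
lemma isLeftAdjoint_forget_of_isLeftAdjoint [T.toFunctor.IsLeftAdjoint] :
    T.forget.IsLeftAdjoint := by
  obtain ⟨K, ⟨adj⟩⟩ := ‹T.toFunctor.IsLeftAdjoint›
  let ε (X : C) : T.obj (K.obj X) ⟶ X := adj.counit.app X
  let tr {Y X : C} (f : T.obj Y ⟶ X) : Y ⟶ K.obj X := adj.homEquiv _ _ f
  let mu (X : C) : T.obj (T.obj X) ⟶ T.obj X := T.μ.app X
  let et (X : C) : X ⟶ T.obj X := T.η.app X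
  have mu_nat {X Y : C} (f : X ⟶ Y) : T.map (T.map f) ≫ mu Y = mu X ≫ T.map f := T.μ.naturality f
  have et_nat {X Y : C} (f : X ⟶ Y) : f ≫ et Y = et X ≫ T.map f := T.η.naturality f
  have mu_assoc (X : C) : T.map (mu X) ≫ mu X = mu (T.obj X) ≫ mu X := T.assoc X
  have mu_left (X : C) : et (T.obj X) ≫ mu X = 𝟙 _ := T.left_unit X
  have mu_right (X : C) : T.map (et X) ≫ mu X = 𝟙 _ := T.right_unit X
  have tr_ε {Y X : C} (f : T.obj Y ⟶ X) : T.map (tr f) ≫ ε X = f :=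
    (adj.homEquiv_counit _ _ _).symm.trans (Equiv.symm_apply_apply _ _)
  have ext {Y X : C} (f g : Y ⟶ K.obj X) (h : T.map f ≫ ε X = T.map g ≫ ε X) : f = g :=
    (adj.homEquiv _ _).symm.injective
      ((adj.homEquiv_counit _ _ _).trans (h.trans (adj.homEquiv_counit _ _ _).symm))
  -- The cofree algebra on `X` has carrier `K.obj X`, and its action is the adjunct of `T T K X ⟶ T
  -- K X ⟶ X`.
  let N (X : C) : T.Algebra :=
    { A := K.obj X
      a := tr (mu _ ≫ ε X)
      unit := by
        apply ext
        change T.map (et (K.obj X) ≫ tr (mu (K.obj X) ≫ ε X)) ≫ ε X = T.map (𝟙 _) ≫ ε X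
        rw [T.map_comp, Category.assoc, tr_ε, reassoc_of% mu_right, T.map_id, Category.id_comp]
      assoc := by
        apply ext
        change T.map (mu _ ≫ _) ≫ _ = _
        rw [T.map_comp, T.map_comp, Category.assoc, Category.assoc, tr_ε, reassoc_of% mu_assoc,
          reassoc_of% mu_nat, tr_ε] }
  have act (B : T.Algebra) : mu B.A ≫ B.a = T.map B.a ≫ B.a := B.assoc
  have actη (B : T.Algebra) : et B.A ≫ B.a = 𝟙 _ := B.unit
  -- A map `f` out of the carrier corresponds to the adjunct of `B.a ≫ f`; the unit of `T` recovers
  -- `f` from it.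
  let e (B : T.Algebra) (X : C) : (T.forget.obj B ⟶ X) ≃ (B ⟶ N X) :=
    { toFun f :=
        { f := tr (B.a ≫ (show B.A ⟶ X from f))
          h := by
            apply ext
            change T.map (T.map (tr _) ≫ tr (mu _ ≫ ε X)) ≫ _ = _
            rw [T.map_comp, T.map_comp, Category.assoc, Category.assoc, tr_ε, tr_ε,
              reassoc_of% mu_nat, tr_ε, reassoc_of% act] }
      invFun g := et B.A ≫ T.map g.f ≫ ε X
      left_inv f := by
        change et B.A ≫ T.map (tr _) ≫ ε X = _
        rw [tr_ε, reassoc_of% actη]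
      right_inv g := by
        ext
        apply ext
        have hg : T.map g.f ≫ tr (mu _ ≫ ε X) = B.a ≫ g.f := g.h
        change T.map (tr (B.a ≫ et B.A ≫ T.map g.f ≫ ε X)) ≫ ε X = _
        rw [tr_ε, reassoc_of% et_nat, ← Category.assoc (T.map B.a), ← T.map_comp, ← hg,
          T.map_comp, Category.assoc, tr_ε, reassoc_of% mu_nat, reassoc_of% mu_left] }
  exact ⟨_, ⟨Adjunction.adjunctionOfEquivRight e (by
    intro B' B X f g
    ext
    apply ext
    change T.map (tr (B'.a ≫ f.f ≫ (show B.A ⟶ X from g))) ≫ _ =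
      T.map (f.f ≫ tr (B.a ≫ (show B.A ⟶ X from g))) ≫ _
    rw [T.map_comp, Category.assoc, tr_ε, tr_ε, f.h_assoc])⟩⟩

end MonadWithRightAdjoint

/-! ### Composite monads from an invertible product map -/

section MonadComposition

variable {C : Type u} [Category.{v} C] {S T F : Monad C}

/-- The natural map `TF ⟶ S` induced by maps of monads `α : T ⟶ S` and `β : F ⟶ S`. -/
def prodHom (α : T ⟶ S) (β : F ⟶ S) (X : C) : T.obj (F.obj X) ⟶ S.obj X :=
  T.map (β.app X) ≫ α.app (S.obj X) ≫ S.μ.app X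

/-- The monad structure of `S` is transported to `TF` along the invertible product map. That map
restricts to `α` and `β` along the units, so the compatibility axioms of a composition reduce to `α`
and `β` being maps of monads; no distributive law has to be constructed. -/
theorem exists_monadComposition (α : T ⟶ S) (β : F ⟶ S) (h : ∀ X, IsIso (prodHom α β X)) :
    ∃ (c : MonadComposition T F) (θ : S ≅ c.monad),
      c.inl ≫ θ.inv = α ∧ c.inr ≫ θ.inv = β := by
  let Tm (X : C) : T.obj (T.obj X) ⟶ T.obj X := T.μ.app X
  let Te (X : C) : X ⟶ T.obj X := T.η.app X
  let Fm (X : C) : F.obj (F.obj X) ⟶ F.obj X := F.μ.app X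
  let Fe (X : C) : X ⟶ F.obj X := F.η.app X
  let Sm (X : C) : S.obj (S.obj X) ⟶ S.obj X := S.μ.app X
  let Se (X : C) : X ⟶ S.obj X := S.η.app X
  let a (X : C) : T.obj X ⟶ S.obj X := α.app X
  let b (X : C) : F.obj X ⟶ S.obj X := β.app X
  have Tm_nat {X Y : C} (f : X ⟶ Y) : T.map (T.map f) ≫ Tm Y = Tm X ≫ T.map f := T.μ.naturality f
  have Te_nat {X Y : C} (f : X ⟶ Y) : f ≫ Te Y = Te X ≫ T.map f := T.η.naturality f
  have Fm_nat {X Y : C} (f : X ⟶ Y) : F.map (F.map f) ≫ Fm Y = Fm X ≫ F.map f := F.μ.naturality f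
  have Fe_nat {X Y : C} (f : X ⟶ Y) : f ≫ Fe Y = Fe X ≫ F.map f := F.η.naturality f
  have Sm_nat {X Y : C} (f : X ⟶ Y) : S.map (S.map f) ≫ Sm Y = Sm X ≫ S.map f := S.μ.naturality f
  have Se_nat {X Y : C} (f : X ⟶ Y) : f ≫ Se Y = Se X ≫ S.map f := S.η.naturality f
  have a_nat {X Y : C} (f : X ⟶ Y) : T.map f ≫ a Y = a X ≫ S.map f := α.naturality f
  have b_nat {X Y : C} (f : X ⟶ Y) : F.map f ≫ b Y = b X ≫ S.map f := β.naturality f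
  have Sm_assoc (X : C) : S.map (Sm X) ≫ Sm X = Sm (S.obj X) ≫ Sm X := S.assoc X
  have Sm_left (X : C) : Se (S.obj X) ≫ Sm X = 𝟙 _ := S.left_unit X
  have Sm_right (X : C) : S.map (Se X) ≫ Sm X = 𝟙 _ := S.right_unit X
  have a_e (X : C) : Te X ≫ a X = Se X := α.app_η X
  have b_e (X : C) : Fe X ≫ b X = Se X := β.app_η X
  have a_m (X : C) : Tm X ≫ a X = T.map (a X) ≫ a (S.obj X) ≫ Sm X :=
    (α.app_μ X).trans (Category.assoc _ _ _)
  have b_m (X : C) : Fm X ≫ b X = F.map (b X) ≫ b (S.obj X) ≫ Sm X :=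
    (β.app_μ X).trans (Category.assoc _ _ _)
  obtain ⟨φ, φ_def, hφ⟩ : ∃ φ : ∀ X, T.obj (F.obj X) ⟶ S.obj X,
      (∀ X, φ X = T.map (b X) ≫ a (S.obj X) ≫ Sm X) ∧ ∀ X, IsIso (φ X) :=
    ⟨_, fun _ => rfl, h⟩
  have φ_nat {X Y : C} (f : X ⟶ Y) : T.map (F.map f) ≫ φ Y = φ X ≫ S.map f := by
    simp only [φ_def, Category.assoc]
    rw [← Sm_nat, reassoc_of% a_nat, ← reassoc_of% a_nat, ← T.map_comp_assoc, b_nat,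
      T.map_comp_assoc, reassoc_of% a_nat]
  have inv_nat {X Y : C} (f : X ⟶ Y) : S.map f ≫ inv (φ Y) = inv (φ X) ≫ T.map (F.map f) := by
    rw [IsIso.comp_inv_eq, Category.assoc, φ_nat, IsIso.inv_hom_id_assoc]
  have inl_φ (X : C) : T.map (Fe X) ≫ φ X = a X := by
    simp only [φ_def]
    rw [← T.map_comp_assoc, b_e, reassoc_of% a_nat, Sm_right, Category.comp_id]
  have inr_φ (X : C) : Te (F.obj X) ≫ φ X = b X := by
    simp only [φ_def]
    rw [← reassoc_of% Te_nat, reassoc_of% a_e, Sm_left, Category.comp_id]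
  -- The multiplication of `S` conjugated by `φ`. Only the equation `m_φ` is used from here on, and
  -- each axiom is checked after composing with the isomorphism `φ`.
  obtain ⟨m, m_φ⟩ : ∃ m : ∀ X, T.obj (F.obj (T.obj (F.obj X))) ⟶ T.obj (F.obj X),
      ∀ X, m X ≫ φ X = T.map (F.map (φ X)) ≫ φ (S.obj X) ≫ Sm X :=
    ⟨fun X => T.map (F.map (φ X)) ≫ φ (S.obj X) ≫ Sm X ≫ inv (φ X), by simp⟩
  have m_nat {X Y : C} (f : X ⟶ Y) :
      T.map (F.map (T.map (F.map f))) ≫ m Y = m X ≫ T.map (F.map f) := by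
    rw [← cancel_mono (φ Y), Category.assoc, m_φ, Category.assoc, φ_nat, reassoc_of% m_φ,
      ← Sm_nat, ← reassoc_of% φ_nat, ← T.map_comp_assoc, ← F.map_comp, φ_nat, F.map_comp,
      T.map_comp_assoc]
  let c : MonadComposition T F :=
    { η := { app X := Se X ≫ inv (φ X)
             naturality X Y f := by
              change f ≫ Se Y ≫ inv (φ Y) = (Se X ≫ inv (φ X)) ≫ T.map (F.map f)
              rw [reassoc_of% Se_nat, inv_nat, Category.assoc] }
      μ := { app X := m X
             naturality X Y f := m_nat f }
      assoc X := by
        change T.map (F.map (m X)) ≫ m X = m _ ≫ m X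
        rw [← cancel_mono (φ X), Category.assoc, m_φ, Category.assoc, m_φ, ← T.map_comp_assoc,
          ← F.map_comp, m_φ, F.map_comp, F.map_comp, T.map_comp, T.map_comp, Category.assoc,
          Category.assoc, reassoc_of% (φ_nat (Sm X)), Sm_assoc, reassoc_of% (φ_nat (φ X)),
          reassoc_of% m_φ, ← reassoc_of% Sm_nat, ← reassoc_of% (φ_nat (S.map (φ X))),
          ← T.map_comp_assoc, ← F.map_comp, φ_nat, F.map_comp, T.map_comp_assoc]
      left_unit X := by
        change (Se _ ≫ inv (φ _)) ≫ m X = 𝟙 _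
        rw [← cancel_mono (φ X), Category.assoc, Category.assoc, m_φ, reassoc_of% φ_nat,
          IsIso.inv_hom_id_assoc, ← reassoc_of% Se_nat, Sm_left]
        simp
      right_unit X := by
        change T.map (F.map (Se _ ≫ inv (φ _))) ≫ m X = 𝟙 _
        rw [← cancel_mono (φ X), Category.assoc, m_φ, ← T.map_comp_assoc,
          ← F.map_comp, Category.assoc, IsIso.inv_hom_id, Category.comp_id, reassoc_of% φ_nat,
          Sm_right]
        simp
      inl_unit X := by
        change Te X ≫ T.map (Fe X) = Se X ≫ inv (φ X)
        rw [← cancel_mono (φ X), Category.assoc, inl_φ, a_e]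
        simp
      inl_mul X := by
        change Tm X ≫ T.map (Fe X) = T.map (T.map (Fe X)) ≫ T.map (Fe _) ≫ m X
        rw [← cancel_mono (φ X), Category.assoc, inl_φ, Category.assoc, Category.assoc, m_φ, a_m,
          ← T.map_comp_assoc (Fe _), ← Fe_nat, T.map_comp_assoc, reassoc_of% inl_φ,
          ← T.map_comp_assoc, inl_φ]
      inr_unit X := by
        change Fe X ≫ Te (F.obj X) = Se X ≫ inv (φ X)
        rw [← cancel_mono (φ X), Category.assoc, inr_φ, b_e]
        simp
      inr_mul X := by
        change Fm X ≫ Te (F.obj X) = F.map (Te (F.obj X)) ≫ Te (F.obj (T.obj (F.obj X))) ≫ m X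
        rw [← cancel_mono (φ X), Category.assoc, inr_φ, Category.assoc, Category.assoc, m_φ, b_m,
          ← reassoc_of% Te_nat, reassoc_of% inr_φ, ← F.map_comp_assoc, inr_φ]
      middle_unit X := by
        change T.map (Fe (F.obj X)) ≫ T.map (F.map (Te (F.obj X))) ≫ m X = 𝟙 _
        rw [← cancel_mono (φ X), Category.assoc, Category.assoc, m_φ,
          ← T.map_comp_assoc (F.map _), ← F.map_comp, inr_φ, ← T.map_comp_assoc, ← Fe_nat,
          T.map_comp_assoc, reassoc_of% inl_φ, Category.id_comp, φ_def] }
  let θ : S ≅ c.monad := MonadIso.mk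
    (NatIso.ofComponents (fun X => (asIso (φ X)).symm) (fun f => inv_nat f))
    (fun X => rfl) (fun X => by
      change Sm X ≫ inv (φ X) = (S.map (inv (φ X)) ≫ inv (φ _)) ≫ m X
      rw [← cancel_mono (φ X), Category.assoc, IsIso.inv_hom_id, Category.comp_id, Category.assoc,
        Category.assoc, m_φ, reassoc_of% φ_nat, IsIso.inv_hom_id_assoc, ← S.map_comp_assoc,
        IsIso.inv_hom_id, S.map_id, Category.id_comp])
  refine ⟨c, θ, ?_, ?_⟩
  · ext X
    exact inl_φ X
  · ext X
    exact inr_φ X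

end MonadComposition

end Plethysm

end

noncomputable section

namespace Plethysm

/-! ### Crude monadicity and comonadicity -/

section Beck

variable {C : Type u} {D : Type w} [Category.{v} C] [Category.{v} D]

/-- All equalizers exist and are preserved, in particular those of the coreflexive pairs in Beck's
criterion. -/
theorem nonempty_comonadicLeftAdjoint (F : C ⥤ D) [F.IsLeftAdjoint] [F.ReflectsIsomorphisms]
    [HasEqualizers C] [PreservesLimitsOfShape WalkingParallelPair F] :
    Nonempty (ComonadicLeftAdjoint F) :=
  have : Comonad.PreservesLimitOfIsCoreflexivePair F := ⟨fun _ _ _ _ _ => inferInstance⟩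
  ⟨Comonad.comonadicOfHasPreservesCoreflexiveEqualizersOfReflectsIsomorphisms
    (Adjunction.ofIsLeftAdjoint F)⟩

theorem nonempty_monadicRightAdjoint (F : C ⥤ D) [F.IsRightAdjoint] [F.ReflectsIsomorphisms]
    [HasCoequalizers C] [PreservesColimitsOfShape WalkingParallelPair F] :
    Nonempty (MonadicRightAdjoint F) :=
  have : Monad.PreservesColimitOfIsReflexivePair F := ⟨fun _ _ _ _ _ => inferInstance⟩
  ⟨Monad.monadicOfHasPreservesReflexiveCoequalizersOfReflectsIsomorphisms
    (Adjunction.ofIsRightAdjoint F)⟩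

end Beck

/-! ### Distributive squares and descent of left adjoints -/

section Distributive

variable {C' C : Type*} {D' : Type u} {D : Type w} [Category* C'] [Category.{v} D'] [Category.{v} D]
  [Category* C]
variable {U' : D' ⥤ C'} {V' : D' ⥤ D} {V : C' ⥤ C} {U : D ⥤ C} (e : U' ⋙ V ≅ V' ⋙ U)
  {R' : D ⥤ D'} (adj' : V' ⊣ R')

/-- A component of a square `U' ⋙ V ≅ V' ⋙ U`, with source and target as iterated applications. -/
abbrev squareApp (H : D') : V.obj (U'.obj H) ⟶ U.obj (V'.obj H) := e.hom.app H

/-- The map `Hom(X, U'R'Z) ⟶ Hom(VX, UZ)` attached to a square `U' ⋙ V ≅ V' ⋙ U` and a right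
adjoint `R'` of `V'`. -/
def squareHom (X : C') (Z : D) (f : X ⟶ U'.obj (R'.obj Z)) : V.obj X ⟶ U.obj Z :=
  V.map f ≫ squareApp e (R'.obj Z) ≫ U.map (adj'.counit.app Z)

lemma squareHom_comp_left {X X' : C'} {Z : D} (g : X' ⟶ X) (f : X ⟶ U'.obj (R'.obj Z)) :
    squareHom e adj' X' Z (g ≫ f) = V.map g ≫ squareHom e adj' X Z f := by
  simp [squareHom]

lemma squareHom_comp_right {X : C'} {Z Z' : D} (f : X ⟶ U'.obj (R'.obj Z)) (h : Z ⟶ Z') :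
    squareHom e adj' X Z' (f ≫ U'.map (R'.map h)) = squareHom e adj' X Z f ≫ U.map h := by
  have h1 : V.map (U'.map (R'.map h)) ≫ squareApp e (R'.obj Z') =
    squareApp e (R'.obj Z) ≫ U.map (V'.map (R'.map h)) := e.hom.naturality (R'.map h)
  have h2 : V'.map (R'.map h) ≫ adj'.counit.app Z' = adj'.counit.app Z ≫ h :=
    adj'.counit.naturality h
  dsimp only [Functor.comp_obj, Functor.id_obj] at h1 h2
  simp only [squareHom, Functor.map_comp, Category.assoc]
  rw [reassoc_of% h1, ← U.map_comp, h2, U.map_comp]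

/-- The unit of an adjunction, with its target written as an iterated application. -/
abbrev unitApp {R' : D ⥤ D'} (adj' : V' ⊣ R') (H : D') : H ⟶ R'.obj (V'.obj H) := adj'.unit.app H

/-- A triangle identity. It gives access to maps into `U'.obj H` for arbitrary `H`, by embedding `H`
in the cofree object `R'.obj (V'.obj H)`. -/
lemma squareHom_unit (H : D') :
    squareHom e adj' (U'.obj H) (V'.obj H) (U'.map (unitApp adj' H)) = squareApp e H := by
  have h1 : V.map (U'.map (unitApp adj' H)) ≫ squareApp e (R'.obj (V'.obj H)) =
      squareApp e H ≫ U.map (V'.map (unitApp adj' H)) := e.hom.naturality (unitApp adj' H)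
  have h2 : V'.map (unitApp adj' H) ≫ adj'.counit.app (V'.obj H) = 𝟙 _ :=
    adj'.left_triangle_components H
  dsimp only [Functor.comp_obj, Functor.id_obj] at h1 h2
  rw [squareHom, reassoc_of% h1, ← U.map_comp, h2, U.map_id, Category.comp_id]

variable (hb : ∀ X Z, Function.Bijective (squareHom e adj' X Z))
include hb

/-- The hypothesis `hb` is the Beck–Chevalley condition for right adjoints, phrased so that `V`
needs none. By Yoneda it suffices to look at maps to `Z`, where composition with the mate is the
chain of bijections Hom(V'T'X, Z) = Hom(T'X, R'Z) = Hom(X, U'R'Z) = Hom(VX, UZ) = Hom(TVX, Z). -/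
theorem isDistributiveSquare_of_bijective {T' : C' ⥤ D'} {T : C ⥤ D} (adjT' : T' ⊣ U')
    (adjT : T ⊣ U) :
    IsIso ((mateEquiv adjT' adjT).symm (TwoSquare.mk U' V' V U e.hom)).natTrans := by
  rw [NatTrans.isIso_iff_isIso_app]
  intro X
  rw [isIso_iff_coyoneda_map_bijective]
  intro Z
  set m := ((mateEquiv adjT' adjT).symm (TwoSquare.mk U' V' V U e.hom)).natTrans.app X with hm
  have key : V.map (adjT'.unit.app X) ≫ squareApp e (T'.obj X) =
      adjT.unit.app (V.obj X) ≫ U.map m :=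
    unit_mateEquiv_symm adjT' adjT (TwoSquare.mk U' V' V U e.hom) X
  have h2 (h : V'.obj (T'.obj X) ⟶ Z) : adjT.homEquiv _ _ (m ≫ h) =
      squareHom e adj' X Z (adjT'.homEquiv _ _ (adj'.homEquiv _ _ h)) := by
    rw [adjT.homEquiv_unit, adjT'.homEquiv_unit, adj'.homEquiv_unit, squareHom_comp_left,
      U'.map_comp, squareHom_comp_right]
    refine Eq.trans ?_ (congrArg (fun t => V.map (adjT'.unit.app X) ≫ t ≫ U.map h)
      (squareHom_unit e adj' (T'.obj X)).symm)
    rw [U.map_comp, ← reassoc_of% key]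
  have h3 : (fun h : V'.obj (T'.obj X) ⟶ Z => m ≫ h) =
      (adjT.homEquiv _ _).symm ∘ squareHom e adj' X Z ∘ (adjT'.homEquiv _ _) ∘
        (adj'.homEquiv _ _) := by
    funext h
    simp only [Function.comp_apply, ← h2, Equiv.symm_apply_apply]
  exact h3 ▸ (Equiv.bijective _).comp ((hb X Z).comp ((Equiv.bijective _).comp
    (Equiv.bijective _)))

variable [HasEqualizers D'] [PreservesLimitsOfShape WalkingParallelPair V']
  [V'.ReflectsIsomorphisms] [PreservesLimitsOfShape WalkingParallelPair U'] [U.IsRightAdjoint]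

/-- If `T'` exists, then `V'T'X` has to be `TVX`. So one equips `TVX` with a coaction of the comonad
of `V' ⊣ R'` and lets `T'X` be the object of `D'` with this coalgebra. Its universal property is
known for cofree targets by `hb`, and extends to every target because that is an equalizer of cofree
ones and `U'` preserves the equalizer. -/
theorem isRightAdjoint_of_bijective (comon : (Comonad.comparison adj').IsEquivalence) :
    U'.IsRightAdjoint := by
  let T := U.leftAdjoint
  let adjT : T ⊣ U := Adjunction.ofIsRightAdjoint U
  suffices ∀ X, HasInitial (StructuredArrow X U') from isRightAdjointOfStructuredArrowInitials U'
  intro X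
  let N := T.obj (V.obj X)
  let u : V.obj X ⟶ U.obj N := adjT.unit.app (V.obj X)
  have tr {Z : D} (g : V.obj X ⟶ U.obj Z) : ∃ h : N ⟶ Z, u ≫ U.map h = g :=
    ⟨(adjT.homEquiv _ _).symm g, by
      rw [← adjT.homEquiv_unit, Equiv.apply_symm_apply]⟩
  have tr_ext {Z : D} (h h' : N ⟶ Z) (hh : u ≫ U.map h = u ≫ U.map h') : h = h' :=
    (adjT.homEquiv _ _).injective (by rwa [adjT.homEquiv_unit, adjT.homEquiv_unit])
  clear_value u N
  -- By `hb` the unit `u` corresponds to a map `k` from `X` to the cofree object on `N`; the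
  -- coaction `κ` is then forced by the universal property of `N`.
  obtain ⟨k, hk⟩ := (hb X N).2 u
  obtain ⟨κ, hκ⟩ : ∃ κ : N ⟶ V'.obj (R'.obj N), u ≫ U.map κ = V.map k ≫ squareApp e (R'.obj N) :=
    tr (V.map k ≫ squareApp e (R'.obj N))
  have hk' : V.map k ≫ squareApp e (R'.obj N) ≫ U.map (adj'.counit.app N) = u := hk
  have counit : κ ≫ adj'.counit.app N = 𝟙 N := by
    apply tr_ext
    rw [U.map_comp, reassoc_of% hκ, hk']
    simp
  have kκ : k ≫ U'.map (R'.map κ) = k ≫ U'.map (unitApp adj' (R'.obj N)) := by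
    apply (hb X _).1
    rw [squareHom_comp_right, squareHom_comp_left, squareHom_unit, hk, hκ]
  have coassoc : κ ≫ V'.map (unitApp adj' (R'.obj N)) = κ ≫ V'.map (R'.map κ) := by
    apply tr_ext
    have n1 : V.map (U'.map (R'.map κ)) ≫ squareApp e (R'.obj (V'.obj (R'.obj N))) =
      squareApp e (R'.obj N) ≫ U.map (V'.map (R'.map κ)) := e.hom.naturality (R'.map κ)
    have n2 : V.map (U'.map (unitApp adj' (R'.obj N))) ≫
        squareApp e (R'.obj (V'.obj (R'.obj N))) =
      squareApp e (R'.obj N) ≫ U.map (V'.map (unitApp adj' (R'.obj N))) :=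
      e.hom.naturality (unitApp adj' (R'.obj N))
    rw [U.map_comp, U.map_comp, reassoc_of% hκ, reassoc_of% hκ, ← n1, ← n2,
      ← V.map_comp_assoc, ← V.map_comp_assoc, kκ]
  let Q : adj'.toComonad.Coalgebra :=
    { A := N, a := κ, counit := counit, coassoc := coassoc }
  obtain ⟨G, ⟨i⟩⟩ := Functor.EssSurj.mem_essImage (F := Comonad.comparison adj') Q
  let i₁ : V'.obj G ⟶ N := i.hom.f
  let i₂ : N ⟶ V'.obj G := i.inv.f
  have i₁₂ : i₁ ≫ i₂ = 𝟙 _ := congrArg Comonad.Coalgebra.Hom.f i.hom_inv_id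
  have i₂₁ : i₂ ≫ i₁ = 𝟙 _ := congrArg Comonad.Coalgebra.Hom.f i.inv_hom_id
  have hi₁ : V'.map (unitApp adj' G) ≫ V'.map (R'.map i₁) = i₁ ≫ κ := i.hom.h
  have hi₂ : κ ≫ V'.map (R'.map i₂) = i₂ ≫ V'.map (unitApp adj' G) := i.inv.h
  have e_nat {H H' : D'} (φ : H ⟶ H') : V.map (U'.map φ) ≫ squareApp e H' =
    squareApp e H ≫ U.map (V'.map φ) := e.hom.naturality φ
  have sq {H : D'} (a : X ⟶ U'.obj H) : squareHom e adj' X (V'.obj H)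
      (a ≫ U'.map (unitApp adj' H)) = V.map a ≫ squareApp e H := by
    rw [squareHom_comp_left, squareHom_unit]
  -- The cofree resolution of `H` is an equalizer: its image under `V'` is split, and `V'` reflects
  -- equalizers, being conservative and preserving them. Applying `U'` keeps it an equalizer.
  have lim (H : D') : IsLimit (Comonad.ComonadicityInternal.unitFork (adj := adj') H) :=
    have : ReflectsLimit (parallelPair (R'.map (V'.map (adj'.unit.app H)))
      (adj'.unit.app (R'.obj (V'.obj H)))) V' := reflectsLimit_of_reflectsIsomorphisms _ _
    Comonad.ComonadicityInternal.unitEqualizerOfCoreflectsEqualizer adj' H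
  have lim' (H : D') := isLimitForkMapOfIsLimit U' _ (lim H)
  have uniq {H : D'} (a a' : X ⟶ U'.obj H)
      (h : V.map a ≫ squareApp e H = V.map a' ≫ squareApp e H) : a = a' :=
    Fork.IsLimit.hom_ext (lim' H) ((hb X _).1 ((sq a).trans (h.trans (sq a').symm)))
  -- If `h` respects the coactions, then `k ≫ U'.map (R'.map h)` equalizes the resolution of `H`, so
  -- it descends to a map into `U'.obj H`.
  have lift {H : D'} (h : N ⟶ V'.obj H)
      (hh : κ ≫ V'.map (R'.map h) = h ≫ V'.map (unitApp adj' H)) :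
      ∃ a : X ⟶ U'.obj H, V.map a ≫ squareApp e H = u ≫ U.map h := by
    have h1 : squareHom e adj' X _ (k ≫ U'.map (R'.map h)) = u ≫ U.map h := by
      rw [squareHom_comp_right, hk]
    have h2 : (k ≫ U'.map (R'.map h)) ≫ U'.map (R'.map (V'.map (unitApp adj' H))) =
        (k ≫ U'.map (R'.map h)) ≫ U'.map (unitApp adj' (R'.obj (V'.obj H))) := by
      apply (hb X _).1
      rw [squareHom_comp_right, h1, sq, V.map_comp, Category.assoc (u), Category.assoc (V.map k),
        e_nat, ← reassoc_of% hκ, ← U.map_comp, ← U.map_comp, hh]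
    obtain ⟨a, ha⟩ := Fork.IsLimit.lift' (lim' H) _ h2
    replace ha : a ≫ U'.map (unitApp adj' H) = k ≫ U'.map (R'.map h) := ha
    exact ⟨a, (sq a).symm.trans ((congrArg (squareHom e adj' X _) ha).trans h1)⟩
  obtain ⟨a₀, ha₀⟩ := lift i₂ hi₂
  have uniq' {H : D'} (φ φ' : G ⟶ H) (h : a₀ ≫ U'.map φ = a₀ ≫ U'.map φ') : φ = φ' := by
    apply (Comonad.comparison adj').map_injective
    ext
    change V'.map φ = V'.map φ'
    have h1 := congrArg (fun t => V.map t ≫ squareApp e H) h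
    simp only [V.map_comp, Category.assoc, e_nat] at h1
    rw [reassoc_of% ha₀, reassoc_of% ha₀, ← U.map_comp, ← U.map_comp] at h1
    rw [← Category.id_comp (V'.map φ), ← i₁₂, Category.assoc, tr_ext _ _ h1, reassoc_of% i₁₂]
  -- The adjunct `h` of the given map turns out to be a map of coalgebras; fullness of the
  -- comparison functor realizes it, after the identification `i₁`, by a map out of `G`.
  have ex (Y : StructuredArrow X U') : ∃ φ : G ⟶ Y.right, a₀ ≫ U'.map φ = Y.hom := by
    let f : X ⟶ U'.obj Y.right := Y.hom
    obtain ⟨h, hh⟩ := tr (V.map f ≫ squareApp e Y.right)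
    have h1 : k ≫ U'.map (R'.map h) = f ≫ U'.map (unitApp adj' Y.right) := by
      apply (hb X _).1
      rw [squareHom_comp_right, hk, sq, hh]
    have h2 : κ ≫ V'.map (R'.map h) = h ≫ V'.map (unitApp adj' Y.right) := by
      apply tr_ext
      rw [U.map_comp, U.map_comp, reassoc_of% hκ, reassoc_of% hh, ← e_nat, ← e_nat,
        ← V.map_comp_assoc, ← V.map_comp_assoc, h1]
    let ψ : (Comonad.comparison adj').obj G ⟶ (Comonad.comparison adj').obj Y.right :=
      { f := i₁ ≫ h
        h := by
          change V'.map (unitApp adj' G) ≫ V'.map (R'.map (i₁ ≫ h)) =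
            (i₁ ≫ h) ≫ V'.map (unitApp adj' Y.right)
          rw [R'.map_comp, V'.map_comp, reassoc_of% hi₁, h2, Category.assoc] }
    obtain ⟨φ, hφ⟩ := (Comonad.comparison adj').map_surjective ψ
    replace hφ : V'.map φ = i₁ ≫ h := congrArg Comonad.Coalgebra.Hom.f hφ
    refine ⟨φ, uniq _ f ?_⟩
    rw [V.map_comp, Category.assoc, e_nat, reassoc_of% ha₀, hφ, ← U.map_comp,
      reassoc_of% i₂₁, hh]
  exact IsInitial.hasInitial (X := StructuredArrow.mk a₀) (IsInitial.ofUniqueHom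
    (fun Y => StructuredArrow.homMk (ex Y).choose (ex Y).choose_spec) (fun Y m => by
      ext
      exact uniq' _ _ ((StructuredArrow.w m).trans (ex Y).choose_spec.symm)))

end Distributive

end Plethysm

end

noncomputable section

namespace Plethysm

/-! ### Equalizers of commutative group objects -/

section CommGrpLimits

open scoped MonObj

variable {C : Type u} [Category.{v} C] [CartesianMonoidalCategory C] [BraidedCategory C]

/-- A subobject of a commutative group object closed under the group operations. -/
abbrev commGrpOfMono {G : CommGrp C} {E : C} (i : E ⟶ G.X) [Mono i] (o : 𝟙_ C ⟶ E)
    (m : E ⊗ E ⟶ E) (n : E ⟶ E) (ho : o ≫ i = η[G.X]) (hm : m ≫ i = (i ⊗ₘ i) ≫ μ[G.X])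
    (hn : n ≫ i = i ≫ GrpObj.inv) : CommGrp C :=
  letI mon : MonObj E :=
    { one := o
      mul := m
      one_mul := by
        rw [← cancel_mono i, Category.assoc, hm, ← tensorHom_id, tensorHom_comp_tensorHom_assoc,
          ho, Category.id_comp, tensorHom_def', Category.assoc, MonObj.one_mul,
          leftUnitor_naturality]
      mul_one := by
        rw [← cancel_mono i, Category.assoc, hm, ← id_tensorHom, tensorHom_comp_tensorHom_assoc,
          ho, Category.id_comp, MonoidalCategory.tensorHom_def, Category.assoc, MonObj.mul_one,
          rightUnitor_naturality]
      mul_assoc := by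
        rw [← cancel_mono i]
        simp only [Category.assoc, hm]
        rw [← tensorHom_id, ← id_tensorHom, tensorHom_comp_tensorHom_assoc,
          tensorHom_comp_tensorHom_assoc, hm, Category.id_comp]
        have h1 : ((i ⊗ₘ i) ≫ μ ⊗ₘ i) ≫ μ[G.X] = ((i ⊗ₘ i) ⊗ₘ i) ≫ μ ▷ _ ≫ μ := by
          rw [← tensorHom_id, tensorHom_comp_tensorHom_assoc, Category.comp_id]
        have h2 : (i ⊗ₘ (i ⊗ₘ i) ≫ μ) ≫ μ[G.X] = (i ⊗ₘ (i ⊗ₘ i)) ≫ _ ◁ μ ≫ μ := by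
          rw [← id_tensorHom, tensorHom_comp_tensorHom_assoc, Category.comp_id]
        rw [h1, h2, MonObj.mul_assoc, associator_naturality_assoc] }
  letI grp : GrpObj E :=
    { mon with
      inv := n
      left_inv := by
        rw [← cancel_mono i]
        change (_ ≫ m) ≫ i = (_ ≫ o) ≫ i
        rw [Category.assoc, Category.assoc, hm, ho, CartesianMonoidalCategory.lift_map_assoc, hn,
          Category.id_comp, ← Category.comp_id i, Category.assoc, Category.id_comp,
          ← CartesianMonoidalCategory.comp_lift_assoc, GrpObj.left_inv]
        simp
      right_inv := by
        rw [← cancel_mono i]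
        change (_ ≫ m) ≫ i = (_ ≫ o) ≫ i
        rw [Category.assoc, Category.assoc, hm, ho, CartesianMonoidalCategory.lift_map_assoc, hn,
          Category.id_comp, ← Category.comp_id i, Category.assoc, Category.id_comp,
          ← CartesianMonoidalCategory.comp_lift_assoc, GrpObj.right_inv]
        simp }
  { X := E
    grp := grp
    comm :=
      { mul_comm := by
          rw [← cancel_mono i]
          change ((β_ _ _).hom ≫ m) ≫ i = m ≫ i
          rw [Category.assoc, hm, ← BraidedCategory.braiding_naturality_assoc,
            IsCommMonObj.mul_comm] } }

/-- A homomorphism of commutative group objects given by a map preserving the operations. -/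
abbrev commGrpHomMk {G H : CommGrp C} (f : G.X ⟶ H.X) [h : IsMonHom f] : G ⟶ H :=
  InducedCategory.homMk (Grp.homMk' (Mon.Hom.mk' f h.one_hom h.mul_hom))

/-- The map of underlying objects of a homomorphism of commutative group objects. -/
abbrev commGrpHom {G H : CommGrp C} (f : G ⟶ H) : G.X ⟶ H.X := f.hom.hom.hom

instance commGrpForget_reflectsIso : (CommGrp.forget C).ReflectsIsomorphisms where
  reflects {G H} f hf := by
    have : IsIso (commGrpHom f) := hf
    have h : f = (CommGrp.mkIso (asIso (commGrpHom f)) (IsMonHom.one_hom f.hom.hom.hom)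
      (IsMonHom.mul_hom f.hom.hom.hom)).hom := rfl
    rw [h]
    infer_instance

variable [HasEqualizers C]

section

variable {G H : CommGrp C} (f g : G ⟶ H)

instance isMonHom_commGrpHom : IsMonHom (commGrpHom f) := f.hom.hom.isMonHom_hom

/-- The equalizer of two homomorphisms of commutative group objects. -/
def commGrpEqualizer : CommGrp C :=
  commGrpOfMono (G := G) (equalizer.ι (commGrpHom f) (commGrpHom g))
    (equalizer.lift η[G.X] (by rw [IsMonHom.one_hom, IsMonHom.one_hom]))
    (equalizer.lift ((equalizer.ι (commGrpHom f) (commGrpHom g) ⊗ₘ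
        equalizer.ι (commGrpHom f) (commGrpHom g)) ≫ μ[G.X]) (by
      rw [Category.assoc, Category.assoc, IsMonHom.mul_hom, IsMonHom.mul_hom,
        tensorHom_comp_tensorHom_assoc, tensorHom_comp_tensorHom_assoc, equalizer.condition]))
    (equalizer.lift (equalizer.ι (commGrpHom f) (commGrpHom g) ≫ GrpObj.inv) (by
      rw [Category.assoc, Category.assoc, GrpObj.inv_hom, GrpObj.inv_hom,
        equalizer.condition_assoc]))
    (equalizer.lift_ι _ _) (equalizer.lift_ι _ _) (equalizer.lift_ι _ _)

/-- The map of underlying objects of the inclusion of the equalizer. -/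
def commGrpEqualizerMap : (commGrpEqualizer f g).X ⟶ G.X :=
  equalizer.ι (commGrpHom f) (commGrpHom g)

instance : Mono (commGrpEqualizerMap f g) :=
  inferInstanceAs (Mono (equalizer.ι (commGrpHom f) (commGrpHom g)))

instance : IsMonHom (commGrpEqualizerMap f g) where
  one_hom := equalizer.lift_ι _ _
  mul_hom := equalizer.lift_ι _ _

/-- The inclusion of the equalizer. -/
def commGrpEqualizerι : commGrpEqualizer f g ⟶ G :=
  commGrpHomMk (commGrpEqualizerMap f g)

lemma commGrpEqualizer_condition : commGrpEqualizerι f g ≫ f = commGrpEqualizerι f g ≫ g :=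
  CommGrp.hom_ext _ _ (equalizer.condition (commGrpHom f) (commGrpHom g))

/-- The universal property of the equalizer. -/
def commGrpEqualizerIsLimit :
    IsLimit (Fork.ofι (commGrpEqualizerι f g) (commGrpEqualizer_condition f g)) :=
  Fork.IsLimit.mk' _ fun s => by
    have hs : commGrpHom s.ι ≫ commGrpHom f = commGrpHom s.ι ≫ commGrpHom g :=
      congrArg commGrpHom s.condition
    let l : s.pt.X ⟶ (commGrpEqualizer f g).X := equalizer.lift (commGrpHom s.ι) hs
    have hl : l ≫ commGrpEqualizerMap f g = commGrpHom s.ι := equalizer.lift_ι _ _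
    have hm : IsMonHom l :=
      { one_hom := by
          rw [← cancel_mono (commGrpEqualizerMap f g), Category.assoc, hl, IsMonHom.one_hom,
            IsMonHom.one_hom]
        mul_hom := by
          rw [← cancel_mono (commGrpEqualizerMap f g), Category.assoc, hl, IsMonHom.mul_hom,
            Category.assoc, IsMonHom.mul_hom, tensorHom_comp_tensorHom_assoc, hl] }
    exact ⟨commGrpHomMk l, CommGrp.hom_ext _ _ hl, fun {m} hm => CommGrp.hom_ext _ _
      ((cancel_mono (commGrpEqualizerMap f g)).1 ((congrArg commGrpHom hm).trans hl.symm))⟩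

end

instance hasEqualizers_commGrp : HasEqualizers (CommGrp C) :=
  have (G H : CommGrp C) (f g : G ⟶ H) : HasLimit (parallelPair f g) :=
    ⟨⟨⟨_, commGrpEqualizerIsLimit f g⟩⟩⟩
  hasEqualizers_of_hasLimit_parallelPair _

instance preservesEqualizers_commGrpForget :
    PreservesLimitsOfShape WalkingParallelPair (CommGrp.forget C) where
  preservesLimit {K} := by
    have (G H : CommGrp C) (f g : G ⟶ H) : PreservesLimit (parallelPair f g) (CommGrp.forget C) :=
      preservesLimit_of_preserves_limit_cone (commGrpEqualizerIsLimit f g)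
        ((isLimitMapConeForkEquiv _ _).symm
          (show IsLimit (Fork.ofι (f := commGrpHom f) (g := commGrpHom g)
            (equalizer.ι (commGrpHom f) (commGrpHom g)) _) from
            equalizerIsEqualizer (commGrpHom f) (commGrpHom g)))
    exact preservesLimit_of_iso_diagram _ (diagramIsoParallelPair K).symm

variable {D : Type w} [Category.{v} D] [CartesianMonoidalCategory D] [BraidedCategory D]
  [HasEqualizers D]

instance preservesEqualizers_mapCommGrp (F : C ⥤ D) [F.Braided]
    [PreservesLimitsOfShape WalkingParallelPair F] :
    PreservesLimitsOfShape WalkingParallelPair F.mapCommGrp := by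
  have : ReflectsLimitsOfShape WalkingParallelPair (CommGrp.forget D) :=
    reflectsLimitsOfShape_of_reflectsIsomorphisms
  have : PreservesLimitsOfShape WalkingParallelPair (F.mapCommGrp ⋙ CommGrp.forget D) :=
    inferInstanceAs (PreservesLimitsOfShape WalkingParallelPair (CommGrp.forget C ⋙ F))
  exact preservesLimitsOfShape_of_reflects_of_preserves F.mapCommGrp (CommGrp.forget D)

instance reflectsIso_mapCommGrp (F : C ⥤ D) [F.Braided] [F.ReflectsIsomorphisms] :
    F.mapCommGrp.ReflectsIsomorphisms where
  reflects f hf := by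
    have : IsIso ((CommGrp.forget C ⋙ F).map f) :=
      inferInstanceAs (IsIso ((CommGrp.forget D).map (F.mapCommGrp.map f)))
    exact isIso_of_reflects_iso f (CommGrp.forget C ⋙ F)

end CommGrpLimits

end Plethysm

end

noncomputable section

namespace Plethysm

/-! ### Products of generalized elements, and Eckmann–Hilton for ideals -/

section RingsOver

open scoped MonObj

attribute [local instance] Over.cartesianMonoidalCategory Over.braidedCategory

variable {A : Type u} [Category.{v} A] [MonoidalCategory A] [SymmetricCategory A]

/-- The product of two generalized elements of a ring. -/
def tmul {S : CommMon A} {Z W : A} (f : Z ⟶ S.X) (g : W ⟶ S.X) : Z ⊗ W ⟶ S.X :=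
  (f ⊗ₘ g) ≫ μ[S.X]

section
variable {S S' : CommMon A} {Z W Z' W' Y : A}

lemma comp_tmul (h : Z' ⟶ Z) (k : W' ⟶ W) (f : Z ⟶ S.X) (g : W ⟶ S.X) :
    (h ⊗ₘ k) ≫ tmul f g = tmul (h ≫ f) (k ≫ g) := by
  simp [tmul, tensorHom_comp_tensorHom_assoc]

lemma whiskerRight_tmul (h : Z' ⟶ Z) (f : Z ⟶ S.X) (g : W ⟶ S.X) :
    h ▷ W ≫ tmul f g = tmul (h ≫ f) g := by
  rw [← tensorHom_id, comp_tmul, Category.id_comp]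

lemma whiskerLeft_tmul (h : W' ⟶ W) (f : Z ⟶ S.X) (g : W ⟶ S.X) :
    Z ◁ h ≫ tmul f g = tmul f (h ≫ g) := by
  rw [← id_tensorHom, comp_tmul, Category.id_comp]

lemma tmul_und (f : Z ⟶ S.X) (g : W ⟶ S.X) (k : S ⟶ S') :
    tmul f g ≫ und k = tmul (f ≫ und k) (g ≫ und k) := by
  simp only [tmul, Category.assoc]
  rw [IsMonHom.mul_hom (und k), tensorHom_comp_tensorHom_assoc]

lemma braiding_tmul (f : Z ⟶ S.X) (g : W ⟶ S.X) :
    (β_ W Z).hom ≫ tmul f g = tmul g f := by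
  have := S.comm
  rw [tmul, ← BraidedCategory.braiding_naturality_assoc, IsCommMonObj.mul_comm, tmul]

lemma tmul_assoc (f : Z ⟶ S.X) (g : W ⟶ S.X) (h : Y ⟶ S.X) :
    tmul (tmul f g) h = (α_ _ _ _).hom ≫ tmul f (tmul g h) := by
  have h1 : tmul (tmul f g) h = ((f ⊗ₘ g) ⊗ₘ h) ≫ μ[S.X] ▷ _ ≫ μ[S.X] := by
    rw [← tensorHom_id, tensorHom_comp_tensorHom_assoc, Category.comp_id]; rfl
  have h2 : tmul f (tmul g h) = (f ⊗ₘ (g ⊗ₘ h)) ≫ _ ◁ μ[S.X] ≫ μ[S.X] := by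
    rw [← id_tensorHom, tensorHom_comp_tensorHom_assoc, Category.comp_id]; rfl
  rw [h1, h2, MonObj.mul_assoc, associator_naturality_assoc]

lemma one_tmul (f : Z ⟶ S.X) : tmul η[S.X] f = (λ_ Z).hom ≫ f := by
  rw [tmul, tensorHom_def', Category.assoc, MonObj.one_mul, leftUnitor_naturality]

lemma mul_eq_tmul : μ[S.X] = tmul (𝟙 S.X) (𝟙 S.X) := by
  simp [tmul]

lemma und_one (k : S ⟶ S') : η[S.X] ≫ und k = η[S'.X] := IsMonHom.one_hom (und k)

lemma und_mul_hom (k : S ⟶ S') : μ[S.X] ≫ und k = tmul (und k) (und k) :=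
  IsMonHom.mul_hom (und k)

lemma und_injective {f g : S ⟶ S'} (h : und f = und g) : f = g :=
  CommMon.hom_ext _ _ h

/-- A map of rings given by a map preserving unit and multiplication. -/
def ringHom (f : S.X ⟶ S'.X) (h1 : η[S.X] ≫ f = η[S'.X]) (hm : μ[S.X] ≫ f = tmul f f) :
    S ⟶ S' :=
  CommMon.homMk { hom := f, isMonHom_hom := { one_hom := h1, mul_hom := hm } }

variable [Preadditive A] [MonoidalPreadditive A]

lemma add_tmul (f f' : Z ⟶ S.X) (g : W ⟶ S.X) : tmul (f + f') g = tmul f g + tmul f' g := by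
  simp [tmul, MonoidalPreadditive.add_tensor]

lemma tmul_add (f : Z ⟶ S.X) (g g' : W ⟶ S.X) : tmul f (g + g') = tmul f g + tmul f g' := by
  simp [tmul, MonoidalPreadditive.tensor_add]

lemma zero_tmul (g : W ⟶ S.X) : tmul (0 : Z ⟶ S.X) g = 0 := by simp [tmul]

lemma tmul_zero (g : Z ⟶ S.X) : tmul g (0 : W ⟶ S.X) = 0 := by simp [tmul]

end

variable [HasFiniteLimits A]

instance preservesLimit_cospan_forget {R S T : CommMon A} (f : R ⟶ T) (g : S ⟶ T) :
    PreservesLimit (cospan f g) (CommMon.forget A) := by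
  have : PreservesLimitsOfShape WalkingCospan (CommMon.forget₂Mon A) := inferInstance
  have : PreservesLimitsOfShape WalkingCospan (Mon.forget A) := inferInstance
  have : PreservesLimitsOfShape WalkingCospan (CommMon.forget A) :=
    inferInstanceAs (PreservesLimitsOfShape WalkingCospan (CommMon.forget₂Mon A ⋙ Mon.forget A))
  infer_instance

/-- Products in the slice are pullbacks of rings, and these are computed in the base category. -/
lemma und_tensor_hom_ext {R : CommMon A} {X Y : Over R} {Z : A} {a b : Z ⟶ (X ⊗ Y).left.X}
    (h₁ : a ≫ und (SemiCartesianMonoidalCategory.fst X Y).left =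
      b ≫ und (SemiCartesianMonoidalCategory.fst X Y).left)
    (h₂ : a ≫ und (SemiCartesianMonoidalCategory.snd X Y).left =
      b ≫ und (SemiCartesianMonoidalCategory.snd X Y).left) : a = b := by
  have h := isLimitOfHasPullbackOfPreservesLimit (CommMon.forget A) X.hom Y.hom
  exact PullbackCone.IsLimit.hom_ext h h₁ h₂

instance {C : Type*} [Category* C] [HasPullbacks C] {X : C} (G : AbOver X) :
    GrpObj G.toOver := G.grp

instance {C : Type*} [Category* C] [HasPullbacks C] {X : C} (G : AbOver X) :
    IsCommMonObj G.toOver := G.comm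

lemma AbOver.one_left {C : Type*} [Category* C] [HasPullbacks C] {R : C} (G : AbOver R)
    (X : Over R) : ((1 : X ⟶ G.toOver)).left = X.hom ≫ G.zero := rfl

variable [Preadditive A] 

lemma zero_und {R : CommMon A} (G : AbOver R) : und G.zero ≫ und G.toOver.hom = 𝟙 R.X :=
  congrArg und (AbOver.zero_hom G)

lemma und_w {R : CommMon A} {X Y : Over R} (x : X ⟶ Y) : und x.left ≫ und Y.hom = und X.hom :=
  congrArg und (Over.w x)

/-- Elements of a fibre product are pairs, and in each coordinate the right-hand side telescopes. -/
lemma und_lift {R : CommMon A} {X Y Z : Over R} (x : X ⟶ Y) (x' : X ⟶ Y) (y : X ⟶ Z) (y' : X ⟶ Z) :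
    und (CartesianMonoidalCategory.lift x y).left =
      und (CartesianMonoidalCategory.lift x y').left +
      und (CartesianMonoidalCategory.lift x' y).left -
      und (CartesianMonoidalCategory.lift x' y').left := by
  have h1 (a : X ⟶ Y) (b : X ⟶ Z) : und (CartesianMonoidalCategory.lift a b).left ≫
      und (SemiCartesianMonoidalCategory.fst Y Z).left = und a.left := by
    rw [← und_comp, ← Over.comp_left, CartesianMonoidalCategory.lift_fst]
  have h2 (a : X ⟶ Y) (b : X ⟶ Z) : und (CartesianMonoidalCategory.lift a b).left ≫
      und (SemiCartesianMonoidalCategory.snd Y Z).left = und b.left := by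
    rw [← und_comp, ← Over.comp_left, CartesianMonoidalCategory.lift_snd]
  apply und_tensor_hom_ext
  · simp only [Preadditive.add_comp, Preadditive.sub_comp, h1]; abel
  · simp only [Preadditive.add_comp, Preadditive.sub_comp, h2]; abel

/-- The sum of two maps into an abelian group object over `R`, on underlying objects. -/
lemma und_mul {R : CommMon A} (G : AbOver R) {X : Over R} (x y : X ⟶ G.toOver) :
    und (x * y).left = und x.left + und y.left - und X.hom ≫ und G.zero := by
  have h (a b : X ⟶ G.toOver) : und (a * b).left =
    und (CartesianMonoidalCategory.lift a b).left ≫ und (μ[G.toOver]).left := rfl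
  -- Additively `(x, y) = (x, 0) + (0, y) - (0, 0)`, where `0` is the zero section. The group law is
  -- a morphism of the preadditive base category, so it is applied term by term.
  rw [h, und_lift x 1 y 1, Preadditive.sub_comp, Preadditive.add_comp, ← h, ← h, ← h]
  simp [AbOver.one_left]

variable [MonoidalPreadditive A]

/-- Eckmann-Hilton: the augmentation ideal of an abelian group object squares to zero. -/
lemma idealMul_toOver {R : CommMon A} (G : AbOver R) : idealMul G.toOver = 0 := by
  -- Here `p` and `q` are `x ↦ (x, 0)` and `x ↦ (0, x)`. For elements of the ideal, `p x * q y` has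
  -- a zero factor in each coordinate, while the group law sends it to `x * y`.
  let p : G.toOver ⟶ G.toOver ⊗ G.toOver := CartesianMonoidalCategory.lift (𝟙 _) 1
  let q : G.toOver ⟶ G.toOver ⊗ G.toOver := CartesianMonoidalCategory.lift 1 (𝟙 _)
  have hp : p ≫ μ[G.toOver] = 𝟙 _ := mul_one (𝟙 G.toOver)
  have hq : q ≫ μ[G.toOver] = 𝟙 _ := one_mul (𝟙 G.toOver)
  have hp' : und p.left ≫ und (μ[G.toOver]).left = 𝟙 _ := congrArg (fun x : G.toOver ⟶ G.toOver => und x.left) hp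
  have hq' : und q.left ≫ und (μ[G.toOver]).left = 𝟙 _ := congrArg (fun x : G.toOver ⟶ G.toOver => und x.left) hq
  have h1 : und p.left ≫ und (SemiCartesianMonoidalCategory.fst G.toOver G.toOver).left = 𝟙 _ := by
    rw [← und_comp, ← Over.comp_left, CartesianMonoidalCategory.lift_fst]; rfl
  have h2 : und p.left ≫ und (SemiCartesianMonoidalCategory.snd G.toOver G.toOver).left =
      und G.toOver.hom ≫ und G.zero := by
    rw [← und_comp, ← Over.comp_left, CartesianMonoidalCategory.lift_snd]; rfl
  have h3 : und q.left ≫ und (SemiCartesianMonoidalCategory.snd G.toOver G.toOver).left = 𝟙 _ := by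
    rw [← und_comp, ← Over.comp_left, CartesianMonoidalCategory.lift_snd]; rfl
  have h4 : und q.left ≫ und (SemiCartesianMonoidalCategory.fst G.toOver G.toOver).left =
      und G.toOver.hom ≫ und G.zero := by
    rw [← und_comp, ← Over.comp_left, CartesianMonoidalCategory.lift_fst]; rfl
  have key : tmul (idealι G.toOver ≫ und p.left) (idealι G.toOver ≫ und q.left) = 0 := by
    apply und_tensor_hom_ext
    · rw [tmul_und, zero_comp, Category.assoc, Category.assoc, h1, h4, idealι_und_assoc,
        tmul_zero]
    · rw [tmul_und, zero_comp, Category.assoc, Category.assoc, h2, h3, idealι_und_assoc,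
        zero_tmul]
  have key' := congrArg (· ≫ und (μ[G.toOver]).left) key
  simp only [zero_comp, tmul_und, Category.assoc, hp', hq', Category.comp_id] at key'
  rw [← cancel_mono (idealι G.toOver), idealMul_ι, zero_comp]
  exact key'

end RingsOver
end Plethysm

end

noncomputable section

namespace Plethysm

/-! ### Modules over a commutative ring, in generalized elements -/

section ModulesOver

open scoped MonObj

variable {A : Type u} [Category.{v} A] [MonoidalCategory A] [SymmetricCategory A]
  {R : CommMon A} (N N' : (tensorMonad R).Algebra)

/-- The action of a module. -/
def act : R.X ⊗ N.A ⟶ N.A := N.a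

/-- The product of a generalized element of a ring and one of a module. -/
def tact {Z W : A} (f : Z ⟶ R.X) (n : W ⟶ N.A) : Z ⊗ W ⟶ N.A := (f ⊗ₘ n) ≫ act N

lemma act_unit : (λ_ N.A).inv ≫ η[R.X] ▷ N.A ≫ act N = 𝟙 N.A := by
  rw [← Category.assoc]; exact N.unit

lemma act_mul : μ[R.X] ▷ N.A ≫ act N = (α_ _ _ _).hom ≫ R.X ◁ act N ≫ act N := by
  have h : ((α_ R.X R.X N.A).inv ≫ μ[R.X] ▷ N.A) ≫ act N = R.X ◁ act N ≫ act N := N.assoc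
  rw [← h, Category.assoc, Iso.hom_inv_id_assoc]

/-- A module given by an action satisfying the axioms. -/
def moduleMk (M : A) (a : R.X ⊗ M ⟶ M) (h1 : η[R.X] ▷ M ≫ a = (λ_ M).hom)
    (hm : μ[R.X] ▷ M ≫ a = (α_ _ _ _).hom ≫ R.X ◁ a ≫ a) : (tensorMonad R).Algebra where
  A := M
  a := a
  unit := by
    change ((λ_ M).inv ≫ η[R.X] ▷ M) ≫ a = 𝟙 M
    rw [Category.assoc, h1, Iso.inv_hom_id]
  assoc := by
    change ((α_ R.X R.X M).inv ≫ μ[R.X] ▷ M) ≫ a = R.X ◁ a ≫ a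
    rw [Category.assoc, hm, Iso.inv_hom_id_assoc]

variable {N N'} {Z W V Z' W' : A}

/-- A map of modules given by a map commuting with the action. -/
def moduleHomMk (f : N.A ⟶ N'.A) (h : R.X ◁ f ≫ act N' = act N ≫ f) : N ⟶ N' where
  f := f
  h := h

lemma moduleHom_act (f : N ⟶ N') : R.X ◁ f.f ≫ act N' = act N ≫ f.f := f.h

lemma comp_tact (h : Z' ⟶ Z) (k : W' ⟶ W) (f : Z ⟶ R.X) (n : W ⟶ N.A) :
    (h ⊗ₘ k) ≫ tact N f n = tact N (h ≫ f) (k ≫ n) := by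
  simp [tact, tensorHom_comp_tensorHom_assoc]

lemma whiskerRight_tact (h : Z' ⟶ Z) (f : Z ⟶ R.X) (n : W ⟶ N.A) :
    h ▷ W ≫ tact N f n = tact N (h ≫ f) n := by
  rw [← tensorHom_id, comp_tact, Category.id_comp]

lemma whiskerLeft_tact (h : W' ⟶ W) (f : Z ⟶ R.X) (n : W ⟶ N.A) :
    Z ◁ h ≫ tact N f n = tact N f (h ≫ n) := by
  rw [← id_tensorHom, comp_tact, Category.id_comp]

lemma act_eq_tact : act N = tact N (𝟙 R.X) (𝟙 N.A) := by simp [tact]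

lemma one_tact (n : W ⟶ N.A) : tact N η[R.X] n = (λ_ W).hom ≫ n := by
  have h : η[R.X] ▷ N.A ≫ act N = (λ_ N.A).hom := by
    have := act_unit N
    rwa [Iso.inv_comp_eq, Category.comp_id] at this
  rw [tact, tensorHom_def', Category.assoc, h, leftUnitor_naturality]

lemma tmul_tact (f : Z ⟶ R.X) (g : W ⟶ R.X) (n : V ⟶ N.A) :
    tact N (tmul f g) n = (α_ _ _ _).hom ≫ tact N f (tact N g n) := by
  have h1 : tact N (tmul f g) n = ((f ⊗ₘ g) ⊗ₘ n) ≫ μ[R.X] ▷ _ ≫ act N := by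
    rw [← tensorHom_id, tensorHom_comp_tensorHom_assoc, Category.comp_id]; rfl
  have h2 : tact N f (tact N g n) = (f ⊗ₘ (g ⊗ₘ n)) ≫ _ ◁ act N ≫ act N := by
    rw [← id_tensorHom, tensorHom_comp_tensorHom_assoc, Category.comp_id]; rfl
  rw [h1, h2, act_mul, associator_naturality_assoc]

lemma tact_map (f : Z ⟶ R.X) (n : W ⟶ N.A) (φ : N ⟶ N') :
    tact N f n ≫ φ.f = tact N' f (n ≫ φ.f) := by
  rw [tact, Category.assoc, ← moduleHom_act, tact, ← id_tensorHom, tensorHom_comp_tensorHom_assoc,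
    Category.comp_id]

lemma tact_swap (f : Z ⟶ R.X) (g : W ⟶ R.X) (n : V ⟶ N.A) :
    (α_ _ _ _).hom ≫ tact N f (tact N g n) =
      (β_ Z W).hom ▷ V ≫ (α_ _ _ _).hom ≫ tact N g (tact N f n) := by
  rw [← tmul_tact, ← tmul_tact, whiskerRight_tact, braiding_tmul]

/-- The case of associativity in a square-zero extension where the module element is the middle
factor. -/
lemma braiding_tact_tact (f : Z ⟶ R.X) (n : W ⟶ N.A) (g : V ⟶ R.X) :
    (β_ (Z ⊗ W) V).hom ≫ tact N g (tact N f n) =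
      (α_ _ _ _).hom ≫ tact N f ((β_ W V).hom ≫ tact N g n) := by
  rw [BraidedCategory.braiding_tensor_left_hom]
  simp only [Category.assoc]
  rw [tact_swap g f n, ← comp_whiskerRight_assoc, SymmetricCategory.symmetry, id_whiskerRight,
    Category.id_comp, Iso.inv_hom_id_assoc, whiskerLeft_tact]

/-- The case where the module element is the first factor. The two ring elements pass it one at a
time on one side and together on the other; commutativity of the ring and the Yang–Baxter equation
reconcile the two. -/
lemma braiding_tact_braiding (n : Z ⟶ N.A) (f : W ⟶ R.X) (g : V ⟶ R.X) :
    (β_ (Z ⊗ W) V).hom ≫ tact N g ((β_ Z W).hom ≫ tact N f n) =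
      (α_ _ _ _).hom ≫ (β_ Z (W ⊗ V)).hom ≫ tact N (tmul f g) n := by
  have h : tact N (tmul f g) n = (β_ W V).hom ▷ Z ≫ tact N (tmul g f) n := by
    rw [whiskerRight_tact, braiding_tmul]
  rw [h, tmul_tact, ← whiskerLeft_tact, ← Category.assoc, ← Category.assoc, ← Category.assoc,
    ← Category.assoc]
  congr 1
  have := BraidedCategory.yang_baxter Z W V
  simp only [BraidedCategory.braiding_tensor_left_hom, BraidedCategory.braiding_tensor_right_hom,
    Category.assoc, Iso.hom_inv_id_assoc] at this ⊢
  rw [← this]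
  simp

variable [Preadditive A] [MonoidalPreadditive A]

lemma tact_add (f : Z ⟶ R.X) (g g' : W ⟶ N.A) :
    tact N f (g + g') = tact N f g + tact N f g' := by
  simp [tact, MonoidalPreadditive.tensor_add]

lemma zero_tact (g : W ⟶ N.A) : tact N (0 : Z ⟶ R.X) g = 0 := by simp [tact]

lemma tact_zero (g : Z ⟶ R.X) : tact N g (0 : W ⟶ N.A) = 0 := by simp [tact]

end ModulesOver
end Plethysm

end

noncomputable section

namespace Plethysm

/-! ### Derivations and square-zero extensions -/

section Derivations

open scoped MonObj

variable {A : Type u} [Category.{v} A] [MonoidalCategory A] [SymmetricCategory A]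
  [Preadditive A] [MonoidalPreadditive A] {R : CommMon A}

/-- Derivations of a ring over `R` with values in an `R`-module. -/
def der (X : Over R) (N : (tensorMonad R).Algebra) : AddSubgroup (X.left.X ⟶ N.A) where
  carrier := {d | μ[X.left.X] ≫ d =
    tact N (und X.hom) d + (β_ _ _).hom ≫ tact N (und X.hom) d}
  zero_mem' := by simp [tact_zero]
  add_mem' {d d'} h h' := by
    simp only [Set.mem_ofPred_eq, Preadditive.comp_add, tact_add] at h h' ⊢
    rw [h, h']
    abel
  neg_mem' {d} h := by
    have h0 : tact N (und X.hom) (-d) = -tact N (und X.hom) d := by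
      rw [eq_neg_iff_add_eq_zero, ← tact_add, neg_add_cancel, tact_zero]
    simp only [Set.mem_ofPred_eq, Preadditive.comp_neg, h0] at h ⊢
    rw [h]
    abel

section
variable {X Y : Over R} {N N' : (tensorMonad R).Algebra}

lemma mul_der (d : der X N) : μ[X.left.X] ≫ d.1 =
    tact N (und X.hom) d.1 + (β_ _ _).hom ≫ tact N (und X.hom) d.1 := d.2

lemma tmul_der {Z W : A} (f : Z ⟶ X.left.X) (g : W ⟶ X.left.X) (d : der X N) :
    tmul f g ≫ d.1 = tact N (f ≫ und X.hom) (g ≫ d.1) +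
      (β_ _ _).hom ≫ tact N (g ≫ und X.hom) (f ≫ d.1) := by
  rw [tmul, Category.assoc, mul_der, Preadditive.comp_add, comp_tact,
    BraidedCategory.braiding_naturality_assoc, comp_tact]

/-- The Leibniz rule for `1 = 1 * 1` gives `d 1 = d 1 + d 1`. -/
lemma one_der (d : der X N) : η[X.left.X] ≫ d.1 = 0 := by
  have h := tmul_der (η[X.left.X]) (η[X.left.X]) d
  rw [one_tmul, Category.assoc, und_one, one_tact, braiding_leftUnitor_assoc, ← unitors_equal] at h
  simpa using h

/-- Composition of a derivation with a map of rings. -/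
def derPrecomp (x : X ⟶ Y) : der Y N →+ der X N where
  toFun d := ⟨und x.left ≫ d.1, by
    change μ[X.left.X] ≫ und x.left ≫ d.1 = _
    rw [← Category.assoc, und_mul_hom, tmul_der]
    rw [show und x.left ≫ und Y.hom = und X.hom from congrArg und (Over.w x)]⟩
  map_zero' := by ext; simp
  map_add' d d' := by ext; simp

/-- Composition of a derivation with a map of modules. -/
def derPostcomp (φ : N ⟶ N') (d : der X N) : der X N' :=
  ⟨d.1 ≫ φ.f, by
    change μ[X.left.X] ≫ d.1 ≫ φ.f = _
    rw [← Category.assoc, mul_der, Preadditive.add_comp, Category.assoc, tact_map]⟩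

end

variable [HasBinaryBiproducts A] (N : (tensorMonad R).Algebra)

/-- The multiplication of the square-zero extension of `R` by a module. -/
def sqExtMul : (R.X ⊞ N.A) ⊗ (R.X ⊞ N.A) ⟶ R.X ⊞ N.A :=
  biprod.lift (tmul biprod.fst biprod.fst)
    (tact N biprod.fst biprod.snd + (β_ _ _).hom ≫ tact N biprod.fst biprod.snd)

lemma sqExtMul_fst : sqExtMul N ≫ biprod.fst = tmul biprod.fst biprod.fst := biprod.lift_fst _ _

lemma sqExtMul_snd : sqExtMul N ≫ biprod.snd =
    tact N biprod.fst biprod.snd + (β_ _ _).hom ≫ tact N biprod.fst biprod.snd :=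
  biprod.lift_snd _ _

/-- The square-zero extension of `R` by a module, as a monoid. -/
@[reducible]
def sqExtMon : MonObj (R.X ⊞ N.A) where
  one := biprod.lift η[R.X] 0
  mul := sqExtMul N
  one_mul := by
    apply biprod.hom_ext
    · rw [Category.assoc, sqExtMul_fst, whiskerRight_tmul, biprod.lift_fst, one_tmul]
    · rw [Category.assoc, sqExtMul_snd, Preadditive.comp_add, whiskerRight_tact, biprod.lift_fst,
        one_tact, BraidedCategory.braiding_naturality_left_assoc, whiskerLeft_tact,
        biprod.lift_snd, tact_zero]
      simp
  mul_one := by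
    apply biprod.hom_ext
    · rw [Category.assoc, sqExtMul_fst, ← braiding_tmul,
        BraidedCategory.braiding_naturality_right_assoc, whiskerRight_tmul, biprod.lift_fst,
        one_tmul, braiding_leftUnitor_assoc]
    · rw [Category.assoc, sqExtMul_snd, Preadditive.comp_add,
        BraidedCategory.braiding_naturality_right_assoc, whiskerRight_tact, whiskerLeft_tact,
        biprod.lift_fst, biprod.lift_snd, one_tact, tact_zero, braiding_leftUnitor_assoc]
      simp
  mul_assoc := by
    apply biprod.hom_ext
    · simp only [Category.assoc, sqExtMul_fst, whiskerRight_tmul, whiskerLeft_tmul]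
      rw [tmul_assoc]
    · simp only [Category.assoc, sqExtMul_snd, Preadditive.comp_add, whiskerRight_tact,
        BraidedCategory.braiding_naturality_left_assoc, whiskerLeft_tact, sqExtMul_fst,
        BraidedCategory.braiding_naturality_right_assoc, tact_add, tmul_tact,
        braiding_tact_tact, braiding_tact_braiding]
      abel

/-- The square-zero extension of `R` by a module. -/
def sqExtRing : CommMon A where
  X := R.X ⊞ N.A
  mon := sqExtMon N
  comm :=
    letI := sqExtMon N
    { mul_comm := by
        change (β_ _ _).hom ≫ sqExtMul N = sqExtMul N
        apply biprod.hom_ext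
        · rw [Category.assoc, sqExtMul_fst, braiding_tmul]
        · rw [Category.assoc, sqExtMul_snd, Preadditive.comp_add, ← Category.assoc,
            SymmetricCategory.symmetry, Category.id_comp, add_comm] }

/-- The projection of the square-zero extension to `R`. -/
def sqExtFst : (sqExtRing N).X ⟶ R.X := biprod.fst

/-- The projection of the square-zero extension to the module. -/
def sqExtSnd : (sqExtRing N).X ⟶ N.A := biprod.snd

/-- A map into the square-zero extension. -/
def sqExtLift {Z : A} (f : Z ⟶ R.X) (n : Z ⟶ N.A) : Z ⟶ (sqExtRing N).X := biprod.lift f n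

@[simp]
lemma sqExtLift_fst {Z : A} (f : Z ⟶ R.X) (n : Z ⟶ N.A) : sqExtLift N f n ≫ sqExtFst N = f :=
  biprod.lift_fst _ _

@[simp]
lemma sqExtLift_fst_assoc {Z W : A} (f : Z ⟶ R.X) (n : Z ⟶ N.A) (h : R.X ⟶ W) :
    sqExtLift N f n ≫ sqExtFst N ≫ h = f ≫ h := by
  rw [← Category.assoc, sqExtLift_fst]

@[simp]
lemma sqExtLift_snd {Z : A} (f : Z ⟶ R.X) (n : Z ⟶ N.A) : sqExtLift N f n ≫ sqExtSnd N = n :=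
  biprod.lift_snd _ _

@[simp]
lemma sqExtLift_snd_assoc {Z W : A} (f : Z ⟶ R.X) (n : Z ⟶ N.A) (h : N.A ⟶ W) :
    sqExtLift N f n ≫ sqExtSnd N ≫ h = n ≫ h := by
  rw [← Category.assoc, sqExtLift_snd]

lemma sqExt_hom_ext {Z : A} {a b : Z ⟶ (sqExtRing N).X} (h1 : a ≫ sqExtFst N = b ≫ sqExtFst N)
    (h2 : a ≫ sqExtSnd N = b ≫ sqExtSnd N) : a = b := biprod.hom_ext _ _ h1 h2

lemma sqExt_mul_fst : μ[(sqExtRing N).X] ≫ sqExtFst N = tmul (sqExtFst N) (sqExtFst N) :=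
  sqExtMul_fst N

lemma sqExt_mul_snd : μ[(sqExtRing N).X] ≫ sqExtSnd N =
    tact N (sqExtFst N) (sqExtSnd N) + (β_ _ _).hom ≫ tact N (sqExtFst N) (sqExtSnd N) :=
  sqExtMul_snd N

lemma sqExt_one_fst : η[(sqExtRing N).X] ≫ sqExtFst N = η[R.X] := biprod.lift_fst _ _

lemma sqExt_one_snd : η[(sqExtRing N).X] ≫ sqExtSnd N = 0 := biprod.lift_snd _ _

/-- The square-zero extension of `R` by a module, over `R`. -/
def sqExt : Over R := Over.mk (ringHom (S := sqExtRing N) (S' := R) (sqExtFst N) (sqExt_one_fst N)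
  (sqExt_mul_fst N))

/-- The universal derivation of the square-zero extension. -/
def sqExtDer : der (sqExt N) N := ⟨sqExtSnd N, sqExt_mul_snd N⟩

variable {N}

/-- The map into a square-zero extension given by a derivation. -/
def sqExtOfDer {X : Over R} (d : der X N) : X ⟶ sqExt N :=
  Over.homMk (ringHom (S := X.left) (S' := sqExtRing N) (sqExtLift N (und X.hom) d.1)
    (by
      apply sqExt_hom_ext
      · rw [Category.assoc, sqExtLift_fst, sqExt_one_fst, und_one]
      · rw [Category.assoc, sqExtLift_snd, sqExt_one_snd, one_der])
    (by
      apply sqExt_hom_ext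
      · rw [Category.assoc, sqExtLift_fst, tmul, Category.assoc, sqExt_mul_fst, comp_tmul,
          sqExtLift_fst, und_mul_hom]
      · rw [Category.assoc, sqExtLift_snd, tmul, Category.assoc, sqExt_mul_snd,
          Preadditive.comp_add, BraidedCategory.braiding_naturality_assoc, comp_tact,
          sqExtLift_fst, sqExtLift_snd, mul_der]))
    (und_injective (sqExtLift_fst N _ _))

/-- Maps into a square-zero extension are derivations. -/
def sqExtEquiv (X : Over R) : (X ⟶ sqExt N) ≃ der X N where
  toFun x := derPrecomp x (sqExtDer N)
  invFun d := sqExtOfDer d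
  left_inv x := by
    apply Over.OverMorphism.ext
    apply und_injective
    apply sqExt_hom_ext
    · exact (sqExtLift_fst N _ _).trans (congrArg und (Over.w x)).symm
    · exact (sqExtLift_snd N _ _)
  right_inv d := Subtype.ext (sqExtLift_snd N _ _)

/-- The functor of derivations. -/
def derFunctor (N : (tensorMonad R).Algebra) : (Over R)ᵒᵖ ⥤ CommGrpCat.{v} where
  obj X := CommGrpCat.of (Multiplicative (der X.unop N))
  map x := CommGrpCat.ofHom (AddMonoidHom.toMultiplicative (derPrecomp x.unop))
  map_id X := by
    ext d
    exact Subtype.ext (Category.id_comp d.1)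
  map_comp x y := by
    ext d
    exact Subtype.ext (Category.assoc _ _ d.1)

/-- The square-zero extension represents derivations. -/
def sqExtRepresentableBy (N : (tensorMonad R).Algebra) :
    (derFunctor N ⋙ CategoryTheory.forget CommGrpCat).RepresentableBy (sqExt N) where
  homEquiv {X} := sqExtEquiv X
  homEquiv_comp _ _ := Subtype.ext (Category.assoc _ _ _)

variable [HasFiniteLimits A]

attribute [local instance] Over.cartesianMonoidalCategory Over.braidedCategory

/-- The square-zero extension of `R` by a module, as an abelian group object. -/
def sqExtAb (N : (tensorMonad R).Algebra) : AbOver R :=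
  -- By Yoneda, the group structure is the addition of derivations.
  letI := CommGrpObj.ofRepresentableBy (sqExt N) (derFunctor N) (sqExtRepresentableBy N)
  ⟨sqExt N⟩

end Derivations
end Plethysm

end

noncomputable section

namespace Plethysm

/-! ### Rings with a section: derivations vanishing on the section -/

section Pointed

open scoped MonObj

variable {A : Type u} [Category.{v} A] [MonoidalCategory A] [SymmetricCategory A]
  [Preadditive A] [MonoidalPreadditive A] [HasFiniteLimits A] {R : CommMon A}

section
variable {X : Over R} (s : R ⟶ X.left) (hs : s ≫ X.hom = 𝟙 R)

lemma und_section (hs : s ≫ X.hom = 𝟙 R) : und s ≫ und X.hom = 𝟙 R.X := congrArg und hs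

/-- The retraction of a ring over `R` with a section onto the augmentation ideal. -/
def retr : X.left.X ⟶ ideal X :=
  idealLift X (𝟙 _ - und X.hom ≫ und s) (by
    rw [Preadditive.sub_comp, Category.assoc, und_section s hs]
    simp)

@[simp]
lemma retr_ι : retr s hs ≫ idealι X = 𝟙 _ - und X.hom ≫ und s := idealLift_ι _ _ _

@[simp]
lemma ι_retr : idealι X ≫ retr s hs = 𝟙 _ := by
  rw [← cancel_mono (idealι X), Category.assoc, retr_ι, Preadditive.comp_sub, idealι_und_assoc]
  simp

@[simp]
lemma section_retr : und s ≫ retr s hs = 0 := by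
  rw [← cancel_mono (idealι X), Category.assoc, retr_ι, Preadditive.comp_sub, ← Category.assoc,
    und_section s hs]
  simp

lemma retr_decomp {Z : A} (f : Z ⟶ X.left.X) :
    f = f ≫ und X.hom ≫ und s + f ≫ retr s hs ≫ idealι X := by simp

lemma pointed_hom_ext {Z : A} {f g : Z ⟶ X.left.X} (h1 : f ≫ und X.hom = g ≫ und X.hom)
    (h2 : f ≫ retr s hs = g ≫ retr s hs) : f = g := by
  rw [retr_decomp s hs f, retr_decomp s hs g, reassoc_of% h1, reassoc_of% h2]

/-- The action of `R` on the augmentation ideal of a ring with a section. -/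
def pointedAction : R.X ⊗ ideal X ⟶ ideal X :=
  idealLift X ((und s ⊗ₘ idealι X) ≫ μ[X.left.X]) (by
    rw [Category.assoc, IsMonHom.mul_hom (und X.hom), tensorHom_comp_tensorHom_assoc]
    simp)

lemma pointedAction_ι : pointedAction s ≫ idealι X = tmul (und s) (idealι X) :=
  idealLift_ι _ _ _

/-- The augmentation ideal of a ring over `R` with a section, as an `R`-module. -/
def pointedModule : (tensorMonad R).Algebra :=
  moduleMk (ideal X) (pointedAction s)
    (by
      rw [← cancel_mono (idealι X), Category.assoc, pointedAction_ι, whiskerRight_tmul, und_one,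
        one_tmul])
    (by
      rw [← cancel_mono (idealι X), Category.assoc, Category.assoc, Category.assoc,
        pointedAction_ι, whiskerRight_tmul, und_mul_hom, tmul_assoc, whiskerLeft_tmul,
        pointedAction_ι])

/-- The inclusion of the augmentation ideal. -/
def pointedι : (pointedModule s).A ⟶ X.left.X := idealι X

instance : Mono (pointedι s) := inferInstanceAs (Mono (idealι X))

lemma tact_pointedι {Z W : A} (f : Z ⟶ R.X) (n : W ⟶ (pointedModule s).A) :
    tact (pointedModule s) f n ≫ pointedι s = tmul (f ≫ und s) (n ≫ pointedι s) := by
  have h : act (pointedModule s) ≫ pointedι s = tmul (und s) (pointedι s) := pointedAction_ι s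
  rw [tact, Category.assoc, h, comp_tmul]

/-- The retraction onto the module underlying the augmentation ideal. -/
def pointedRetr (hs : s ≫ X.hom = 𝟙 R) : X.left.X ⟶ (pointedModule s).A := retr s hs

/-- The multiplication of the augmentation ideal, with values in the underlying module. -/
def pointedMul : ideal X ⊗ ideal X ⟶ (pointedModule s).A := idealMul X

lemma pointedMul_ι : pointedMul s ≫ pointedι s = tmul (idealι X) (idealι X) := idealMul_ι X

lemma pointedRetr_ι : pointedRetr s hs ≫ pointedι s = 𝟙 _ - und X.hom ≫ und s := retr_ι s hs

/-- Split each factor into its part in `R` and its part in the ideal and expand. The product of the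
two `R`-parts is removed by the retraction, the cross terms are the Leibniz terms, and the rest is
the multiplication of the ideal. So the retraction fails to be a derivation exactly by products of
ideal elements. -/
lemma mul_retr : μ[X.left.X] ≫ pointedRetr s hs =
    tact (pointedModule s) (und X.hom) (pointedRetr s hs) +
      (β_ _ _).hom ≫ tact (pointedModule s) (und X.hom) (pointedRetr s hs) +
      (retr s hs ⊗ₘ retr s hs) ≫ pointedMul s := by
  rw [← cancel_mono (pointedι s)]
  have h1 : ((retr s hs ⊗ₘ retr s hs) ≫ pointedMul s) ≫ pointedι s =
      tmul (𝟙 _ - und X.hom ≫ und s) (𝟙 _ - und X.hom ≫ und s) := by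
    rw [Category.assoc, pointedMul_ι, comp_tmul, retr_ι]
  rw [Preadditive.add_comp, Preadditive.add_comp, h1, Category.assoc, Category.assoc,
    pointedRetr_ι, tact_pointedι, pointedRetr_ι]
  obtain ⟨p, hp⟩ : ∃ p, p = und X.hom ≫ und s := ⟨_, rfl⟩
  have hb : (β_ X.left.X X.left.X).hom ≫ tmul (S := X.left) p (𝟙 _ - p) = tmul (𝟙 _ - p) p :=
    braiding_tmul _ _
  have hm : μ[X.left.X] ≫ und X.hom ≫ und s = tmul p p := by
    rw [← Category.assoc, und_mul_hom, tmul_und, hp]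
  rw [Preadditive.comp_sub, hm, ← hp, hb, Category.comp_id, mul_eq_tmul]
  have h2 : tmul (S := X.left) (𝟙 _) (𝟙 _) = tmul (p + (𝟙 _ - p)) (p + (𝟙 _ - p)) := by
    simp
  rw [h2, add_tmul, tmul_add, tmul_add]
  abel

/-- A derivation vanishing on the section, from a linear map that kills products. -/
def derOfLinear (hs : s ≫ X.hom = 𝟙 R) {N : (tensorMonad R).Algebra} (h : pointedModule s ⟶ N)
    (h0 : pointedMul s ≫ h.f = 0) : der X N :=
  ⟨pointedRetr s hs ≫ h.f, by
    change μ[X.left.X] ≫ pointedRetr s hs ≫ h.f = _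
    rw [← Category.assoc, mul_retr, Preadditive.add_comp, Preadditive.add_comp]
    have : ((retr s hs ⊗ₘ retr s hs) ≫ pointedMul s) ≫ h.f = 0 := by
      rw [Category.assoc, h0, comp_zero]
    rw [this, add_zero, Category.assoc, tact_map]⟩

/-- A derivation vanishing on the section is linear on the augmentation ideal. -/
def linearOfDer (hs : s ≫ X.hom = 𝟙 R) {N : (tensorMonad R).Algebra} (d : der X N)
    (hd : und s ≫ d.1 = 0) : pointedModule s ⟶ N :=
  moduleHomMk (pointedι s ≫ d.1) (by
    have h : act (pointedModule s) ≫ pointedι s = tmul (und s) (pointedι s) := pointedAction_ι s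
    rw [← Category.assoc, h, tmul_der, und_section s hs, hd, tact_zero, act_eq_tact,
      whiskerLeft_tact]
    simp)

lemma linearOfDer_f (hs : s ≫ X.hom = 𝟙 R) {N : (tensorMonad R).Algebra} (d : der X N)
    (hd : und s ≫ d.1 = 0) : (linearOfDer s hs d hd).f = pointedι s ≫ d.1 := rfl

lemma pointedMul_linearOfDer (hs : s ≫ X.hom = 𝟙 R) {N : (tensorMonad R).Algebra} (d : der X N)
    (hd : und s ≫ d.1 = 0) : pointedMul s ≫ (linearOfDer s hs d hd).f = 0 := by
  rw [linearOfDer_f, ← Category.assoc, pointedMul_ι, tmul_der, idealι_und, zero_tact]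
  simp

/-- Derivations vanishing on the section are linear maps that kill products. -/
def derLinearEquiv (hs : s ≫ X.hom = 𝟙 R) (N : (tensorMonad R).Algebra) :
    {d : der X N // und s ≫ d.1 = 0} ≃ {h : pointedModule s ⟶ N // pointedMul s ≫ h.f = 0} where
  toFun d := ⟨linearOfDer s hs d.1 d.2, pointedMul_linearOfDer s hs d.1 d.2⟩
  invFun h := ⟨derOfLinear s hs h.1 h.2, by
    have h1 : und s ≫ pointedRetr s hs = 0 := section_retr s hs
    change und s ≫ pointedRetr s hs ≫ h.1.f = 0
    rw [← Category.assoc, h1, zero_comp]⟩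
  left_inv d := by
    apply Subtype.ext
    apply Subtype.ext
    change pointedRetr s hs ≫ pointedι s ≫ d.1.1 = d.1.1
    rw [← Category.assoc, pointedRetr_ι, Preadditive.sub_comp, Category.assoc, d.2]
    simp
  right_inv h := by
    apply Subtype.ext
    apply Monad.Algebra.Hom.ext
    have h1 : pointedι s ≫ pointedRetr s hs = 𝟙 _ := ι_retr s hs
    change pointedι s ≫ pointedRetr s hs ≫ h.1.f = h.1.f
    rw [← Category.assoc, h1, Category.id_comp]

end

end Pointed

/-! ### Quotient modules and the module of indecomposables -/

section Quotients

open scoped MonObj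

variable {A : Type u} [Category.{v} A] [MonoidalCategory A] [SymmetricCategory A]
  [Preadditive A] [MonoidalPreadditive A] [HasCokernels A] {R : CommMon A}

/-- Tensoring preserves cokernels. -/
def cokernelWhiskerIsColimit (M : A) [(tensorLeft M).IsLeftAdjoint] {Y Z : A} (f : Y ⟶ Z) :
    IsColimit (CokernelCofork.ofπ (f := M ◁ f) (M ◁ cokernel.π f) (by
      rw [← MonoidalCategory.whiskerLeft_comp, cokernel.condition,
        MonoidalPreadditive.whiskerLeft_zero])) :=
  CokernelCofork.mapIsColimit (CokernelCofork.ofπ (cokernel.π f) (cokernel.condition f))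
    (cokernelIsCokernel f) (tensorLeft M)

instance epi_whiskerLeft_cokernel (M : A) [(tensorLeft M).IsLeftAdjoint] {Y Z : A} (f : Y ⟶ Z) :
    Epi (M ◁ cokernel.π f) :=
  inferInstanceAs (Epi ((tensorLeft M).map (cokernel.π f)))

variable [∀ M : A, (tensorLeft M).IsLeftAdjoint] {N : (tensorMonad R).Algebra} {Y : A}
  (f : Y ⟶ N.A) (hf : R.X ◁ f ≫ act N ≫ cokernel.π f = 0)

/-- The action on the quotient of a module. -/
def quotAction : R.X ⊗ cokernel f ⟶ cokernel f :=
  (cokernelWhiskerIsColimit R.X f).desc (CokernelCofork.ofπ (act N ≫ cokernel.π f) hf)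

lemma π_quotAction : R.X ◁ cokernel.π f ≫ quotAction f hf = act N ≫ cokernel.π f :=
  (cokernelWhiskerIsColimit R.X f).fac _ WalkingParallelPair.one

/-- The quotient of a module. -/
def quotModule : (tensorMonad R).Algebra :=
  moduleMk (cokernel f) (quotAction f hf)
    (by
      rw [← cancel_epi ((𝟙_ A) ◁ cokernel.π f), whisker_exchange_assoc,
        π_quotAction, leftUnitor_naturality]
      have h : η[R.X] ▷ N.A ≫ act N = (λ_ _).hom := by
        have := act_unit N
        rwa [Iso.inv_comp_eq, Category.comp_id] at this
      rw [← Category.assoc, h])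
    (by
      rw [← cancel_epi ((R.X ⊗ R.X) ◁ cokernel.π f), whisker_exchange_assoc,
        π_quotAction, tensor_whiskerLeft]
      simp only [Category.assoc, Iso.inv_hom_id_assoc]
      rw [← MonoidalCategory.whiskerLeft_comp_assoc, π_quotAction,
        MonoidalCategory.whiskerLeft_comp_assoc, π_quotAction, ← Category.assoc, act_mul]
      simp only [Category.assoc])

/-- The projection to the quotient of a module. -/
def quotπ : N ⟶ quotModule f hf := moduleHomMk (N' := quotModule f hf) (cokernel.π f)
  (π_quotAction f hf)

instance : Epi (quotπ f hf).f := inferInstanceAs (Epi (cokernel.π f))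

instance (M : A) : Epi (M ◁ (quotπ f hf).f) := inferInstanceAs (Epi (M ◁ cokernel.π f))

lemma comp_quotπ : f ≫ (quotπ f hf).f = 0 := cokernel.condition f

variable {N' : (tensorMonad R).Algebra}

/-- The underlying map of a map out of the quotient of a module. -/
def quotDescHom (h : N.A ⟶ N'.A) (h0 : f ≫ h = 0) : (quotModule f hf).A ⟶ N'.A :=
  cokernel.desc f h h0

lemma quotπ_descHom (h : N.A ⟶ N'.A) (h0 : f ≫ h = 0) :
    (quotπ f hf).f ≫ quotDescHom f hf h h0 = h := cokernel.π_desc _ _ _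

/-- Linear maps out of the quotient of a module. -/
def quotEquiv : {h : N ⟶ N' // f ≫ h.f = 0} ≃ (quotModule f hf ⟶ N') where
  toFun h := moduleHomMk (quotDescHom f hf h.1.f h.2) (by
    rw [← cancel_epi (R.X ◁ (quotπ f hf).f), ← Category.assoc, ← Category.assoc,
      ← MonoidalCategory.whiskerLeft_comp, quotπ_descHom, moduleHom_act, moduleHom_act,
      Category.assoc, quotπ_descHom])
  invFun h := ⟨quotπ f hf ≫ h, by
    change f ≫ (quotπ f hf).f ≫ h.f = 0
    rw [← Category.assoc, comp_quotπ, zero_comp]⟩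
  left_inv h := by
    apply Subtype.ext
    apply Monad.Algebra.Hom.ext
    exact quotπ_descHom f hf _ _
  right_inv h := by
    apply Monad.Algebra.Hom.ext
    rw [← cancel_epi (quotπ f hf).f]
    exact quotπ_descHom f hf _ _

variable [HasFiniteLimits A]

section
variable {X : Over R} (s : R ⟶ X.left)

/-- This is `r (x y) = (r x) y`: it makes the products of ideal elements stable under `R`, so that
I/I² inherits an action. -/
lemma whiskerLeft_pointedMul_act :
    R.X ◁ pointedMul s ≫ act (pointedModule s) =
      (α_ _ _ _).inv ≫ pointedAction s ▷ _ ≫ pointedMul s := by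
  rw [← cancel_mono (pointedι s), act_eq_tact, whiskerLeft_tact, tact_pointedι, Category.assoc,
    Category.id_comp, Category.id_comp, pointedMul_ι, Category.assoc, Category.assoc,
    pointedMul_ι, whiskerRight_tmul, pointedAction_ι, tmul_assoc, Iso.inv_hom_id_assoc]

/-- The indecomposables of a ring over `R` with a section, as an `R`-module. -/
def cotangentModule : (tensorMonad R).Algebra :=
  quotModule (N := pointedModule s) (pointedMul s) (by
    rw [← Category.assoc, whiskerLeft_pointedMul_act]
    simp)

/-- The projection to the indecomposables. -/
def cotangentπ : pointedModule s ⟶ cotangentModule s := quotπ _ _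

/-- Derivations vanishing on the section are linear maps out of the indecomposables. -/
def cotangentEquiv (hs : s ≫ X.hom = 𝟙 R) (N : (tensorMonad R).Algebra) :
    {d : der X N // und s ≫ d.1 = 0} ≃ (cotangentModule s ⟶ N) :=
  (derLinearEquiv s hs N).trans (quotEquiv _ _)

lemma cotangentEquiv_symm (hs : s ≫ X.hom = 𝟙 R) (N : (tensorMonad R).Algebra)
    (h : cotangentModule s ⟶ N) : ((cotangentEquiv s hs N).symm h).1.1 =
      pointedRetr s hs ≫ (cotangentπ s).f ≫ h.f := rfl

end

end Quotients
end Plethysm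

end

noncomputable section

namespace Plethysm

/-! ### Abelian group objects over a ring are modules -/

section IdealModule

open scoped MonObj

attribute [local instance] Over.cartesianMonoidalCategory Over.braidedCategory

variable {A : Type u} [Category.{v} A] [MonoidalCategory A] [SymmetricCategory A]

lemma isIso_of_isIso_und {S S' : CommMon A} (f : S ⟶ S') [IsIso (und f)] : IsIso f := by
  have : IsIso f.hom.hom := inferInstanceAs (IsIso (und f))
  have : IsIso ((Mon.forget A).map f.hom) := this
  have : IsIso f.hom := isIso_of_reflects_iso f.hom (Mon.forget A)
  have : IsIso ((CommMon.forget₂Mon A).map f) := this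
  exact isIso_of_reflects_iso f (CommMon.forget₂Mon A)

lemma isIso_of_isIso_und_left {R : CommMon A} {X Y : Over R} (f : X ⟶ Y) [IsIso (und f.left)] :
    IsIso f := by
  have : IsIso ((Over.forget R).map f) := isIso_of_isIso_und f.left
  exact isIso_of_reflects_iso f (Over.forget R)

variable [Preadditive A] [MonoidalPreadditive A] [HasFiniteLimits A] [HasBinaryBiproducts A]
  {R : CommMon A}

section
variable {X : Over R} (s : R ⟶ X.left) (hs : s ≫ X.hom = 𝟙 R) (h0 : idealMul X = 0)

/-- The derivation onto an augmentation ideal that squares to zero. -/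
def pointedDer : der X (pointedModule s) :=
  ⟨pointedRetr s hs, by
    change μ[X.left.X] ≫ pointedRetr s hs = _
    have : pointedMul s = 0 := h0
    rw [mul_retr, this, comp_zero, add_zero]⟩

/-- The section splits the underlying object as `R` plus the ideal; the inverse is the section on
the first summand and the inclusion on the second. -/
instance isIso_sqExtOfDer_pointedDer : IsIso (sqExtOfDer (pointedDer s hs h0)) := by
  have h : IsIso (sqExtLift (pointedModule s) (und X.hom) (pointedRetr s hs)) := by
    have h1 : und s ≫ pointedRetr s hs = 0 := section_retr s hs
    have h2 : pointedι s ≫ pointedRetr s hs = 𝟙 _ := ι_retr s hs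
    have h3 : pointedι s ≫ und X.hom = 0 := idealι_und X
    refine ⟨sqExtFst _ ≫ und s + sqExtSnd _ ≫ pointedι s, ?_, ?_⟩
    · rw [Preadditive.comp_add, sqExtLift_fst_assoc, sqExtLift_snd_assoc, pointedRetr_ι]
      abel
    · apply sqExt_hom_ext
      · rw [Category.assoc, sqExtLift_fst, Preadditive.add_comp, Category.assoc, Category.assoc,
          h3, und_section s hs]
        simp
      · rw [Category.assoc, sqExtLift_snd, Preadditive.add_comp, Category.assoc, Category.assoc,
          h1, h2]
        simp
  have : IsIso (und (sqExtOfDer (pointedDer s hs h0)).left) := h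
  exact isIso_of_isIso_und_left _

/-- Maps into a pointed object whose augmentation ideal squares to zero are derivations. -/
def pointedEquiv (Y : Over R) : (Y ⟶ X) ≃ der Y (pointedModule s) :=
  (Iso.homCongr (Iso.refl Y) (asIso (sqExtOfDer (pointedDer s hs h0)))).trans (sqExtEquiv Y)

lemma pointedEquiv_coe {Y : Over R} (y : Y ⟶ X) :
    (pointedEquiv s hs h0 Y y).1 = und y.left ≫ pointedRetr s hs := by
  change und ((𝟙 Y : Y ⟶ Y) ≫ y ≫ sqExtOfDer (pointedDer s hs h0)).left ≫ sqExtSnd _ = _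
  rw [Category.id_comp, Over.comp_left, und_comp]
  exact (Category.assoc _ _ _).trans (congrArg _ (sqExtLift_snd _ _ _))

end

variable (G H : AbOver R)

/-- Maps into an abelian group object are derivations into its module. -/
def derEquiv (X : Over R) : (X ⟶ G.toOver) ≃ der X ((idealModule R).obj G) :=
  pointedEquiv G.zero G.zero_hom (idealMul_toOver G) X

/-- The retraction onto the augmentation ideal. -/
def abRetr : G.toOver.left.X ⟶ ((idealModule R).obj G).A := pointedRetr G.zero G.zero_hom

/-- The inclusion of the augmentation ideal. -/
def abι : ((idealModule R).obj G).A ⟶ G.toOver.left.X := idealι G.toOver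

lemma abι_retr : abι G ≫ abRetr G = 𝟙 _ := ι_retr G.zero G.zero_hom

lemma zero_retr : und G.zero ≫ abRetr G = 0 := section_retr G.zero G.zero_hom

lemma abRetr_ι : abRetr G ≫ abι G = 𝟙 _ - und G.toOver.hom ≫ und G.zero :=
  retr_ι G.zero G.zero_hom

lemma derEquiv_coe {X : Over R} (x : X ⟶ G.toOver) :
    (derEquiv G X x).1 = und x.left ≫ abRetr G := pointedEquiv_coe _ _ _ _

variable {G H}

lemma abι_naturality (f : G ⟶ H) : ((idealModule R).map f).f ≫ abι H =
    abι G ≫ und (AbOver.homOver f).left := idealOverMap_ι _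

lemma abRetr_naturality (f : G ⟶ H) : abRetr G ≫ ((idealModule R).map f).f =
    und (AbOver.homOver f).left ≫ abRetr H := by
  have : Mono (abι H) := inferInstanceAs (Mono (idealι H.toOver))
  rw [← cancel_mono (abι H), Category.assoc, abι_naturality, ← Category.assoc, abRetr_ι,
    Category.assoc, abRetr_ι, Preadditive.sub_comp, Preadditive.comp_sub, Category.assoc,
    ← und_comp, AbOver.zero_map, ← Category.assoc (und (AbOver.homOver f).left), und_w]
  simp

lemma derEquiv_comp {X : Over R} (x : X ⟶ G.toOver) (f : G ⟶ H) :
    derEquiv H X (x ≫ AbOver.homOver f) = derPostcomp ((idealModule R).map f) (derEquiv G X x) := by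
  apply Subtype.ext
  change _ = (derEquiv G X x).1 ≫ ((idealModule R).map f).f
  rw [derEquiv_coe, derEquiv_coe, Category.assoc, abRetr_naturality]
  simp

/-- A map carries a section to the zero section if the derivation vanishes on the section. -/
lemma pointed_iff {X : Over R} (s : R ⟶ X.left) (hs : s ≫ X.hom = 𝟙 R) (x : X ⟶ G.toOver) :
    s ≫ x.left = G.zero ↔ und s ≫ (derEquiv G X x).1 = 0 := by
  constructor
  · intro h
    rw [derEquiv_coe, ← Category.assoc, ← und_comp, h, zero_retr]
  · intro h
    apply und_injective
    apply pointed_hom_ext G.zero G.zero_hom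
    · rw [und_comp, Category.assoc, und_w, und_section s hs, zero_und]
    · have h1 : und G.zero ≫ retr G.zero G.zero_hom = 0 := zero_retr G
      rw [derEquiv_coe] at h
      rw [h1, und_comp, Category.assoc]
      exact h

/-- A map of rings over `R` that preserves zero is a homomorphism of abelian group objects. -/
lemma isMonHom_of_pointed (x : G.toOver ⟶ H.toOver) (h : G.zero ≫ x.left = H.zero) :
    IsMonHom x where
  one_hom := Over.OverMorphism.ext h
  mul_hom := by
    have h1 : μ[G.toOver] = SemiCartesianMonoidalCategory.fst G.toOver G.toOver *
        SemiCartesianMonoidalCategory.snd G.toOver G.toOver := by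
      change _ = CartesianMonoidalCategory.lift _ _ ≫ _
      rw [CartesianMonoidalCategory.lift_fst_snd, Category.id_comp]
    have h2 : (x ⊗ₘ x) ≫ μ[H.toOver] =
        (SemiCartesianMonoidalCategory.fst G.toOver G.toOver ≫ x) *
        (SemiCartesianMonoidalCategory.snd G.toOver G.toOver ≫ x) := by
      change _ = CartesianMonoidalCategory.lift _ _ ≫ _
      congr 1
    rw [h1, h2]
    apply Over.OverMorphism.ext
    apply und_injective
    -- By `und_mul` both group laws are addition corrected by the zero section, and `x` respects
    -- addition and zero.
    rw [und_mul, Over.comp_left, und_comp, und_mul, Preadditive.sub_comp, Preadditive.add_comp,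
      Category.assoc _ (und G.zero), ← und_comp, ← und_comp, ← und_comp, h, Over.comp_left,
      Over.comp_left]

/-- The homomorphism given by a map of rings over `R` that preserves zero. -/
def abHomOfPointed (x : G.toOver ⟶ H.toOver) (h : G.zero ≫ x.left = H.zero) : G ⟶ H :=
  have : IsMonHom (M := G.X) (N := H.X) x := isMonHom_of_pointed x h
  commGrpHomMk (G := G) (H := H) x

lemma abHomOfPointed_homOver (x : G.toOver ⟶ H.toOver) (h : G.zero ≫ x.left = H.zero) :
    AbOver.homOver (abHomOfPointed x h) = x := rfl

lemma abHom_ext {f g : G ⟶ H} (h : AbOver.homOver f = AbOver.homOver g) : f = g :=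
  CommGrp.hom_ext _ _ h

instance : (idealModule R).Faithful where
  map_injective {G H} f g h := by
    apply abHom_ext
    apply Over.OverMorphism.ext
    apply und_injective
    apply pointed_hom_ext H.zero H.zero_hom
    · rw [und_w, und_w]
    · have h1 := abRetr_naturality f
      rw [h, abRetr_naturality g] at h1
      exact h1.symm

/-- A linear map is a derivation on an abelian group object. -/
def abDer {N : (tensorMonad R).Algebra} (h : (idealModule R).obj G ⟶ N) : der G.toOver N :=
  derPostcomp h (pointedDer G.zero G.zero_hom (idealMul_toOver G))

lemma abDer_coe {N : (tensorMonad R).Algebra} (h : (idealModule R).obj G ⟶ N) :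
    (abDer h).1 = abRetr G ≫ h.f := rfl

/-- A linear map, composed with the retraction onto the ideal of `G`, is a derivation and so a ring
map to `H`. The retraction kills the zero section, hence the ring map preserves zero and is a
homomorphism. -/
instance : (idealModule R).Full where
  map_surjective {G H} h := by
    let x := (derEquiv H G.toOver).symm (abDer h)
    have hx : und x.left ≫ abRetr H = abRetr G ≫ h.f := by
      rw [← derEquiv_coe, Equiv.apply_symm_apply, abDer_coe]
    have hz : G.zero ≫ x.left = H.zero := by
      rw [pointed_iff G.zero G.zero_hom, Equiv.apply_symm_apply, abDer_coe, ← Category.assoc,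
        zero_retr, zero_comp]
    refine ⟨abHomOfPointed x hz, ?_⟩
    apply Monad.Algebra.Hom.ext
    have h1 := abRetr_naturality (abHomOfPointed x hz)
    rw [abHomOfPointed_homOver, hx] at h1
    have h2 := congrArg (abι G ≫ ·) h1
    simp only [← Category.assoc, abι_retr] at h2
    simpa using h2

/-- The module of a square-zero extension. -/
def idealModuleSqExtHom (N : (tensorMonad R).Algebra) : (idealModule R).obj (sqExtAb N) ⟶ N :=
  linearOfDer (X := (sqExtAb N).toOver) (sqExtAb N).zero (sqExtAb N).zero_hom (sqExtDer N)
    (sqExtLift_snd _ _ _)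

/-- The ideal is the kernel of the first projection of a biproduct, so the second projection
identifies it with `N`. -/
instance (N : (tensorMonad R).Algebra) : IsIso (idealModuleSqExtHom N) := by
  obtain ⟨k, hk⟩ : ∃ k : ((idealModule R).obj (sqExtAb N)).A ⟶ (sqExtRing N).X,
    k = abι (sqExtAb N) := ⟨_, rfl⟩
  have : Mono k := hk ▸ inferInstanceAs (Mono (idealι (sqExtAb N).toOver))
  have h1 : k ≫ sqExtFst N = 0 := hk ▸ idealι_und (sqExt N)
  obtain ⟨i, hi⟩ : ∃ i : N.A ⟶ ((idealModule R).obj (sqExtAb N)).A, i ≫ k = sqExtLift N 0 (𝟙 _) :=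
    ⟨idealLift (sqExt N) (sqExtLift N 0 (𝟙 N.A)) (sqExtLift_fst _ _ _),
      hk ▸ idealLift_ι _ _ _⟩
  have h3 : IsIso (k ≫ sqExtSnd N) := by
    refine ⟨i, ?_, ?_⟩
    · rw [← cancel_mono k, Category.assoc, hi]
      apply sqExt_hom_ext
      · rw [Category.assoc, sqExtLift_fst, Category.id_comp, h1, comp_zero]
      · rw [Category.assoc, sqExtLift_snd]
        simp
    · rw [← Category.assoc, hi, sqExtLift_snd]
  have : IsIso ((tensorMonad R).forget.map (idealModuleSqExtHom N)) := by
    rw [hk] at h3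
    exact h3
  exact isIso_of_reflects_iso _ (tensorMonad R).forget

instance : (idealModule R).EssSurj where
  mem_essImage N := ⟨sqExtAb N, ⟨asIso (idealModuleSqExtHom N)⟩⟩

instance idealModule_isEquivalence : (idealModule R).IsEquivalence where

end IdealModule
end Plethysm

end

noncomputable section

namespace Plethysm

/-! ### Differentials and free abelian group objects over a ring -/

section Differentials

open scoped MonObj

attribute [local instance] Over.cartesianMonoidalCategory Over.braidedCategory

variable {A : Type u} [Category.{v} A] [MonoidalCategory A] [SymmetricCategory A]

section
variable (R : CommMon A) (M : A)

/-- The free module on an object. -/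
def freeModule : (tensorMonad R).Algebra :=
  moduleMk (R.X ⊗ M) ((α_ _ _ _).inv ≫ μ[R.X] ▷ M)
    (by
      rw [associator_inv_naturality_left_assoc, ← comp_whiskerRight, MonObj.one_mul]
      monoidal)
    (by
      rw [associator_inv_naturality_left_assoc, ← comp_whiskerRight, MonObj.mul_assoc]
      simp only [comp_whiskerRight, MonoidalCategory.whiskerLeft_comp, Category.assoc,
        associator_inv_naturality_middle_assoc]
      monoidal)

/-- The inclusion of the generators of the free module. -/
def freeModuleUnit : M ⟶ (freeModule R M).A := (λ_ M).inv ≫ η[R.X] ▷ M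

variable {R M}

lemma tact_freeModuleUnit : tact (freeModule R M) (𝟙 R.X) (freeModuleUnit R M) = 𝟙 (R.X ⊗ M) := by
  rw [tact, id_tensorHom]
  change R.X ◁ ((λ_ M).inv ≫ η[R.X] ▷ M) ≫ (α_ _ _ _).inv ≫ μ[R.X] ▷ M = _
  rw [MonoidalCategory.whiskerLeft_comp, Category.assoc, associator_inv_naturality_middle_assoc,
    ← comp_whiskerRight, MonObj.mul_one]
  monoidal

lemma unit_tact {N : (tensorMonad R).Algebra} {W : A} (n : W ⟶ N.A) :
    ((λ_ W).inv ≫ η[R.X] ▷ W) ≫ tact N (𝟙 R.X) n = n := by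
  rw [Category.assoc, whiskerRight_tact, Category.comp_id, one_tact, Iso.inv_hom_id_assoc]

/-- The universal property of the free module. -/
def freeModuleEquiv (N : (tensorMonad R).Algebra) : (freeModule R M ⟶ N) ≃ (M ⟶ N.A) where
  toFun h := freeModuleUnit R M ≫ h.f
  invFun n := moduleHomMk (N := freeModule R M) (tact N (𝟙 R.X) n) (by
    have h : act (freeModule R M) = (α_ _ _ _).inv ≫ μ[R.X] ▷ M := rfl
    rw [h]
    have h2 : R.X ◁ tact N (𝟙 R.X) n ≫ act N = tact N (𝟙 _) (tact N (𝟙 _) n) := by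
      rw [act_eq_tact, whiskerLeft_tact, Category.comp_id]
    have h3 : (α_ _ _ _).inv ≫ μ[R.X] ▷ M ≫ tact N (𝟙 R.X) n = tact N (𝟙 _) (tact N (𝟙 _) n) := by
      rw [whiskerRight_tact, Category.comp_id, mul_eq_tmul, tmul_tact, Iso.inv_hom_id_assoc]
    exact h2.trans (h3.symm.trans (Category.assoc _ _ _).symm))
  left_inv h := by
    apply Monad.Algebra.Hom.ext
    change tact N (𝟙 R.X) (freeModuleUnit R M ≫ h.f) = h.f
    rw [← tact_map, tact_freeModuleUnit]
    exact Category.id_comp _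
  right_inv n := unit_tact n

lemma freeModuleEquiv_apply {N : (tensorMonad R).Algebra} (h : freeModule R M ⟶ N) :
    freeModuleEquiv N h = freeModuleUnit R M ≫ h.f := rfl

end

variable [Preadditive A] [MonoidalPreadditive A] [HasCokernels A]
  [∀ M : A, (tensorLeft M).IsLeftAdjoint] {R : CommMon A}

section
variable (X : Over R)

/-- The failure of the inclusion of the generators to be a derivation. -/
def leibnizRelation : X.left.X ⊗ X.left.X ⟶ (freeModule R X.left.X).A :=
  μ[X.left.X] ≫ freeModuleUnit R X.left.X -
    tact _ (und X.hom) (freeModuleUnit R X.left.X) -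
    (β_ _ _).hom ≫ tact _ (und X.hom) (freeModuleUnit R X.left.X)

lemma leibnizRelation_comp {N : (tensorMonad R).Algebra} (h : freeModule R X.left.X ⟶ N) :
    leibnizRelation X ≫ h.f = 0 ↔ freeModuleEquiv N h ∈ der X N := by
  rw [leibnizRelation, Preadditive.sub_comp, Preadditive.sub_comp, Category.assoc, Category.assoc,
    tact_map, freeModuleEquiv_apply, sub_sub, sub_eq_zero]
  rfl

/-- The module of differentials of a ring over `R`, with scalars extended to `R`. -/
def differentials : (tensorMonad R).Algebra :=
  -- The Leibniz relation is multiplied by `R` before the cokernel is taken, so that the image is a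
  -- submodule. Since `R` has a unit, a linear map kills the enlarged relation exactly when it kills
  -- the original one.
  quotModule (N := freeModule R X.left.X) (tact _ (𝟙 R.X) (leibnizRelation X)) (by
    rw [← Category.assoc, act_eq_tact, whiskerLeft_tact, Category.comp_id,
      ← Iso.inv_hom_id_assoc (α_ R.X R.X _) (tact _ (𝟙 R.X) (tact _ (𝟙 R.X) _)), ← tmul_tact,
      ← Category.comp_id (tmul _ _), ← whiskerRight_tact, Category.assoc, Category.assoc,
      cokernel.condition]
    simp)

/-- The differentials represent derivations. -/
def differentialsEquiv (N : (tensorMonad R).Algebra) : (differentials X ⟶ N) ≃ der X N :=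
  (quotEquiv _ _).symm.trans ((freeModuleEquiv N).subtypeEquiv fun h => by
    rw [← leibnizRelation_comp, tact_map]
    constructor
    · intro h0
      rw [← unit_tact (N := N) (leibnizRelation X ≫ h.f), h0, comp_zero]
    · intro h0
      rw [h0, tact_zero])

lemma differentialsEquiv_comp {N N' : (tensorMonad R).Algebra} (h : differentials X ⟶ N)
    (φ : N ⟶ N') :
    differentialsEquiv X N' (h ≫ φ) = derPostcomp φ (differentialsEquiv X N h) := by
  apply Subtype.ext
  exact (congrArg (freeModuleUnit R X.left.X ≫ ·) (Category.assoc (quotπ _ _).f h.f φ.f).symm).trans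
    (Category.assoc (freeModuleUnit R X.left.X) ((quotπ _ _).f ≫ h.f) φ.f).symm

end

variable [HasFiniteLimits A] [HasBinaryBiproducts A]

variable (R) in
/-- The inverse of the equivalence `idealModule R` is left adjoint to it. -/
def idealModuleAdj : (idealModule R).inv ⊣ idealModule R :=
  (idealModule R).asEquivalence.symm.toAdjunction

variable (R) in
/-- The free abelian group object on a ring over `R`. -/
def freeAbEquiv (X : Over R) (G : AbOver R) :
    ((idealModule R).inv.obj (differentials X) ⟶ G) ≃ (X ⟶ (AbOver.forget R).obj G) :=
  (((idealModuleAdj R).homEquiv _ _).trans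
    (differentialsEquiv X _)).trans (derEquiv G X).symm

/-- Maps from `X` to `G` are derivations, derivations are linear maps out of the differentials, and
linear maps are homomorphisms of abelian group objects. -/
instance isRightAdjoint_abForget : (AbOver.forget R).IsRightAdjoint := by
  refine (Adjunction.adjunctionOfEquivLeft (G := AbOver.forget R) (freeAbEquiv R) ?_).isRightAdjoint
  intro X G H g f
  change (derEquiv H X).symm _ = (derEquiv G X).symm _ ≫ AbOver.homOver g
  rw [Equiv.symm_apply_eq, derEquiv_comp, Equiv.apply_symm_apply]
  change differentialsEquiv X _ ((idealModuleAdj R).homEquiv _ _ _) = _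
  rw [Adjunction.homEquiv_naturality_right, Equiv.trans_apply, ← differentialsEquiv_comp]

end Differentials

/-! ### Abelian group objects in augmented rings -/

section Unit

open scoped MonObj

attribute [local instance] Over.cartesianMonoidalCategory Over.braidedCategory

variable {A : Type u} [Category.{v} A] [MonoidalCategory A] [SymmetricCategory A]

/-- The unit map of the trivial ring is the identity, so the unit axiom of a module already
prescribes the whole action. -/
lemma act_trivial (N : (tensorMonad (CommMon.trivial A)).Algebra) : act N = (λ_ N.A).hom := by
  have h := one_tact (N := N) (𝟙 N.A)
  rw [Category.comp_id] at h
  rw [← h, act_eq_tact]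
  rfl

instance : (tensorMonad (CommMon.trivial A)).forget.Full where
  map_surjective {N N'} f := ⟨moduleHomMk f (by
    rw [act_trivial, act_trivial]
    exact leftUnitor_naturality _), rfl⟩

instance : (tensorMonad (CommMon.trivial A)).forget.EssSurj where
  mem_essImage M := ⟨moduleMk M (λ_ M).hom
    ((congrArg (· ≫ (λ_ M).hom) (id_whiskerRight _ _)).trans (Category.id_comp _)) (by
      change (λ_ (𝟙_ A)).hom ▷ M ≫ (λ_ M).hom = _
      monoidal), ⟨Iso.refl _⟩⟩

instance : (tensorMonad (CommMon.trivial A)).forget.IsEquivalence where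

variable [Preadditive A] [MonoidalPreadditive A] [HasFiniteLimits A] [HasBinaryBiproducts A]

/-- Square-zero extensions of the unit by a module. -/
def sqExtTrivial (N : (tensorMonad (CommMon.trivial A)).Algebra) :
    sqExt N ⟶ sqZero.obj N.A :=
  Over.homMk (ringHom (S := sqExtRing N) (S' := sqZeroRing N.A) (𝟙 (𝟙_ A ⊞ N.A))
    (by
      apply biprod.hom_ext
      · exact (congrArg (· ≫ biprod.fst) (Category.comp_id _)).trans
          ((sqExt_one_fst N).trans biprod.inl_fst.symm)
      · exact (congrArg (· ≫ biprod.snd) (Category.comp_id _)).trans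
          ((sqExt_one_snd N).trans biprod.inl_snd.symm))
    (by
      have h : sqExtMul N = sqZeroMul N.A := by
        have h1 : ((biprod.fst : 𝟙_ A ⊞ N.A ⟶ 𝟙_ A) ⊗ₘ (biprod.snd : 𝟙_ A ⊞ N.A ⟶ N.A)) ≫ act N =
            (biprod.fst ⊗ₘ biprod.snd) ≫ (λ_ N.A).hom := congrArg _ (act_trivial N)
        have h2 : (β_ (𝟙_ A ⊞ N.A) (𝟙_ A ⊞ N.A)).hom ≫
            ((biprod.fst : 𝟙_ A ⊞ N.A ⟶ 𝟙_ A) ⊗ₘ (biprod.snd : 𝟙_ A ⊞ N.A ⟶ N.A)) ≫ act N =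
            (biprod.snd ⊗ₘ biprod.fst) ≫ (ρ_ N.A).hom := by
          refine (congrArg ((β_ (𝟙_ A ⊞ N.A) (𝟙_ A ⊞ N.A)).hom ≫ ·) h1).trans ?_
          rw [← BraidedCategory.braiding_naturality_assoc, braiding_leftUnitor]
        exact congrArg (biprod.lift _) (congrArg₂ (· + ·) h1 h2)
      exact (Category.comp_id _).trans (h.trans (mul_eq_tmul (S := sqZeroRing N.A)))))
    (und_injective (Category.id_comp _))

instance isIso_sqExtTrivial (N : (tensorMonad (CommMon.trivial A)).Algebra) :
    IsIso (sqExtTrivial N) := by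
  have : IsIso (und (sqExtTrivial N).left) := inferInstanceAs (IsIso (𝟙 (𝟙_ A ⊞ N.A)))
  exact isIso_of_isIso_und_left _

/-- An augmented ring that is an abelian group object is a square-zero extension. -/
def abToSqZero (G : AbOver (CommMon.trivial A)) :
    G.toOver ⟶ sqZero.obj ((idealModule (CommMon.trivial A)).obj G).A :=
  sqExtOfDer (pointedDer G.zero G.zero_hom (idealMul_toOver G)) ≫
    sqExtTrivial (pointedModule G.zero)

instance isIso_abToSqZero (G : AbOver (CommMon.trivial A)) : IsIso (abToSqZero G) := by
  exact IsIso.comp_isIso' (isIso_sqExtOfDer_pointedDer G.zero G.zero_hom (idealMul_toOver G))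
    (isIso_sqExtTrivial (pointedModule G.zero))

lemma und_abToSqZero (G : AbOver (CommMon.trivial A)) : und (abToSqZero G).left =
    biprod.lift (und G.toOver.hom : G.toOver.left.X ⟶ 𝟙_ A) (abRetr G) :=
  Category.comp_id _

lemma comp_biprod_lift {X Y U M M' : A} {f : X ⟶ Y} {a : X ⟶ U} {b : Y ⟶ U} {c : X ⟶ M}
    {d : Y ⟶ M'} {g : M ⟶ M'} (h1 : f ≫ b = a) (h2 : c ≫ g = f ≫ d) :
    f ≫ biprod.lift b d = biprod.lift a c ≫ biprod.map (𝟙 _) g := by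
  apply biprod.hom_ext <;> simp [h1, h2]

variable (A) in
/-- Abelian group objects in augmented rings are square-zero extensions. -/
def abForgetIso : AbOver.forget (CommMon.trivial A) ≅
    (idealModule (CommMon.trivial A) ⋙ (tensorMonad (CommMon.trivial A)).forget) ⋙ sqZero :=
  NatIso.ofComponents
    (fun G => @asIso _ _ G.toOver (sqZero.obj _) (abToSqZero G) (isIso_abToSqZero G)) (by
    intro G H f
    change AbOver.homOver f ≫ abToSqZero H = abToSqZero G ≫ sqZero.map ((idealModule _).map f).f
    apply Over.OverMorphism.ext
    apply und_injective
    rw [Over.comp_left, Over.comp_left, und_comp, und_comp, und_abToSqZero, und_abToSqZero]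
    exact comp_biprod_lift (und_w (AbOver.homOver f)) (abRetr_naturality f))

end Unit
end Plethysm

end

noncomputable section

namespace Plethysm

/-! ### Left exact left adjoints on slices and abelian group objects -/

section Post

open scoped MonObj

attribute [local instance] Over.cartesianMonoidalCategory Over.braidedCategory

variable {C : Type u} {D : Type w} [Category.{v} C] [Category.{v} D]
  [HasFiniteLimits C] [HasFiniteLimits D] (F : C ⥤ D) [PreservesFiniteLimits F]

instance hasEqualizers_over (X : C) : HasEqualizers (Over X) :=
  hasLimitsOfShape_of_hasLimitsOfShape_createsLimitsOfShape (Over.forget X)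

instance preservesEqualizers_overForget (X : C) :
    PreservesLimitsOfShape WalkingParallelPair (Over.forget X) := inferInstance

instance preservesEqualizers_overPost (X : C) :
    PreservesLimitsOfShape WalkingParallelPair (Over.post (X := X) F) := by
  have : ReflectsLimitsOfShape WalkingParallelPair (Over.forget (F.obj X)) :=
    reflectsLimitsOfShape_of_reflectsIsomorphisms
  have : PreservesLimitsOfShape WalkingParallelPair (Over.post (X := X) F ⋙ Over.forget (F.obj X)) :=
    inferInstanceAs (PreservesLimitsOfShape WalkingParallelPair (Over.forget X ⋙ F))
  exact preservesLimitsOfShape_of_reflects_of_preserves _ (Over.forget (F.obj X))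

instance reflectsIso_overPost (X : C) [F.ReflectsIsomorphisms] :
    (Over.post (X := X) F).ReflectsIsomorphisms where
  reflects f hf := by
    have : IsIso ((Over.forget X ⋙ F).map f) :=
      inferInstanceAs (IsIso ((Over.forget (F.obj X)).map ((Over.post F).map f)))
    exact isIso_of_reflects_iso f (Over.forget X ⋙ F)

instance hasEqualizers_abOver (X : C) : HasEqualizers (AbOver X) :=
  hasEqualizers_commGrp

instance preservesEqualizers_abOverForget (X : C) :
    PreservesLimitsOfShape WalkingParallelPair (AbOver.forget X) :=
  preservesEqualizers_commGrpForget

instance preservesEqualizers_abOverPost (X : C) :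
    PreservesLimitsOfShape WalkingParallelPair (AbOver.post F X) :=
  letI : (Over.post F (X := X)).Braided := .ofChosenFiniteProducts _
  preservesEqualizers_mapCommGrp (Over.post F (X := X))

instance reflectsIso_abOverPost (X : C) [F.ReflectsIsomorphisms] :
    (AbOver.post F X).ReflectsIsomorphisms :=
  letI : (Over.post F (X := X)).Braided := .ofChosenFiniteProducts _
  reflectsIso_mapCommGrp (Over.post F (X := X))

variable {F} {G : D ⥤ C} (a : F ⊣ G) (X : C)

/-- The right adjoint of `Over.post`. -/
def overPostRight : Over (F.obj X) ⥤ Over X := Over.post G ⋙ Over.pullback (a.unit.app X)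

/-- `Over.post` is left adjoint to `overPostRight`. -/
def overPostAdj : Over.post F ⊣ overPostRight a X := Over.postAdjunctionLeft a

/-- The right adjoint of `AbOver.post`. -/
def abPostRight : AbOver (F.obj X) ⥤ AbOver X :=
  letI : (overPostRight a X).Braided :=
    have := (overPostAdj a X).rightAdjoint_preservesLimits
    .ofChosenFiniteProducts _
  (overPostRight a X).mapCommGrp

/-- `AbOver.post` is left adjoint to `abPostRight`. -/
def abPostAdj : AbOver.post F X ⊣ abPostRight a X :=
  letI : (Over.post F (X := X)).Braided := .ofChosenFiniteProducts _
  letI : (overPostRight a X).Braided :=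
    have := (overPostAdj a X).rightAdjoint_preservesLimits
    .ofChosenFiniteProducts _
  (overPostAdj a X).mapCommGrp

lemma abPostAdj_counit (Z : AbOver (F.obj X)) :
    AbOver.homOver ((abPostAdj a X).counit.app Z) = (overPostAdj a X).counit.app Z.toOver := by
  exact (Category.id_comp _).trans (Category.comp_id ((overPostAdj a X).counit.app Z.toOver))

/-- The counit for abelian group objects lies over the counit for slices, which turns `squareHom`
into the adjunction bijection of the slices. This is where the hypothesis `hb` of the descent
theorem comes from. -/
lemma squareHom_postForgetIso (Y : Over X) (Z : AbOver (F.obj X))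
    (f : Y ⟶ (overPostRight a X).obj Z.toOver) :
    squareHom (AbOver.postForgetIso F X) (abPostAdj a X) Y Z f =
      ((overPostAdj a X).homEquiv Y Z.toOver).symm f := by
  rw [Adjunction.homEquiv_counit]
  change (Over.post F).map f ≫ 𝟙 _ ≫ AbOver.homOver ((abPostAdj a X).counit.app Z) = _
  rw [abPostAdj_counit, Category.id_comp]

lemma squareHom_postForgetIso_bijective (Y : Over X) (Z : AbOver (F.obj X)) :
    Function.Bijective (squareHom (AbOver.postForgetIso F X) (abPostAdj a X) Y Z) := by
  have : squareHom (AbOver.postForgetIso F X) (abPostAdj a X) Y Z =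
    ((overPostAdj a X).homEquiv Y Z.toOver).symm :=
    funext (squareHom_postForgetIso a X Y Z)
  rw [this]
  exact Equiv.bijective _

include a in
/-- Free abelian group objects over `X` exist if they exist over `F X`. -/
theorem isRightAdjoint_abOverForget [F.ReflectsIsomorphisms]
    [(AbOver.forget (F.obj X)).IsRightAdjoint] : (AbOver.forget X).IsRightAdjoint := by
  -- `AbOver.post F X` is comonadic by the crude criterion, which is what descent of the left
  -- adjoint requires.
  have : (AbOver.post F X).IsLeftAdjoint := (abPostAdj a X).isLeftAdjoint
  have : Comonad.PreservesLimitOfIsCoreflexivePair (AbOver.post F X) :=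
    ⟨fun _ _ _ _ _ => inferInstance⟩
  have h : (Comonad.comparison (abPostAdj a X)).IsEquivalence :=
    (Comonad.comonadicOfHasPreservesCoreflexiveEqualizersOfReflectsIsomorphisms
      (abPostAdj a X)).eqv
  exact isRightAdjoint_of_bijective (AbOver.postForgetIso F X) (abPostAdj a X)
    (squareHom_postForgetIso_bijective a X) h

end Post

end Plethysm

end

noncomputable section

namespace Plethysm

/-! ### Limits, colimits and adjoints for modules and for abelian group objects over Λ-rings -/

section Modules

variable {A : Type u} [Category.{v} A] [MonoidalCategory A] [SymmetricCategory A]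

instance isLeftAdjoint_tensorMonad (R : CommMon A) [h : (tensorLeft R.X).IsLeftAdjoint] :
    (tensorMonad R).toFunctor.IsLeftAdjoint := h

instance isLeftAdjoint_moduleForget (R : CommMon A) [(tensorLeft R.X).IsLeftAdjoint] :
    (tensorMonad R).forget.IsLeftAdjoint :=
  isLeftAdjoint_forget_of_isLeftAdjoint _

instance isRightAdjoint_moduleForget (R : CommMon A) : (tensorMonad R).forget.IsRightAdjoint :=
  (tensorMonad R).adj.isRightAdjoint

/-- As a left adjoint, `R ⊗ -` preserves coequalizers, so they are created by the forgetful functor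
of its algebras. -/
instance hasCoequalizers_module (R : CommMon A) [(tensorLeft R.X).IsLeftAdjoint]
    [HasCoequalizers A] : HasCoequalizers (tensorMonad R).Algebra := by
  have : PreservesColimitsOfShape WalkingParallelPair (tensorMonad R).toFunctor :=
    (Adjunction.ofIsLeftAdjoint (tensorMonad R).toFunctor).leftAdjoint_preservesColimits.1
  have := monadicCreatesColimitsOfShapeOfPreservesColimitsOfShape (J := WalkingParallelPair)
    (tensorMonad R).forget
  exact hasColimitsOfShape_of_hasColimitsOfShape_createsColimitsOfShape (tensorMonad R).forget

end Modules

namespace Plethory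

variable {A : Type u} [Category.{v} A] [MonoidalCategory A] [SymmetricCategory A] (Λ : Plethory A)

/-- The defining property of a plethory, transferred from the monad to its algebras: underlying
rings have cofree `Λ`-rings. -/
instance isLeftAdjoint_toCommMon : Λ.toCommMon.IsLeftAdjoint :=
  have := Λ.isLeftAdjoint
  isLeftAdjoint_forget_of_isLeftAdjoint _

instance isRightAdjoint_toCommMon : Λ.toCommMon.IsRightAdjoint := Λ.monad.adj.isRightAdjoint

instance isRightAdjoint_forget [(CommMon.forget A).IsRightAdjoint] : Λ.forget.IsRightAdjoint :=
  inferInstance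

variable [HasFiniteLimits A]

instance hasFiniteLimits_ring : HasFiniteLimits Λ.Ring where
  out _ _ _ := hasLimitsOfShape_of_hasLimitsOfShape_createsLimitsOfShape Λ.toCommMon

/-- The adjunction between abelian group objects over a `Λ`-ring and over its underlying ring. -/
def abAdj (B : Λ.Ring) : AbOver.post Λ.toCommMon B ⊣
    abPostRight (Adjunction.ofIsLeftAdjoint Λ.toCommMon) B :=
  abPostAdj (Adjunction.ofIsLeftAdjoint Λ.toCommMon) B

variable [Preadditive A] [MonoidalPreadditive A] [HasBinaryBiproducts A]

instance isLeftAdjoint_abToModule (B : Λ.Ring) : (Λ.abToModule B).IsLeftAdjoint :=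
  have := (Λ.abAdj B).isLeftAdjoint
  inferInstanceAs (AbOver.post Λ.toCommMon B ⋙ idealModule (Λ.toCommMon.obj B)).IsLeftAdjoint

instance reflectsIso_abToModule (B : Λ.Ring) : (Λ.abToModule B).ReflectsIsomorphisms :=
  inferInstanceAs (AbOver.post Λ.toCommMon B ⋙ idealModule (Λ.toCommMon.obj B)).ReflectsIsomorphisms

instance preservesEqualizers_abToModule (B : Λ.Ring) :
    PreservesLimitsOfShape WalkingParallelPair (Λ.abToModule B) :=
  inferInstanceAs (PreservesLimitsOfShape WalkingParallelPair
    (AbOver.post Λ.toCommMon B ⋙ idealModule (Λ.toCommMon.obj B)))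

lemma nonempty_comonadic_abToModule (B : Λ.Ring) :
    Nonempty (ComonadicLeftAdjoint (Λ.abToModule B)) :=
  nonempty_comonadicLeftAdjoint _

instance reflectsIso_abForget (B : Λ.Ring) : (Λ.abForget B).ReflectsIsomorphisms :=
  inferInstanceAs (Λ.abToModule B ⋙ (tensorMonad B.A).forget).ReflectsIsomorphisms

instance preservesEqualizers_abForget (B : Λ.Ring) :
    PreservesLimitsOfShape WalkingParallelPair (Λ.abForget B) :=
  inferInstanceAs (PreservesLimitsOfShape WalkingParallelPair
    (Λ.abToModule B ⋙ (tensorMonad B.A).forget))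

variable [HasCokernels A] [∀ M : A, (tensorLeft M).IsLeftAdjoint]

/-- A comonadic functor creates colimits, so coequalizers come from those of `B`-modules. -/
instance hasCoequalizers_ab (B : Λ.Ring) : HasCoequalizers (Λ.Ab B) := by
  obtain ⟨h⟩ := Λ.nonempty_comonadic_abToModule B
  have := comonadicCreatesColimits.{0, 0} (Λ.abToModule B)
  have : HasCoequalizers A := Preadditive.hasCoequalizers_of_hasCokernels
  exact hasColimitsOfShape_of_hasColimitsOfShape_createsColimitsOfShape (Λ.abToModule B)

instance preservesCoequalizers_abToModule (B : Λ.Ring) :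
    PreservesColimitsOfShape WalkingParallelPair (Λ.abToModule B) :=
  (Adjunction.ofIsLeftAdjoint (Λ.abToModule B)).leftAdjoint_preservesColimits.1

instance isLeftAdjoint_abForget (B : Λ.Ring) : (Λ.abForget B).IsLeftAdjoint :=
  inferInstanceAs (Λ.abToModule B ⋙ (tensorMonad B.A).forget).IsLeftAdjoint

instance preservesCoequalizers_abForget (B : Λ.Ring) :
    PreservesColimitsOfShape WalkingParallelPair (Λ.abForget B) :=
  (Adjunction.ofIsLeftAdjoint (Λ.abForget B)).leftAdjoint_preservesColimits.1

/-- Over the underlying ring the free objects come from differentials; they descend to `Λ`-rings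
along the comonadic functor `AbOver.post`. -/
instance isRightAdjoint_abOverForget_ring (B : Λ.Ring) : (AbOver.forget B).IsRightAdjoint :=
  have : (AbOver.forget (Λ.toCommMon.obj B)).IsRightAdjoint :=
    isRightAdjoint_abForget (R := Λ.toCommMon.obj B)
  isRightAdjoint_abOverForget (Adjunction.ofIsLeftAdjoint Λ.toCommMon) B

theorem isDistributiveSquare_postForgetIso (B : Λ.Ring) :
    IsDistributiveSquare (AbOver.postForgetIso Λ.toCommMon B) :=
  have : (AbOver.forget (Λ.toCommMon.obj B)).IsRightAdjoint :=
    isRightAdjoint_abForget (R := Λ.toCommMon.obj B)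
  ⟨_, _, Adjunction.ofIsRightAdjoint (AbOver.forget B),
    Adjunction.ofIsRightAdjoint (AbOver.forget (Λ.toCommMon.obj B)),
    isDistributiveSquare_of_bijective _ _
      (squareHom_postForgetIso_bijective (Adjunction.ofIsLeftAdjoint Λ.toCommMon) B) _ _⟩

end Plethory

/-! ### Augmented free objects, and plethystic forgetful functors -/

section FreeAugEquiv

variable {A : Type u} [Category.{v} A] [MonoidalCategory A] [SymmetricCategory A]
  [Preadditive A] [HasFiniteLimits A] {D : Type w} [Category.{v} D] (V : D ⥤ CommMon A)
  {Fr : A ⥤ D} (adj : Fr ⊣ V ⋙ CommMon.forget A) (E : D)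

variable {E} in
/-- The map of `A` adjoint to a map out of a free object. -/
def transpose {M : A} {Z : D} : (Fr.obj M ⟶ Z) ≃ (M ⟶ (V.obj Z).X) := adj.homEquiv M Z

lemma transpose_comp {M : A} {Z Z' : D} (f : Fr.obj M ⟶ Z) (g : Z ⟶ Z') :
    transpose V adj (f ≫ g) = transpose V adj f ≫ und (V.map g) :=
  adj.homEquiv_naturality_right f g

lemma transpose_map_comp {M M' : A} {Z : D} (h : M' ⟶ M) (f : Fr.obj M ⟶ Z) :
    transpose V adj (Fr.map h ≫ f) = h ≫ transpose V adj f :=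
  adj.homEquiv_naturality_left h f

/-- The augmentation of the free object. -/
def freeAugHom (M : A) : Fr.obj M ⟶ E := ((freeAug adj E).obj M).hom

lemma transpose_freeAugHom (M : A) : transpose V adj (freeAugHom V adj E M) = 0 :=
  Equiv.apply_symm_apply (adj.homEquiv M E) 0

variable {E} in
/-- The map of underlying objects of a map out of the augmented free object. -/
def freeAugLeft {M : A} {Y : Over E} (g : (freeAug adj E).obj M ⟶ Y) : Fr.obj M ⟶ Y.left := g.left

variable {E} in
lemma freeAugLeft_comp {M : A} {Y : Over E} (g : (freeAug adj E).obj M ⟶ Y) :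
    freeAugLeft V adj g ≫ Y.hom = freeAugHom V adj E M := Over.w g

/-- Maps out of the augmented free object are maps to the augmentation ideal. -/
def freeAugEquiv (M : A) (Y : Over E) :
    ((freeAug adj E).obj M ⟶ Y) ≃ (M ⟶ ideal ((Over.post V).obj Y)) where
  toFun g := idealLift ((Over.post V).obj Y) (transpose V adj (freeAugLeft V adj g)) (by
    change _ ≫ und (V.map Y.hom) = 0
    rw [← transpose_comp, freeAugLeft_comp, transpose_freeAugHom])
  invFun m := Over.homMk ((transpose V adj).symm (m ≫ idealι ((Over.post V).obj Y))) (by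
    change _ = freeAugHom V adj E M
    have key (k : M ⟶ (V.obj Y.left).X) (h : k ≫ und (V.map Y.hom) = 0) :
        (transpose V adj).symm k ≫ Y.hom = freeAugHom V adj E M := by
      apply (transpose V adj).injective
      rw [transpose_comp, transpose_freeAugHom, Equiv.apply_symm_apply, h]
    refine key _ ((Category.assoc _ _ _).trans ?_)
    exact (congrArg (m ≫ ·) (idealι_und ((Over.post V).obj Y))).trans comp_zero)
  left_inv g := by
    apply Over.OverMorphism.ext
    change (transpose V adj).symm _ = freeAugLeft V adj g
    rw [Equiv.symm_apply_eq]
    exact idealLift_ι _ _ _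
  right_inv m := by
    rw [← cancel_mono (idealι ((Over.post V).obj Y))]
    exact (idealLift_ι _ _ _).trans (Equiv.apply_symm_apply (transpose V adj) _)

lemma freeAugEquiv_ι (M : A) (Y : Over E) (g : (freeAug adj E).obj M ⟶ Y) :
    freeAugEquiv V adj E M Y g ≫ idealι ((Over.post V).obj Y) =
      transpose V adj (freeAugLeft V adj g) :=
  idealLift_ι _ _ _

lemma freeAugEquiv_map_comp {M M' : A} (Y : Over E) (f : M' ⟶ M) (g : (freeAug adj E).obj M ⟶ Y) :
    freeAugEquiv V adj E M' Y ((freeAug adj E).map f ≫ g) = f ≫ freeAugEquiv V adj E M Y g := by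
  rw [← cancel_mono (idealι ((Over.post V).obj Y)), Category.assoc, freeAugEquiv_ι,
    freeAugEquiv_ι]
  exact transpose_map_comp V adj f (freeAugLeft V adj g)

lemma freeAugEquiv_comp {M : A} {Y Y' : Over E} (g : (freeAug adj E).obj M ⟶ Y) (f : Y ⟶ Y') :
    freeAugEquiv V adj E M Y' (g ≫ f) =
      freeAugEquiv V adj E M Y g ≫ idealOverMap ((Over.post V).map f) := by
  rw [← cancel_mono (idealι ((Over.post V).obj Y')), Category.assoc, freeAugEquiv_ι,
    idealOverMap_ι, ← Category.assoc, freeAugEquiv_ι]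
  exact transpose_comp V adj (freeAugLeft V adj g) f.left

/-- The augmented free object functor is left adjoint to the augmentation ideal. -/
def freeAugAdj : freeAug adj E ⊣ Over.post V ⋙ augIdeal (V.obj E) :=
  Adjunction.mkOfHomEquiv
    { homEquiv := freeAugEquiv V adj E
      homEquiv_naturality_left_symm := by
        intro M M' Y f m
        refine (Equiv.symm_apply_eq (freeAugEquiv V adj E M Y)).2 ?_
        refine Eq.trans ?_ (freeAugEquiv_map_comp V adj E Y f _).symm
        exact congrArg (f ≫ ·) (Equiv.apply_symm_apply (freeAugEquiv V adj E M' Y) m).symm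
      homEquiv_naturality_right := fun g f => freeAugEquiv_comp V adj E g f }

end FreeAugEquiv

namespace Plethory

variable {A : Type u} [Category.{v} A] [MonoidalCategory A] [SymmetricCategory A] (Λ : Plethory A)
  [HasFiniteLimits A] [Preadditive A] [MonoidalPreadditive A] [HasBinaryBiproducts A]
  [HasCokernels A] [∀ M : A, (tensorLeft M).IsLeftAdjoint] [(CommMon.forget A).IsRightAdjoint]

/-- The functor is a composite of two right adjoints: forgetting the group structure, and the
augmentation ideal of a `Λ`-ring over `B`, whose left adjoint is the free `Λ`-ring with the zero
augmentation. -/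
instance isRightAdjoint_abForget (B : Λ.Ring) : (Λ.abForget B).IsRightAdjoint :=
  have : (Over.post Λ.toCommMon ⋙ augIdeal (Λ.toCommMon.obj B)).IsRightAdjoint :=
    (freeAugAdj Λ.toCommMon (Adjunction.ofIsRightAdjoint Λ.forget) B).isRightAdjoint
  inferInstanceAs (AbOver.forget B ⋙ Over.post Λ.toCommMon ⋙
    augIdeal (Λ.toCommMon.obj B)).IsRightAdjoint

/-- The adjoint triangle theorem: modules are monadic over the base, the composite to the base is a
right adjoint, and abelian group objects have coequalizers. -/
instance isRightAdjoint_abToModule (B : Λ.Ring) : (Λ.abToModule B).IsRightAdjoint :=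
  have : (Λ.abToModule B ⋙ (tensorMonad B.A).forget).IsRightAdjoint :=
    Λ.isRightAdjoint_abForget B
  isRightAdjoint_triangle_lift_monadic (tensorMonad B.A).forget

/-- Beck's theorem applies in both directions: the functor is conservative, has both adjoints, and
preserves equalizers and coequalizers, all of which exist in its source. -/
theorem isPlethystic_abForget (B : Λ.Ring) : IsPlethystic (Λ.abForget B) :=
  ⟨nonempty_monadicRightAdjoint _, nonempty_comonadicLeftAdjoint _⟩

theorem isPlethystic_abToModule (B : Λ.Ring) : IsPlethystic (Λ.abToModule B) :=
  ⟨nonempty_monadicRightAdjoint _, nonempty_comonadicLeftAdjoint _⟩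

end Plethory

end Plethysm

end

noncomputable section

namespace Plethysm

/-! ### Coproducts of rings and Λ-rings -/

section Coproducts

open scoped MonObj

variable {A : Type u} [Category.{v} A] [MonoidalCategory A] [SymmetricCategory A]

/-- The tensor product of commutative rings. -/
def ringTensor (R S : CommMon A) : CommMon A := ⟨R.X ⊗ S.X⟩

variable (R S : CommMon A)

lemma isMonHom_one : IsMonHom η[S.X] where
  one_hom := Category.id_comp _
  mul_hom := by
    rw [tensorHom_def', Category.assoc, MonObj.one_mul, leftUnitor_naturality]
    rfl

/-- The inclusion of the left factor of a tensor product of rings. -/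
def ringInl : R ⟶ ringTensor R S :=
  have _ : IsMonHom (𝟙 R.X ⊗ₘ η[S.X]) :=
    have := isMonHom_one S
    inferInstance
  have _ : IsMonHom (ρ_ R.X).inv := inferInstance
  CommMon.homMk (Mon.Hom.mk (M := Mon.mk R.X) (N := Mon.mk (R.X ⊗ S.X))
    ((ρ_ R.X).inv ≫ (𝟙 R.X ⊗ₘ η[S.X])))

/-- The inclusion of the right factor of a tensor product of rings. -/
def ringInr : S ⟶ ringTensor R S :=
  have _ : IsMonHom (η[R.X] ⊗ₘ 𝟙 S.X) :=
    have := isMonHom_one R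
    inferInstance
  have _ : IsMonHom (λ_ S.X).inv := inferInstance
  CommMon.homMk (Mon.Hom.mk (M := Mon.mk S.X) (N := Mon.mk (R.X ⊗ S.X))
    ((λ_ S.X).inv ≫ (η[R.X] ⊗ₘ 𝟙 S.X)))

lemma und_ringInl : und (ringInl R S) = (ρ_ R.X).inv ≫ (𝟙 R.X ⊗ₘ η[S.X]) := rfl

lemma und_ringInr : und (ringInr R S) = (λ_ S.X).inv ≫ (η[R.X] ⊗ₘ 𝟙 S.X) := rfl

lemma ringTensor_mul : μ[(ringTensor R S).X] =
    tensorμ R.X S.X R.X S.X ≫ (μ[R.X] ⊗ₘ μ[S.X]) := rfl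

lemma tensorμ_units (X Y : A) :
    ((ρ_ X).inv ⊗ₘ (λ_ Y).inv) ≫ tensorμ X (𝟙_ A) (𝟙_ A) Y ≫ ((ρ_ X).hom ⊗ₘ (λ_ Y).hom) = 𝟙 _ := by
  have h : (β_ (𝟙_ A) (𝟙_ A)).hom = 𝟙 _ := by
    rw [braiding_tensorUnit_left, unitors_equal, Iso.hom_inv_id]
  rw [tensorμ, h]
  monoidal

/-- This is `(x ⊗ 1) (1 ⊗ y) = x ⊗ y`, which makes a ring map out of a tensor product determined by
its two restrictions. -/
lemma ringInl_inr : tmul (und (ringInl R S)) (und (ringInr R S)) = 𝟙 (R.X ⊗ S.X) := by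
  rw [tmul, und_ringInl, und_ringInr, ringTensor_mul]
  change (_ ⊗ₘ _) ≫ tensorμ R.X S.X R.X S.X ≫ (μ[R.X] ⊗ₘ μ[S.X]) = _
  rw [← tensorHom_comp_tensorHom_assoc, tensorμ_natural_assoc,
    tensorHom_comp_tensorHom, id_tensorHom, tensorHom_id, MonObj.mul_one, MonObj.one_mul,
    tensorμ_units]

variable {R S} {T : CommMon A}

/-- The map out of a tensor product of rings. -/
def ringDesc (f : R ⟶ T) (g : S ⟶ T) : ringTensor R S ⟶ T :=
  ringHom (S := ringTensor R S) (tmul (und f) (und g))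
    (by
      change ((λ_ (𝟙_ A)).inv ≫ (η[R.X] ⊗ₘ η[S.X])) ≫ tmul (und f) (und g) = _
      rw [Category.assoc, comp_tmul, und_one, und_one, one_tmul, Iso.inv_hom_id_assoc])
    (by
      have := T.comm
      rw [ringTensor_mul]
      change (tensorμ R.X S.X R.X S.X ≫ (μ[R.X] ⊗ₘ μ[S.X])) ≫ tmul (und f) (und g) =
        (tmul (und f) (und g) ⊗ₘ tmul (und f) (und g)) ≫ μ[T.X]
      rw [Category.assoc, comp_tmul, und_mul_hom, und_mul_hom, tmul, tmul, tmul,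
        tmul, ← tensorHom_comp_tensorHom_assoc, ← tensorμ_natural_assoc, MonObj.mul_mul_mul_comm,
        ← tensorHom_comp_tensorHom_assoc])

lemma ringInl_desc (f : R ⟶ T) (g : S ⟶ T) : ringInl R S ≫ ringDesc f g = f := by
  apply und_injective
  change ((ρ_ R.X).inv ≫ (𝟙 R.X ⊗ₘ η[S.X])) ≫ tmul (und f) (und g) = und f
  rw [Category.assoc, comp_tmul, und_one, Category.id_comp, ← braiding_tmul, one_tmul]
  simp

lemma ringInr_desc (f : R ⟶ T) (g : S ⟶ T) : ringInr R S ≫ ringDesc f g = g := by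
  apply und_injective
  change ((λ_ S.X).inv ≫ (η[R.X] ⊗ₘ 𝟙 S.X)) ≫ tmul (und f) (und g) = und g
  rw [Category.assoc, comp_tmul, und_one, Category.id_comp, one_tmul]
  simp

lemma ringTensor_hom_ext {f g : ringTensor R S ⟶ T} (h1 : ringInl R S ≫ f = ringInl R S ≫ g)
    (h2 : ringInr R S ≫ f = ringInr R S ≫ g) : f = g := by
  have key (k : ringTensor R S ⟶ T) :
      und k = tmul (und (ringInl R S ≫ k)) (und (ringInr R S ≫ k)) := by
    rw [und_comp, und_comp, ← tmul_und, ringInl_inr]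
    exact (Category.id_comp _).symm
  apply und_injective
  rw [key f, key g, h1, h2]

instance hasBinaryCoproducts_commMon : HasBinaryCoproducts (CommMon A) :=
  have (R S : CommMon A) : HasColimit (pair R S) :=
    ⟨⟨⟨BinaryCofan.mk (ringInl R S) (ringInr R S), BinaryCofan.isColimitMk
      (fun s => ringDesc s.inl s.inr) (fun _ => ringInl_desc _ _) (fun _ => ringInr_desc _ _)
      (fun _ _ h1 h2 => ringTensor_hom_ext (h1.trans (ringInl_desc _ _).symm)
        (h2.trans (ringInr_desc _ _).symm))⟩⟩⟩
  hasBinaryCoproducts_of_hasColimit_pair _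

end Coproducts

namespace Plethory

variable {A : Type u} [Category.{v} A] [MonoidalCategory A] [SymmetricCategory A] (Λ : Plethory A)

/-- The monad, a left adjoint, preserves coproducts, so its algebras inherit them from rings. They
provide the left adjoint of `Under.forget B`, and with it the free objects under `B`. -/
instance hasBinaryCoproducts_ring : HasBinaryCoproducts Λ.Ring := by
  have := Λ.isLeftAdjoint
  have : PreservesColimitsOfShape (Discrete WalkingPair) Λ.monad.toFunctor :=
    (Adjunction.ofIsLeftAdjoint Λ.monad.toFunctor).leftAdjoint_preservesColimits.1
  have := monadicCreatesColimitsOfShapeOfPreservesColimitsOfShape (J := Discrete WalkingPair)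
    Λ.toCommMon
  exact hasColimitsOfShape_of_hasColimitsOfShape_createsColimitsOfShape Λ.toCommMon

instance isRightAdjoint_underForget (B : Λ.Ring) [(CommMon.forget A).IsRightAdjoint] :
    (Λ.underForget B).IsRightAdjoint := inferInstance

end Plethory

end Plethysm

end

noncomputable section

namespace Plethysm

/-! ### Pasting a square with an equivalence -/

section SquareComp

variable {C' C : Type*} {D' : Type u} {D : Type w} {D'' : Type*} [Category* C'] [Category.{v} D']
  [Category.{v} D] [Category* C] [Category.{v} D'']
variable {U' : D' ⥤ C'} {V' : D' ⥤ D} {V : C' ⥤ C} {U₀ : D ⥤ C} (e₀ : U' ⋙ V ≅ V' ⋙ U₀)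
  {R' : D ⥤ D'} (adj' : V' ⊣ R') {E : D ⥤ D''} {U : D'' ⥤ C} (τ : U₀ ≅ E ⋙ U) {E' : D'' ⥤ D}
  (adjE : E ⊣ E')

/-- The square obtained by pasting an isomorphism `U₀ ≅ E ⋙ U` to a square. -/
def squarePaste : U' ⋙ V ≅ (V' ⋙ E) ⋙ U :=
  e₀ ≪≫ Functor.isoWhiskerLeft V' τ

lemma squareHom_squarePaste (X : C') (Z : D'') (f : X ⟶ U'.obj (R'.obj (E'.obj Z))) :
    squareHom (squarePaste e₀ τ) (adj'.comp adjE) X Z f =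
      squareHom e₀ adj' X (E'.obj Z) f ≫ τ.hom.app (E'.obj Z) ≫ U.map (adjE.counit.app Z) := by
  let ε : V'.obj (R'.obj (E'.obj Z)) ⟶ E'.obj Z := adj'.counit.app (E'.obj Z)
  let ε' : E.obj (E'.obj Z) ⟶ Z := adjE.counit.app Z
  let t (H : D) : U₀.obj H ⟶ U.obj (E.obj H) := τ.hom.app H
  have ht : U₀.map ε ≫ t _ = t _ ≫ U.map (E.map ε) := τ.hom.naturality ε
  have h1 : squareApp (squarePaste e₀ τ) (R'.obj (E'.obj Z)) =
    squareApp e₀ (R'.obj (E'.obj Z)) ≫ t _ := rfl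
  have h2 : (adj'.comp adjE).counit.app Z = E.map ε ≫ ε' := by
    simp [ε, ε']
  change V.map f ≫ squareApp (squarePaste e₀ τ) (R'.obj (E'.obj Z)) ≫
    U.map ((adj'.comp adjE).counit.app Z) = (V.map f ≫ squareApp e₀ (R'.obj (E'.obj Z)) ≫
      U₀.map ε) ≫ t _ ≫ U.map ε'
  rw [h1, h2]
  simp only [Category.assoc]
  refine congrArg (fun x => V.map f ≫ squareApp e₀ (R'.obj (E'.obj Z)) ≫ x) ?_
  refine (congrArg (t _ ≫ ·) (U.map_comp (E.map ε) ε')).trans ?_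
  refine (Category.assoc _ _ _).symm.trans ((congrArg (· ≫ U.map ε') ht.symm).trans ?_)
  exact Category.assoc _ _ _

/-- The counit of an equivalence and `τ` are invertible, so pasting changes `squareHom` only by a
bijection. -/
lemma squareHom_squarePaste_bijective [E.IsEquivalence]
    (hb : ∀ X Z, Function.Bijective (squareHom e₀ adj' X Z)) (X : C') (Z : D'') :
    Function.Bijective (squareHom (squarePaste e₀ τ) (adj'.comp adjE) X Z) := by
  have : IsIso (adjE.counit.app Z) := inferInstance
  have h : squareHom (squarePaste e₀ τ) (adj'.comp adjE) X Z =
      ((asIso (τ.hom.app (E'.obj Z) ≫ U.map (adjE.counit.app Z))).homToEquiv :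
        (V.obj X ⟶ U₀.obj (E'.obj Z)) ≃ (V.obj X ⟶ U.obj Z)) ∘
        squareHom e₀ adj' X (E'.obj Z) :=
    funext (squareHom_squarePaste e₀ adj' τ adjE X Z)
  rw [h]
  exact (Equiv.bijective _).comp (hb X _)

end SquareComp

section MonHom

open scoped MonObj

variable {C D : Type*} [Category* C] [Category* D] [MonoidalCategory C] [MonoidalCategory D]
  (F : C ⥤ D) [F.Monoidal] [F.Faithful]

open scoped Obj in
lemma isMonHom_of_map {G H : C} [MonObj G] [MonObj H] (f : G ⟶ H) [h : IsMonHom (F.map f)] :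
    IsMonHom f where
  one_hom := by
    apply F.map_injective
    have h1 : (Functor.LaxMonoidal.ε F ≫ F.map η[G]) ≫ F.map f =
      Functor.LaxMonoidal.ε F ≫ F.map η[H] := h.one_hom
    rw [Category.assoc, cancel_epi] at h1
    rw [F.map_comp, h1]
  mul_hom := by
    apply F.map_injective
    have h1 : (Functor.LaxMonoidal.μ F G G ≫ F.map μ[G]) ≫ F.map f =
      (F.map f ⊗ₘ F.map f) ≫ Functor.LaxMonoidal.μ F H H ≫ F.map μ[H] := h.mul_hom
    rw [Category.assoc, Functor.LaxMonoidal.μ_natural_assoc, cancel_epi] at h1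
    rw [F.map_comp, h1, F.map_comp]

end MonHom

/-! ### Augmented Λ-rings: full faithfulness and essential image -/

namespace Plethory

attribute [local instance] Over.cartesianMonoidalCategory Over.braidedCategory

variable {A : Type u} [Category.{v} A] [MonoidalCategory A] [SymmetricCategory A] (Λ : Plethory A)
  [HasFiniteLimits A] [Preadditive A] [MonoidalPreadditive A] [HasBinaryBiproducts A]
  [HasCokernels A] [∀ M : A, (tensorLeft M).IsLeftAdjoint]

/-- Two maps out of the initial ring agree. This is the special feature of the unit as a base: every
map over it preserves zero. -/
lemma pointed_trivial {G H : AbOver (CommMon.trivial A)} (x : G.toOver ⟶ H.toOver) :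
    G.zero ≫ x.left = H.zero := trivialIsInitial.hom_ext _ _

instance faithful_abOverForget : (AbOver.forget Λ.unit).Faithful where
  map_injective h := CommGrp.hom_ext _ _ h

instance faithful_overPost : (Over.post (X := Λ.unit) Λ.toCommMon).Faithful where
  map_injective h := Over.OverMorphism.ext
    (Λ.toCommMon.map_injective (congrArg CommaMorphism.left h))

/-- On underlying rings the map preserves zero automatically and hence is additive; the faithful
forgetful functor from `Λ`-rings reflects additivity. -/
instance full_abOverForget : (AbOver.forget Λ.unit).Full where
  map_surjective {G H} x := by
    let : (Over.post Λ.toCommMon (X := Λ.unit)).Braided := .ofChosenFiniteProducts _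
    let G' : AbOver (CommMon.trivial A) := (AbOver.post Λ.toCommMon Λ.unit).obj G
    let H' : AbOver (CommMon.trivial A) := (AbOver.post Λ.toCommMon Λ.unit).obj H
    let x' : G'.toOver ⟶ H'.toOver := (Over.post Λ.toCommMon).map x
    have h : IsMonHom x' := isMonHom_of_pointed x' (pointed_trivial x')
    have : IsMonHom (M := G.X) (N := H.X) x :=
      isMonHom_of_map (Over.post Λ.toCommMon (X := Λ.unit)) (h := h) (G := G.X) (H := H.X) x
    exact ⟨commGrpHomMk (G := G) (H := H) x, rfl⟩

variable (A) in
/-- The module of an augmented abelian group object, as an object of the base. -/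
def trivialModule : AbOver (CommMon.trivial A) ⥤ A :=
  idealModule (CommMon.trivial A) ⋙ (tensorMonad (CommMon.trivial A)).forget

instance isEquivalence_trivialModule : (trivialModule A).IsEquivalence :=
  inferInstanceAs (idealModule (CommMon.trivial A) ⋙
    (tensorMonad (CommMon.trivial A)).forget).IsEquivalence

instance full_forgetTrivial : (AbOver.forget (CommMon.trivial A)).Full where
  map_surjective {G H} x := ⟨abHomOfPointed (G := G) (H := H) x (pointed_trivial x), rfl⟩

instance faithful_forgetTrivial : (AbOver.forget (CommMon.trivial A)).Faithful where
  map_injective h := CommGrp.hom_ext _ _ h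

variable (A) in
/-- The functor of square-zero extensions is the forgetful functor of abelian group objects, up to
equivalence. -/
def sqZeroIso : (trivialModule A).inv ⋙ AbOver.forget (CommMon.trivial A) ≅ sqZero (A := A) :=
  Functor.isoWhiskerLeft (trivialModule A).inv (abForgetIso A) ≪≫
    (Functor.associator (trivialModule A).inv (trivialModule A) sqZero).symm ≪≫
    Functor.isoWhiskerRight (trivialModule A).asEquivalence.counitIso sqZero ≪≫
    Functor.leftUnitor _

instance full_sqZero : (sqZero (A := A)).Full := Functor.Full.of_iso (sqZeroIso A)

instance faithful_sqZero : (sqZero (A := A)).Faithful := Functor.Faithful.of_iso (sqZeroIso A)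

instance isRightAdjoint_sqZero : (sqZero (A := A)).IsRightAdjoint :=
  ((Adjunction.ofIsRightAdjoint ((trivialModule A).inv ⋙
    AbOver.forget (CommMon.trivial A))).ofNatIsoRight (sqZeroIso A)).isRightAdjoint

/-- The module of an abelian group object over the ring underlying the unit. -/
def unitModule : AbOver (Λ.toCommMon.obj Λ.unit) ⥤ A := trivialModule A

instance isEquivalence_unitModule : Λ.unitModule.IsEquivalence :=
  isEquivalence_trivialModule

/-- The underlying augmented ring of an abelian group object in augmented `Λ`-rings is a
square-zero extension. -/
def abUnitSquare : AbOver.forget Λ.unit ⋙ Over.post Λ.toCommMon ≅ Λ.abForget Λ.unit ⋙ sqZero :=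
  squarePaste (E := Λ.unitModule) (AbOver.postForgetIso Λ.toCommMon Λ.unit) (abForgetIso A)

theorem isDistributiveSquare_abUnitSquare : IsDistributiveSquare Λ.abUnitSquare := by
  have hb := squareHom_squarePaste_bijective (E := Λ.unitModule)
    (AbOver.postForgetIso Λ.toCommMon Λ.unit)
    (abPostAdj (Adjunction.ofIsLeftAdjoint Λ.toCommMon) Λ.unit) (abForgetIso A)
    Λ.unitModule.asEquivalence.toAdjunction
    (squareHom_postForgetIso_bijective (Adjunction.ofIsLeftAdjoint Λ.toCommMon) Λ.unit)
  have h := isDistributiveSquare_of_bijective _ _ hb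
    (Adjunction.ofIsRightAdjoint (AbOver.forget Λ.unit)) (Adjunction.ofIsRightAdjoint sqZero)
  exact ⟨_, _, _, _, h⟩

/-- For the converse, compare units. If the underlying augmented ring is a square-zero extension,
its unit for the reflective functor `sqZero` is invertible. By distributivity this unit agrees, up
to isomorphisms, with the underlying map of the unit at `X`, which is therefore invertible because
passing to underlying rings is conservative. -/
theorem essImage_abOverForget_iff (X : Over Λ.unit) : (AbOver.forget Λ.unit).essImage X ↔
    (sqZero (A := A)).essImage ((Over.post Λ.toCommMon).obj X) := by
  constructor
  · rintro ⟨G, ⟨i⟩⟩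
    exact ⟨(Λ.abForget Λ.unit).obj G,
      ⟨(Λ.abUnitSquare.app G).symm ≪≫ (Over.post Λ.toCommMon).mapIso i⟩⟩
  · intro h
    obtain ⟨T', T, adj', adj, hm⟩ := Λ.isDistributiveSquare_abUnitSquare
    let : Reflective (sqZero (A := A)) := { L := T, adj := adj }
    have h1 : IsIso (adj.unit.app ((Over.post Λ.toCommMon).obj X)) := h.unit_isIso
    have h0 := @NatIso.isIso_app_of_isIso _ _ _ _ _ _ _ hm X
    have key : (Over.post Λ.toCommMon).map (adj'.unit.app X) ≫
        squareApp Λ.abUnitSquare (T'.obj X) =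
      adj.unit.app ((Over.post Λ.toCommMon).obj X) ≫ sqZero.map
        (((mateEquiv adj' adj).symm (TwoSquare.mk _ _ _ _ Λ.abUnitSquare.hom)).natTrans.app X) :=
      unit_mateEquiv_symm adj' adj (TwoSquare.mk _ _ _ _ Λ.abUnitSquare.hom) X
    have h2 : IsIso (squareApp Λ.abUnitSquare (T'.obj X)) :=
      inferInstanceAs (IsIso (Λ.abUnitSquare.hom.app (T'.obj X)))
    have h3 : IsIso ((Over.post Λ.toCommMon).map (adj'.unit.app X)) := by
      have : IsIso ((Over.post Λ.toCommMon).map (adj'.unit.app X) ≫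
          squareApp Λ.abUnitSquare (T'.obj X)) := by
        rw [key]
        exact IsIso.comp_isIso' h1 (Functor.map_isIso _ _)
      exact IsIso.of_isIso_comp_right _ (squareApp Λ.abUnitSquare (T'.obj X))
    have h4 : IsIso (adj'.unit.app X) := isIso_of_reflects_iso _ (Over.post Λ.toCommMon)
    exact adj'.mem_essImage_of_unit_isIso X

end Plethory

end Plethysm

end

noncomputable section

namespace Plethysm

/-! ### Universal maps to abelian group objects, and indecomposables -/

section FreeAb

open scoped MonObj

attribute [local instance] Over.cartesianMonoidalCategory Over.braidedCategory

section
variable {D : Type*} [Category* D] [HasPullbacks D]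

/-- A map to an abelian group object over `B` is universal among the maps that restrict to zero
along `s`. -/
structure IsFreeAb {B W : D} (q : W ⟶ B) {Y : Over B} (s : W ⟶ Y.left) {L : AbOver B}
    (y : Y ⟶ L.toOver) : Prop where
  pointed : s ≫ y.left = q ≫ L.zero
  existsUnique (H : AbOver B) (x : Y ⟶ H.toOver) : s ≫ x.left = q ≫ H.zero →
    ∃! k : L ⟶ H, y ≫ AbOver.homOver k = x

end

section
variable {C : Type u} {D : Type w} [Category.{v} C] [Category.{v} D]
  [HasFiniteLimits C] [HasFiniteLimits D] (F : C ⥤ D) [PreservesFiniteLimits F]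

/-- The unit comparison of the monoidal functor `Over.post F` is a map over `F X` between identity
objects, so it is the identity and does not alter the zero section. -/
lemma zero_post {X : C} (G : AbOver X) : ((AbOver.post F X).obj G).zero = F.map G.zero := by
  let : (Over.post F (X := X)).Braided := .ofChosenFiniteProducts _
  obtain ⟨e, he⟩ : ∃ e : F.obj X ⟶ F.obj X,
    e = (Functor.LaxMonoidal.ε (Over.post F (X := X))).left := ⟨_, rfl⟩
  have h1 : e ≫ F.map (𝟙 X) = 𝟙 (F.obj X) :=
    he ▸ Over.w (Functor.LaxMonoidal.ε (Over.post F (X := X)))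
  have h3 : ((AbOver.post F X).obj G).zero = e ≫ F.map G.zero := he ▸ rfl
  rw [F.map_id, Category.comp_id] at h1
  rw [h3, h1, Category.id_comp]

variable {F} {G : D ⥤ C} (a : F ⊣ G)

include a in
/-- Free abelian group objects are preserved by left exact left adjoints. -/
lemma IsFreeAb.post {B W : C} {q : W ⟶ B} {Y : Over B} {s : W ⟶ Y.left} {L : AbOver B}
    {y : Y ⟶ L.toOver} (h : IsFreeAb q s y) (hs : s ≫ Y.hom = q) :
    IsFreeAb (Y := (Over.post F).obj Y) (L := (AbOver.post F B).obj L) (F.map q) (F.map s)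
      ((Over.post F).map y) where
  pointed := by
    have h1 : F.map s ≫ F.map y.left = F.map q ≫ F.map L.zero := by
      rw [← F.map_comp, ← F.map_comp, h.pointed]
    rw [zero_post]
    exact h1
  existsUnique N x hx := by
    -- The test object `N` is moved to the source category by the right adjoint. The bijections `T`
    -- for slices and `S` for abelian group objects are compatible, since their counits are.
    let R' := (abPostRight a B).obj N
    let ε : (AbOver.post F B).obj R' ⟶ N := (abPostAdj a B).counit.app N
    let T (Z : Over B) : (Z ⟶ R'.toOver) ≃ ((Over.post F).obj Z ⟶ N.toOver) :=
      ((overPostAdj a B).homEquiv Z N.toOver).symm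
    have hT {Z : Over B} (z : Z ⟶ R'.toOver) :
        T Z z = (Over.post F).map z ≫ AbOver.homOver ε := by
      rw [abPostAdj_counit]
      exact (overPostAdj a B).homEquiv_counit Z N.toOver z
    have hT' {Z Z' : Over B} (f : Z ⟶ Z') (z : Z' ⟶ R'.toOver) :
        T Z (f ≫ z) = (Over.post F).map f ≫ T Z' z := by
      rw [hT, hT, (Over.post F).map_comp]
      exact Category.assoc _ _ _
    obtain ⟨x', rfl⟩ := (T Y).surjective x
    -- The vanishing condition is transported as well: `s` is viewed as a map over `B`, and its
    -- composite with `x'` is compared with the zero map after transposing.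
    have hx' : s ≫ x'.left = q ≫ R'.zero := by
      let sO : Over.mk q ⟶ Y := Over.homMk s hs
      let z : Over.mk q ⟶ R'.toOver := Over.homMk (q ≫ R'.zero) (by
        rw [Category.assoc, R'.zero_hom]; exact Category.comp_id q)
      have h1 : sO ≫ x' = z := by
        apply (T _).injective
        rw [hT', hT z]
        apply Over.OverMorphism.ext
        refine Eq.trans hx ?_
        have h2 : F.map (q ≫ R'.zero) = F.map q ≫ ((AbOver.post F B).obj R').zero := by
          rw [F.map_comp, zero_post]
          rfl
        change _ = F.map (q ≫ R'.zero) ≫ (AbOver.homOver ε).left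
        rw [h2]
        exact ((Category.assoc _ _ _).trans (congrArg (F.map q ≫ ·) (AbOver.zero_map ε))).symm
      exact congrArg CommaMorphism.left h1
    let S : (L ⟶ R') ≃ ((AbOver.post F B).obj L ⟶ N) := ((abPostAdj a B).homEquiv L N).symm
    have hS (k : L ⟶ R') : S k = (AbOver.post F B).map k ≫ ε := (abPostAdj a B).homEquiv_counit L N k
    have key (k : L ⟶ R') : (Over.post F).map y ≫ AbOver.homOver (S k) =
        T Y (y ≫ AbOver.homOver k) := by
      rw [hT', hT, hS]
      rfl
    obtain ⟨k, hk, hu⟩ := h.existsUnique R' x' hx'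
    refine ⟨S k, (key k).trans (congrArg (T Y) hk), ?_⟩
    intro k' hk'
    obtain ⟨k'', rfl⟩ := S.surjective k'
    rw [hu k'' ((T Y).injective ((key k'').symm.trans hk'))]

end

variable {A : Type u} [Category.{v} A] [MonoidalCategory A] [SymmetricCategory A]
  [Preadditive A] [MonoidalPreadditive A] [HasFiniteLimits A] [HasBinaryBiproducts A]

section
variable {R W : CommMon A} {q : W ⟶ R} {X : Over R} {s : W ⟶ X.left} (hs : s ≫ X.hom = q)

include hs in
lemma restrict_iff {G : AbOver R} (x : X ⟶ G.toOver) :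
    s ≫ x.left = q ≫ G.zero ↔ und s ≫ (derEquiv G X x).1 = 0 := by
  constructor
  · intro h
    rw [derEquiv_coe, ← Category.assoc, ← und_comp, h, und_comp, Category.assoc, zero_retr,
      comp_zero]
  · intro h
    apply und_injective
    apply pointed_hom_ext G.zero G.zero_hom
    · rw [und_comp, Category.assoc, und_w, ← und_comp, hs, und_comp, Category.assoc, zero_und,
        Category.comp_id]
    · have h1 : und G.zero ≫ retr G.zero G.zero_hom = 0 := zero_retr G
      rw [derEquiv_coe] at h
      rw [und_comp, und_comp, Category.assoc, Category.assoc, h1, comp_zero]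
      exact h

include hs in
/-- A free abelian group object carries a universal derivation. -/
lemma IsFreeAb.existsUnique_der {L : AbOver R} {y : X ⟶ L.toOver} (h : IsFreeAb q s y)
    {N : (tensorMonad R).Algebra} (d : der X N) (hd : und s ≫ d.1 = 0) :
    ∃! k : (idealModule R).obj L ⟶ N, (derEquiv L X y).1 ≫ k.f = d.1 := by
  -- Every module is, up to isomorphism, the ideal of an abelian group object, so a derivation into
  -- `N` is a ring map to which universality applies.
  let H := (idealModule R).objPreimage N
  let i : (idealModule R).obj H ≅ N := (idealModule R).objObjPreimageIso N
  let x := (derEquiv H X).symm (derPostcomp i.inv d)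
  have hx0 : derEquiv H X x = derPostcomp i.inv d := Equiv.apply_symm_apply _ _
  have hx : (derEquiv H X x).1 = d.1 ≫ i.inv.f := congrArg Subtype.val hx0
  have hp : s ≫ x.left = q ≫ H.zero := by
    rw [restrict_iff hs, hx, ← Category.assoc, hd, zero_comp]
  have hf : i.inv.f ≫ i.hom.f = 𝟙 _ := congrArg Monad.Algebra.Hom.f i.inv_hom_id
  have hf' : i.hom.f ≫ i.inv.f = 𝟙 _ := congrArg Monad.Algebra.Hom.f i.hom_inv_id
  obtain ⟨k, hk, hu⟩ := h.existsUnique H x hp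
  have hk1 : (derEquiv L X y).1 ≫ ((idealModule R).map k).f = d.1 ≫ i.inv.f := by
    rw [← hx, ← hk, derEquiv_comp]
    rfl
  refine ⟨(idealModule R).map k ≫ i.hom, ?_, ?_⟩
  · change (derEquiv L X y).1 ≫ ((idealModule R).map k).f ≫ i.hom.f = _
    rw [← Category.assoc, hk1, Category.assoc, hf, Category.comp_id]
  · intro k' hk'
    obtain ⟨l, hl⟩ := (idealModule R).map_surjective (k' ≫ i.inv)
    have : l = k := by
      apply hu
      apply (derEquiv H X).injective
      apply Subtype.ext
      rw [derEquiv_comp, hx, hl]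
      change (derEquiv L X y).1 ≫ k'.f ≫ i.inv.f = _
      rw [← Category.assoc, hk']
    rw [← this, hl, Category.assoc, i.inv_hom_id, Category.comp_id]

end

section
variable [HasCokernels A] [∀ M : A, (tensorLeft M).IsLeftAdjoint]
  {R : CommMon A} {X : Over R} {s : R ⟶ X.left} (hs : s ≫ X.hom = 𝟙 R)
  {L : AbOver R} {y : X ⟶ L.toOver} (h : IsFreeAb (𝟙 R) s y)

/-- The comparison of the indecomposables with the free abelian group object. -/
def cotangentComparison : cotangentModule s ⟶ (idealModule R).obj L :=
  cotangentEquiv s hs _ ⟨derEquiv L X y, (restrict_iff hs y).1 h.pointed⟩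

lemma cotangentComparison_spec :
    pointedRetr s hs ≫ (cotangentπ s).f ≫ (cotangentComparison hs h).f = (derEquiv L X y).1 := by
  rw [← cotangentEquiv_symm, cotangentComparison, Equiv.symm_apply_apply]

/-- Both modules corepresent the derivations vanishing on the section, compatibly with the
comparison. -/
instance isIso_cotangentComparison : IsIso (cotangentComparison hs h) := by
  rw [isIso_iff_coyoneda_map_bijective]
  intro N
  have key (k : (idealModule R).obj L ⟶ N) : ((cotangentEquiv s hs N).symm
      (cotangentComparison hs h ≫ k)).1.1 = (derEquiv L X y).1 ≫ k.f := by
    rw [cotangentEquiv_symm, ← cotangentComparison_spec hs h]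
    simp only [Category.assoc]
    rfl
  constructor
  · intro k k' hk
    have hk0 : cotangentComparison hs h ≫ k = cotangentComparison hs h ≫ k' := hk
    have h1 := key k
    rw [hk0, key k'] at h1
    exact (h.existsUnique_der hs ((cotangentEquiv s hs N).symm
      (cotangentComparison hs h ≫ k)).1 ((cotangentEquiv s hs N).symm
      (cotangentComparison hs h ≫ k)).2).unique (key k).symm (by rw [hk0, key k'])
  · intro l
    obtain ⟨k, hk, -⟩ := h.existsUnique_der hs ((cotangentEquiv s hs N).symm l).1
      ((cotangentEquiv s hs N).symm l).2
    refine ⟨k, ?_⟩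
    change cotangentComparison hs h ≫ k = l
    apply (cotangentEquiv s hs N).symm.injective
    apply Subtype.ext
    apply Subtype.ext
    rw [key k]
    exact hk

/-- The indecomposables of a ring with a section are the ideal of the free abelian group object. -/
def cotangentIso : (indecomposables R).obj X ≅ ideal L.toOver :=
  (tensorMonad R).forget.mapIso (asIso (cotangentComparison hs h))

/-- This determines the isomorphism on the ideal, from which naturality in the ring will follow. -/
lemma π_cotangentIso : cokernel.π (idealMul X) ≫ (cotangentIso hs h).hom = idealOverMap y := by
  have h1 := congrArg (pointedι s ≫ ·) (cotangentComparison_spec hs h)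
  have h2 : pointedι s ≫ pointedRetr s hs = 𝟙 _ := ι_retr s hs
  have h3 : pointedι s ≫ und y.left = idealOverMap y ≫ abι L := (idealOverMap_ι y).symm
  refine Eq.trans ?_ ((h1.trans ?_).trans (Category.comp_id (idealOverMap y)))
  · rw [← Category.assoc, h2, Category.id_comp]
    rfl
  · rw [derEquiv_coe, ← Category.assoc, h3]
    exact (Category.assoc _ _ _).trans (congrArg (idealOverMap y ≫ ·) (abι_retr L))

end

end FreeAb

end Plethysm

end

noncomputable section

namespace Plethysm

/-! ### The monad of abelian group objects is the cotangent functor -/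

namespace Plethory

attribute [local instance] Over.cartesianMonoidalCategory Over.braidedCategory

variable {A : Type u} [Category.{v} A] [MonoidalCategory A] [SymmetricCategory A] (Λ : Plethory A)
  [HasFiniteLimits A] [Preadditive A] [MonoidalPreadditive A] [HasBinaryBiproducts A]
  [HasCokernels A] [∀ M : A, (tensorLeft M).IsLeftAdjoint]

lemma fromUnit_uniq {B : Λ.Ring} (f g : Λ.unit ⟶ B) : f = g :=
  Λ.toCommMon.map_injective (trivialIsInitial.hom_ext (Λ.toCommMon.map f) (Λ.toCommMon.map g))

variable {Λ}

/-- The map of augmentation ideals underlying a map of `Λ`-rings over `B`. -/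
def ringIdealMap {B : Λ.Ring} {X Y : Over B} (x : X ⟶ Y) :
    ideal ((Over.post Λ.toCommMon).obj X) ⟶ ideal ((Over.post Λ.toCommMon).obj Y) :=
  idealOverMap ((Over.post Λ.toCommMon).map x)

lemma ringIdealMap_comp {B : Λ.Ring} {X Y Z : Over B} (x : X ⟶ Y) (y : Y ⟶ Z) :
    ringIdealMap (x ≫ y) = ringIdealMap x ≫ ringIdealMap y :=
  (Over.post Λ.toCommMon ⋙ augIdeal (Λ.toCommMon.obj B)).map_comp x y

variable {B W : Λ.Ring} {L : A ⥤ Λ.Ab B} (adj : L ⊣ Λ.abForget B)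

/-- The unit of a left adjoint of `abForget`, as a map to an augmentation ideal. -/
def abUnit (M : A) : M ⟶ ideal ((Over.post Λ.toCommMon).obj (L.obj M).toOver) := adj.unit.app M

/-- The homomorphism given by a map to an augmentation ideal. -/
def abEquiv (M : A) (H : Λ.Ab B) :
    (L.obj M ⟶ H) ≃ (M ⟶ ideal ((Over.post Λ.toCommMon).obj H.toOver)) := adj.homEquiv M H

lemma abEquiv_apply {M : A} {H : Λ.Ab B} (k : L.obj M ⟶ H) :
    abEquiv adj M H k = abUnit adj M ≫ ringIdealMap (AbOver.homOver k) :=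
  adj.homEquiv_unit M H k

lemma abUnit_naturality {M N : A} (f : M ⟶ N) :
    f ≫ abUnit adj N = abUnit adj M ≫ ringIdealMap (AbOver.homOver (L.map f)) :=
  adj.unit.naturality f

/-- A map corepresenting augmentation ideals factors through a free abelian group object. -/
lemma isFreeAb_of_existsUnique {q : W ⟶ B} {Y : Over B} {s : W ⟶ Y.left} {M : A}
    (m : M ⟶ ideal ((Over.post Λ.toCommMon).obj Y))
    (hm : ∀ (H : Λ.Ab B) (x x' : Y ⟶ H.toOver), s ≫ x.left = q ≫ H.zero →
      s ≫ x'.left = q ≫ H.zero → m ≫ ringIdealMap x = m ≫ ringIdealMap x' → x = x')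
    (y : Y ⟶ (L.obj M).toOver) (hy : s ≫ y.left = q ≫ (L.obj M).zero)
    (h : m ≫ ringIdealMap y = abUnit adj M) : IsFreeAb q s y where
  pointed := hy
  existsUnique H x hx := by
    have key (k : L.obj M ⟶ H) : m ≫ ringIdealMap (y ≫ AbOver.homOver k) =
        abEquiv adj M H k := by
      rw [ringIdealMap_comp, ← Category.assoc, h, abEquiv_apply]
    refine ⟨(abEquiv adj M H).symm (m ≫ ringIdealMap x), ?_, ?_⟩
    · apply hm _ _ _ ?_ hx
      · rw [key, Equiv.apply_symm_apply]
      · rw [Over.comp_left, ← Category.assoc, hy, Category.assoc, AbOver.zero_map]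
    · intro k hk
      have : y ≫ AbOver.homOver k = x := hk
      rw [Equiv.eq_symm_apply, ← key, this]

section Free

variable {Fr : A ⥤ Λ.Ring} (adjFr : Fr ⊣ Λ.forget)

/-- The map from the free `Λ`-ring to the free abelian group object. -/
def freeToAb (M : A) : (freeAug adjFr B).obj M ⟶ (L.obj M).toOver :=
  (freeAugEquiv Λ.toCommMon adjFr B M (L.obj M).toOver).symm (abUnit adj M)

lemma freeAugEquiv_freeToAb (M : A) :
    freeAugEquiv Λ.toCommMon adjFr B M (L.obj M).toOver (freeToAb adj adjFr M) = abUnit adj M :=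
  Equiv.apply_symm_apply _ _

lemma freeToAb_naturality {M N : A} (f : M ⟶ N) :
    (freeAug adjFr B).map f ≫ freeToAb adj adjFr N =
      freeToAb adj adjFr M ≫ AbOver.homOver (L.map f) := by
  apply (freeAugEquiv Λ.toCommMon adjFr B M (L.obj N).toOver).injective
  rw [freeAugEquiv_map_comp, freeAugEquiv_freeToAb, freeAugEquiv_comp, freeAugEquiv_freeToAb,
    abUnit_naturality]
  rfl

/-- The condition along the unit is vacuous, because the unit is initial. What remains is the
adjunction: maps over `B` from the free `Λ`-ring to `H` are maps from `M` to the ideal of `H`. -/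
lemma isFreeAb_freeToAb (M : A) : IsFreeAb (Λ.fromUnit B)
    (Λ.fromUnit ((freeAug adjFr B).obj M).left) (freeToAb adj adjFr M) := by
  let m := freeAugEquiv Λ.toCommMon adjFr B M _ (𝟙 ((freeAug adjFr B).obj M))
  have key (H : Λ.Ab B) (x : (freeAug adjFr B).obj M ⟶ H.toOver) :
      m ≫ ringIdealMap x = freeAugEquiv Λ.toCommMon adjFr B M H.toOver x :=
    (freeAugEquiv_comp Λ.toCommMon adjFr B (𝟙 _) x).symm.trans (by rw [Category.id_comp])
  refine isFreeAb_of_existsUnique adj m ?_ _ (fromUnit_uniq _ _ _) ?_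
  · intro H x x' _ _ h
    rw [key, key] at h
    exact (freeAugEquiv Λ.toCommMon adjFr B M H.toOver).injective h
  · rw [key, freeAugEquiv_freeToAb]

end Free

section FreeUnder

variable {Fr : A ⥤ Under B} (adjFr : Fr ⊣ Λ.underForget B)

/-- The free `Λ`-ring under `B`, over `B`. -/
def freeUnder (M : A) : Over B :=
  (Over.post (X := Under.mk (𝟙 B)) (Under.forget B)).obj ((freeAug adjFr (Under.mk (𝟙 B))).obj M)

/-- The functoriality of the free `Λ`-ring under `B`. -/
def freeUnderMap {M N : A} (f : M ⟶ N) : freeUnder adjFr M ⟶ freeUnder adjFr N :=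
  (Over.post (X := Under.mk (𝟙 B)) (Under.forget B)).map ((freeAug adjFr (Under.mk (𝟙 B))).map f)

/-- The section of the augmentation of the free `Λ`-ring under `B`. -/
def freeUnderSection (M : A) : B ⟶ (freeUnder adjFr M).left :=
  ((freeAug adjFr (Under.mk (𝟙 B))).obj M).left.hom

lemma freeUnderSection_hom (M : A) :
    freeUnderSection adjFr M ≫ (freeUnder adjFr M).hom = 𝟙 B :=
  Under.w ((freeAug adjFr (Under.mk (𝟙 B))).obj M).hom

lemma freeUnderSection_map {M N : A} (f : M ⟶ N) :
    freeUnderSection adjFr M ≫ (freeUnderMap adjFr f).left = freeUnderSection adjFr N :=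
  Under.w ((freeAug adjFr (Under.mk (𝟙 B))).map f).left

/-- An abelian group object over `B`, as an object under and over `B`. -/
def underZero (H : Λ.Ab B) : Over (Under.mk (𝟙 B)) :=
  Over.mk (Y := Under.mk H.zero) (Under.homMk H.toOver.hom H.zero_hom)

/-- Maps from the free `Λ`-ring under `B` to an abelian group object. -/
def freeUnderEquiv (M : A) (H : Λ.Ab B) :
    ((freeAug adjFr (Under.mk (𝟙 B))).obj M ⟶ underZero H) ≃
      (M ⟶ ideal ((Over.post Λ.toCommMon).obj H.toOver)) :=
  freeAugEquiv (Under.forget B ⋙ Λ.toCommMon) adjFr (Under.mk (𝟙 B)) M (underZero H)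

/-- The map of `Λ`-rings over `B` underlying a map to an abelian group object. -/
def ofUnderZero {M : A} {H : Λ.Ab B}
    (x : (freeAug adjFr (Under.mk (𝟙 B))).obj M ⟶ underZero H) : freeUnder adjFr M ⟶ H.toOver :=
  (Over.post (X := Under.mk (𝟙 B)) (Under.forget B)).map x

lemma section_ofUnderZero {M : A} {H : Λ.Ab B}
    (x : (freeAug adjFr (Under.mk (𝟙 B))).obj M ⟶ underZero H) :
    freeUnderSection adjFr M ≫ (ofUnderZero adjFr x).left = H.zero :=
  Under.w x.left

/-- A map preserving the sections is a map under `B`. -/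
def toUnderZero {M : A} {H : Λ.Ab B} (x : freeUnder adjFr M ⟶ H.toOver)
    (hx : freeUnderSection adjFr M ≫ x.left = H.zero) :
    (freeAug adjFr (Under.mk (𝟙 B))).obj M ⟶ underZero H :=
  Over.homMk (Under.homMk x.left hx) (Under.UnderMorphism.ext (Over.w x))

lemma ofUnderZero_toUnderZero {M : A} {H : Λ.Ab B} (x : freeUnder adjFr M ⟶ H.toOver)
    (hx : freeUnderSection adjFr M ≫ x.left = H.zero) :
    ofUnderZero adjFr (toUnderZero adjFr x hx) = x := rfl

/-- The generators of the free `Λ`-ring under `B`. -/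
def freeUnderUnit (M : A) : M ⟶ ideal ((Over.post Λ.toCommMon).obj (freeUnder adjFr M)) :=
  freeAugEquiv (Under.forget B ⋙ Λ.toCommMon) adjFr (Under.mk (𝟙 B)) M _ (𝟙 _)

lemma freeUnderUnit_comp {M : A} {H : Λ.Ab B}
    (x : (freeAug adjFr (Under.mk (𝟙 B))).obj M ⟶ underZero H) :
    freeUnderUnit adjFr M ≫ ringIdealMap (ofUnderZero adjFr x) = freeUnderEquiv adjFr M H x :=
  (freeAugEquiv_comp (Under.forget B ⋙ Λ.toCommMon) adjFr _ (𝟙 _) x).symm.trans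
    (congrArg (freeUnderEquiv adjFr M H) (Category.id_comp x))

lemma freeUnderUnit_naturality {M N : A} (f : M ⟶ N) :
    freeUnderUnit adjFr M ≫ ringIdealMap (freeUnderMap adjFr f) = f ≫ freeUnderUnit adjFr N :=
  (freeAugEquiv_comp (Under.forget B ⋙ Λ.toCommMon) adjFr _ (𝟙 _)
      ((freeAug adjFr (Under.mk (𝟙 B))).map f)).symm.trans
    ((congrArg (freeAugEquiv (Under.forget B ⋙ Λ.toCommMon) adjFr _ M _)
      ((Category.id_comp _).trans (Category.comp_id _).symm)).trans
      (freeAugEquiv_map_comp (Under.forget B ⋙ Λ.toCommMon) adjFr _ _ f (𝟙 _)))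

lemma freeUnder_hom_ext {M : A} {H : Λ.Ab B} {x x' : freeUnder adjFr M ⟶ H.toOver}
    (hx : freeUnderSection adjFr M ≫ x.left = H.zero)
    (hx' : freeUnderSection adjFr M ≫ x'.left = H.zero)
    (h : freeUnderUnit adjFr M ≫ ringIdealMap x = freeUnderUnit adjFr M ≫ ringIdealMap x') :
    x = x' := by
  rw [← ofUnderZero_toUnderZero adjFr x hx, ← ofUnderZero_toUnderZero adjFr x' hx',
    freeUnderUnit_comp, freeUnderUnit_comp] at h
  rw [← ofUnderZero_toUnderZero adjFr x hx, (freeUnderEquiv adjFr M H).injective h]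
  rfl

/-- The map from the free `Λ`-ring under `B` to the free abelian group object. -/
def freeUnderToAb (M : A) : freeUnder adjFr M ⟶ (L.obj M).toOver :=
  ofUnderZero adjFr ((freeUnderEquiv adjFr M (L.obj M)).symm (abUnit adj M))

lemma section_freeUnderToAb (M : A) :
    freeUnderSection adjFr M ≫ (freeUnderToAb adj adjFr M).left = (L.obj M).zero :=
  section_ofUnderZero _ _

lemma freeUnderUnit_toAb (M : A) :
    freeUnderUnit adjFr M ≫ ringIdealMap (freeUnderToAb adj adjFr M) = abUnit adj M := by
  rw [freeUnderToAb, freeUnderUnit_comp, Equiv.apply_symm_apply]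

lemma freeUnderToAb_naturality {M N : A} (f : M ⟶ N) :
    freeUnderMap adjFr f ≫ freeUnderToAb adj adjFr N =
      freeUnderToAb adj adjFr M ≫ AbOver.homOver (L.map f) := by
  apply freeUnder_hom_ext
  · rw [Over.comp_left, ← Category.assoc, freeUnderSection_map, section_freeUnderToAb]
  · rw [Over.comp_left, ← Category.assoc, section_freeUnderToAb, AbOver.zero_map]
  · rw [ringIdealMap_comp, ringIdealMap_comp, ← Category.assoc, freeUnderUnit_naturality,
      Category.assoc, freeUnderUnit_toAb, ← Category.assoc, freeUnderUnit_toAb, abUnit_naturality]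

/-- Sending the section to zero means being a map under `B`, once an abelian group object is placed
under `B` by its zero section. Universality is then freeness under `B`. -/
lemma isFreeAb_freeUnderToAb (M : A) : IsFreeAb (𝟙 B)
    (freeUnderSection adjFr M) (freeUnderToAb adj adjFr M) := by
  refine isFreeAb_of_existsUnique adj (freeUnderUnit adjFr M) ?_ _ ?_ (freeUnderUnit_toAb adj adjFr M)
  · intro H x x' hx hx' h
    rw [Category.id_comp] at hx hx'
    exact freeUnder_hom_ext adjFr hx hx' h
  · rw [section_freeUnderToAb, Category.id_comp]

end FreeUnder

section Cotangent

/-- The comparison of the cotangent functor with the monad of abelian group objects, on one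
object. -/
def ringCotangentIso {Y : Over B} {s : B ⟶ Y.left} (hs : s ≫ Y.hom = 𝟙 B) {G : Λ.Ab B}
    {y : Y ⟶ G.toOver} (h : IsFreeAb (𝟙 B) s y) :
    (indecomposables (Λ.toCommMon.obj B)).obj ((Over.post Λ.toCommMon).obj Y) ≅
      ideal ((Over.post Λ.toCommMon).obj G.toOver) :=
  have h' := h.post (Adjunction.ofIsLeftAdjoint Λ.toCommMon) hs
  cotangentIso (X := (Over.post Λ.toCommMon).obj Y) (s := Λ.toCommMon.map s)
    (L := (AbOver.post Λ.toCommMon B).obj G) (y := (Over.post Λ.toCommMon).map y)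
    (by
      have : Λ.toCommMon.map s ≫ Λ.toCommMon.map Y.hom = 𝟙 _ := by
        rw [← Λ.toCommMon.map_comp, hs, Λ.toCommMon.map_id]
      exact this)
    (by rwa [Λ.toCommMon.map_id] at h')

lemma π_ringCotangentIso {Y : Over B} {s : B ⟶ Y.left} (hs : s ≫ Y.hom = 𝟙 B) {G : Λ.Ab B}
    {y : Y ⟶ G.toOver} (h : IsFreeAb (𝟙 B) s y) :
    cokernel.π (idealMul ((Over.post Λ.toCommMon).obj Y)) ≫ (ringCotangentIso hs h).hom =
      ringIdealMap y :=
  π_cotangentIso _ _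

lemma π_indecomposables {R : CommMon A} {X Y : Over R} (x : X ⟶ Y) :
    cokernel.π (idealMul X) ≫ (indecomposables R).map x =
      idealOverMap x ≫ cokernel.π (idealMul Y) :=
  cokernel.π_desc _ _ _

/-- The projection from the ideal to the indecomposables is an epimorphism, so the square is checked
on ideals. -/
lemma ringCotangentIso_naturality {Y Y' : Over B} {s : B ⟶ Y.left} (hs : s ≫ Y.hom = 𝟙 B)
    {G G' : Λ.Ab B} {y : Y ⟶ G.toOver} (h : IsFreeAb (𝟙 B) s y) {s' : B ⟶ Y'.left}
    (hs' : s' ≫ Y'.hom = 𝟙 B) {y' : Y' ⟶ G'.toOver} (h' : IsFreeAb (𝟙 B) s' y')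
    (x : Y ⟶ Y') (k : G ⟶ G') (hk : x ≫ y' = y ≫ AbOver.homOver k) :
    (indecomposables (Λ.toCommMon.obj B)).map ((Over.post Λ.toCommMon).map x) ≫
      (ringCotangentIso hs' h').hom =
      (ringCotangentIso hs h).hom ≫ ringIdealMap (AbOver.homOver k) := by
  have : Epi (cokernel.π (idealMul ((Over.post Λ.toCommMon).obj Y))) := inferInstance
  refine this.left_cancellation _ _ ?_
  refine (Category.assoc _ _ _).symm.trans
    ((congrArg (· ≫ (ringCotangentIso hs' h').hom) (π_indecomposables _)).trans ?_)
  refine (Category.assoc _ _ _).trans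
    ((congrArg (ringIdealMap x ≫ ·) (π_ringCotangentIso hs' h')).trans ?_)
  rw [← ringIdealMap_comp, hk, ringIdealMap_comp, ← π_ringCotangentIso hs h]
  exact Category.assoc _ _ _

/-- The monad of abelian group objects under `B` is the relative cotangent functor. -/
theorem nonempty_cotangentUnder {Fr : A ⥤ Under B} (adjFr : Fr ⊣ Λ.underForget B) :
    Nonempty (adj.toMonad.toFunctor ≅ Λ.cotangentUnder B adjFr) :=
  ⟨(NatIso.ofComponents (F := Λ.cotangentUnder B adjFr) (G := adj.toMonad.toFunctor)
    (fun M => ringCotangentIso (freeUnderSection_hom adjFr M)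
      (isFreeAb_freeUnderToAb adj adjFr M))
    (fun f => ringCotangentIso_naturality _ _ _ _ (freeUnderMap adjFr f) (L.map f)
      (freeUnderToAb_naturality adj adjFr f))).symm⟩

lemma isFreeAb_unit {L : A ⥤ Λ.Ab Λ.unit} (adj : L ⊣ Λ.abForget Λ.unit) {Fr : A ⥤ Λ.Ring}
    (adjFr : Fr ⊣ Λ.forget) (M : A) : IsFreeAb (𝟙 Λ.unit)
      (Λ.fromUnit ((freeAug adjFr Λ.unit).obj M).left) (freeToAb adj adjFr M) := by
  have h := isFreeAb_freeToAb adj adjFr M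
  rwa [fromUnit_uniq Λ (Λ.fromUnit Λ.unit) (𝟙 _)] at h

/-- The monad of augmented abelian group objects is the cotangent functor. -/
theorem nonempty_cotangent {L : A ⥤ Λ.Ab Λ.unit} (adj : L ⊣ Λ.abForget Λ.unit) {Fr : A ⥤ Λ.Ring}
    (adjFr : Fr ⊣ Λ.forget) : Nonempty (adj.toMonad.toFunctor ≅ Λ.cotangent adjFr) :=
  ⟨(NatIso.ofComponents (F := Λ.cotangent adjFr) (G := adj.toMonad.toFunctor)
    (fun M => ringCotangentIso (fromUnit_uniq _ _ _) (isFreeAb_unit adj adjFr M))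
    (fun f => ringCotangentIso_naturality _ _ _ _ ((freeAug adjFr Λ.unit).map f) (L.map f)
      (freeToAb_naturality adj adjFr f))).symm⟩

end Cotangent

end Plethory

end Plethysm

end

noncomputable section

namespace Plethysm

/-! ### Maps of monads induced by functors over the base -/

section MonadMaps

variable {C : Type u} [Category.{v} C] {D D' : Type*} [Category* D] [Category* D']
  {L : C ⥤ D} {U : D ⥤ C} (adj : L ⊣ U) {L' : C ⥤ D'} {U' : D' ⥤ C} (adj' : L' ⊣ U')
  {p : D' ⥤ D} (κ : p ⋙ U ≅ U')

/-- The component at an object of `D'` of the isomorphism `κ`. -/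
def kapp (G : D') : U.obj (p.obj G) ⟶ U'.obj G := κ.hom.app G

/-- The inverse of `kapp`. -/
def kinv (G : D') : U'.obj G ⟶ U.obj (p.obj G) := κ.inv.app G

lemma kapp_kinv (G : D') : kapp κ G ≫ kinv κ G = 𝟙 _ := κ.hom_inv_id_app G

lemma kinv_kapp (G : D') : kinv κ G ≫ kapp κ G = 𝟙 _ := κ.inv_hom_id_app G

lemma kapp_naturality {G H : D'} (f : G ⟶ H) :
    U.map (p.map f) ≫ kapp κ H = kapp κ G ≫ U'.map f := κ.hom.naturality f

/-- The adjunct of the unit of `adj'`. -/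
def liftUnit (M : C) : L.obj M ⟶ p.obj (L'.obj M) :=
  (adj.homEquiv M _).symm (adj'.unit.app M ≫ kinv κ (L'.obj M))

lemma unit_liftUnit (M : C) : adj.unit.app M ≫ U.map (liftUnit adj adj' κ M) =
    adj'.unit.app M ≫ kinv κ (L'.obj M) := by
  exact (adj.homEquiv_unit M _ _).symm.trans (Equiv.apply_symm_apply (adj.homEquiv M _) _)

/-- The components of `monadMap`. -/
def monadMapApp (M : C) : U.obj (L.obj M) ⟶ U'.obj (L'.obj M) :=
  U.map (liftUnit adj adj' κ M) ≫ kapp κ (L'.obj M)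

lemma monadMapApp_naturality {M N : C} (f : M ⟶ N) :
    U.map (L.map f) ≫ monadMapApp adj adj' κ N =
      monadMapApp adj adj' κ M ≫ U'.map (L'.map f) := by
  have h : L.map f ≫ liftUnit adj adj' κ N = liftUnit adj adj' κ M ≫ p.map (L'.map f) := by
    apply (adj.homEquiv _ _).injective
    rw [adj.homEquiv_unit, adj.homEquiv_unit, U.map_comp, U.map_comp, ← Category.assoc,
      ← Category.assoc, unit_liftUnit]
    have h1 : adj.unit.app M ≫ U.map (L.map f) = f ≫ adj.unit.app N := (adj.unit.naturality f).symm
    have h2 : adj'.unit.app M ≫ U'.map (L'.map f) = f ≫ adj'.unit.app N :=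
      (adj'.unit.naturality f).symm
    have h3 : kinv κ _ ≫ U.map (p.map (L'.map f)) = U'.map (L'.map f) ≫ kinv κ _ :=
      (κ.inv.naturality (L'.map f)).symm
    rw [h1, Category.assoc, Category.assoc, unit_liftUnit, h3, ← Category.assoc, ← Category.assoc,
      h2]
  rw [monadMapApp, monadMapApp, Category.assoc, ← kapp_naturality, ← Category.assoc,
    ← Category.assoc, ← U.map_comp, ← U.map_comp, h]

lemma unit_monadMapApp (M : C) :
    adj.unit.app M ≫ monadMapApp adj adj' κ M = adj'.unit.app M := by
  rw [monadMapApp, ← Category.assoc, unit_liftUnit, Category.assoc, kinv_kapp]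
  exact Category.comp_id _

/-- The monad map carries the action on `U' G` to the one on `U (p G)`. -/
lemma monadMapApp_action (G : D') :
    U.map (L.map (kapp κ G)) ≫ monadMapApp adj adj' κ (U'.obj G) ≫ U'.map (adj'.counit.app G) =
      U.map (adj.counit.app (p.obj G)) ≫ kapp κ G := by
  have h : L.map (kapp κ G) ≫ liftUnit adj adj' κ (U'.obj G) ≫ p.map (adj'.counit.app G) =
      adj.counit.app (p.obj G) := by
    apply (adj.homEquiv _ _).injective
    rw [adj.homEquiv_unit, adj.homEquiv_unit]
    simp only [Functor.map_comp, Functor.id_obj, Adjunction.right_triangle_components]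
    have h1 : adj.unit.app (U.obj (p.obj G)) ≫ U.map (L.map (kapp κ G)) =
      kapp κ G ≫ adj.unit.app _ := (adj.unit.naturality (kapp κ G)).symm
    have h3 : kinv κ _ ≫ U.map (p.map (adj'.counit.app G)) =
      U'.map (adj'.counit.app G) ≫ kinv κ _ := (κ.inv.naturality (adj'.counit.app G)).symm
    have h4 := reassoc_of% (unit_liftUnit adj adj' κ (U'.obj G))
    rw [← Category.assoc, h1, Category.assoc, h4]
    have h5 := adj'.right_triangle_components G
    refine (congrArg (fun z => kapp κ G ≫ adj'.unit.app (U'.obj G) ≫ z) h3).trans ?_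
    rw [← Category.assoc (adj'.unit.app _), h5]
    refine (congrArg (kapp κ G ≫ ·) (Category.id_comp _)).trans (kapp_kinv κ G)
  rw [← h, monadMapApp]
  simp only [Functor.map_comp, Category.assoc]
  exact congrArg (fun z => U.map (L.map (kapp κ G)) ≫ U.map (liftUnit adj adj' κ (U'.obj G)) ≫ z)
    (kapp_naturality κ (adj'.counit.app G)).symm

/-- The map of monads induced by a functor over `C`. -/
def monadMap : adj.toMonad ⟶ adj'.toMonad where
  app M := monadMapApp adj adj' κ M
  naturality _ _ f := monadMapApp_naturality adj adj' κ f
  app_η M := unit_monadMapApp adj adj' κ M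
  app_μ M := by
    change U.map (adj.counit.app (L.obj M)) ≫ monadMapApp adj adj' κ M =
      (U.map (L.map (monadMapApp adj adj' κ M)) ≫ monadMapApp adj adj' κ (U'.obj (L'.obj M))) ≫
        U'.map (adj'.counit.app (L'.obj M))
    -- The multiplication of a monad is its action on free objects, so compatibility with actions at
    -- `L'.obj M` yields multiplicativity.
    have h1 := monadMapApp_action adj adj' κ (L'.obj M)
    have h2 : U.map (adj.counit.app (L.obj M)) ≫ U.map (liftUnit adj adj' κ M) =
        U.map (L.map (U.map (liftUnit adj adj' κ M))) ≫ U.map (adj.counit.app _) := by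
      rw [← U.map_comp, ← U.map_comp]
      exact congrArg U.map (adj.counit.naturality _).symm
    rw [Category.assoc]
    have h3 : U.map (L.map (monadMapApp adj adj' κ M)) =
      U.map (L.map (U.map (liftUnit adj adj' κ M))) ≫ U.map (L.map (kapp κ (L'.obj M))) := by
      rw [← U.map_comp, ← L.map_comp]
      rfl
    rw [h3, Category.assoc, h1, ← Category.assoc, ← h2, Category.assoc]
    rfl

/-- The map of monads given by a lift of a functor to the algebras of a monad. -/
def actionMonadMap {T : Monad C} (W : D' ⥤ T.Algebra) (adj' : L' ⊣ W ⋙ T.forget) :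
    T ⟶ adj'.toMonad :=
  (Adjunction.adjToMonadIso T).inv ≫ monadMap T.adj adj' (Iso.refl (W ⋙ T.forget))

/-- The case of `monadMapApp_action` where `p` is `W` and `κ` is the identity: the counit of the
free algebra adjunction is the structure map. -/
lemma actionMonadMap_action {T : Monad C} (W : D' ⥤ T.Algebra) (adj' : L' ⊣ W ⋙ T.forget)
    (G : D') : (actionMonadMap W adj').app (W.obj G).A ≫
      (W ⋙ T.forget).map (adj'.counit.app G) = (W.obj G).a := by
  have h := monadMapApp_action T.adj adj' (Iso.refl (W ⋙ T.forget)) G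
  have h1 : T.forget.map (T.adj.counit.app (W.obj G)) = (W.obj G).a := by
    simp
    rfl
  have h2 : kapp (p := W) (Iso.refl (W ⋙ T.forget)) G = 𝟙 (W.obj G).A := rfl
  rw [h2] at h
  refine Eq.trans ?_ ((h.trans (Category.comp_id _)).trans h1)
  have h3 : (actionMonadMap W adj').app (W.obj G).A =
    monadMapApp T.adj adj' (Iso.refl (W ⋙ T.forget)) (W.obj G).A := by
    change (Adjunction.adjToMonadIso T).inv.app _ ≫ monadMapApp T.adj adj' _ _ = _
    simp
    exact Category.id_comp _
  rw [h3]
  refine ((congrArg (· ≫ _) ?_).trans (Category.id_comp _)).symm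
  exact (T.free ⋙ T.forget).map_id _

end MonadMaps

end Plethysm

end

noncomputable section

namespace Plethysm

/-! ### Restriction of scalars, and pullback to the unit -/

section Restriction

open scoped MonObj

variable {A : Type u} [Category.{v} A] [MonoidalCategory A] [SymmetricCategory A]

/-- Restriction of a module along a map of rings. -/
def restrictModule {R R' : CommMon A} (g : R' ⟶ R) (N : (tensorMonad R).Algebra) :
    (tensorMonad R').Algebra :=
  moduleMk N.A (tact N (und g) (𝟙 _))
    (by rw [whiskerRight_tact, und_one, one_tact, Category.comp_id])
    (by rw [whiskerRight_tact, und_mul_hom, tmul_tact, whiskerLeft_tact, Category.comp_id])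

lemma tact_restrictModule {R R' : CommMon A} (g : R' ⟶ R) (N : (tensorMonad R).Algebra)
    {Z W : A} (f : Z ⟶ R'.X) (n : W ⟶ N.A) :
    tact (restrictModule g N) f n = tact N (f ≫ und g) n := by
  have h : tact (restrictModule g N) f n = (f ⊗ₘ n) ≫ tact N (und g) (𝟙 _) := rfl
  rw [h, comp_tact, Category.comp_id]

variable [Preadditive A] [MonoidalPreadditive A] [HasFiniteLimits A]

/-- Derivations into a restricted module are derivations over the larger base. -/
lemma mem_der_iff_restrict {R R' S : CommMon A} (g : R' ⟶ R) (a : S ⟶ R') (c : S ⟶ R)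
    (hc : a ≫ g = c) (N : (tensorMonad R).Algebra) (d : S.X ⟶ N.A) :
    d ∈ der (Over.mk c) N ↔ d ∈ der (Over.mk a) (restrictModule g N) := by
  have h1 : tact (restrictModule g N) (und a) d = tact N (und c) d := by
    rw [tact_restrictModule, ← hc, und_comp]
  change μ[S.X] ≫ d = tact N (und c) d + (β_ _ _).hom ≫ tact N (und c) d ↔
    μ[S.X] ≫ d = tact (restrictModule g N) (und a) d +
      (β_ _ _).hom ≫ tact (restrictModule g N) (und a) d
  rw [h1]
  rfl

/-- A map between modules over the trivial ring is linear. -/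
def trivialHom {N N' : (tensorMonad (CommMon.trivial A)).Algebra} (f : N.A ⟶ N'.A) : N ⟶ N' :=
  moduleHomMk f (by
    rw [act_trivial, act_trivial]
    exact leftUnitor_naturality _)

/-- The map from the trivial ring picks out `1`, which derivations kill. -/
lemma fromTrivial_der {R : CommMon A} {X : Over R} {N : (tensorMonad R).Algebra} (d : der X N)
    (s : CommMon.trivial A ⟶ X.left) : und s ≫ d.1 = 0 := by
  have h : und s = η[X.left.X] := (Category.id_comp _).symm.trans (und_one s)
  exact (congrArg (· ≫ d.1) h).trans (one_der d)

/-- The map of augmentation ideals induced by a pullback square is an isomorphism. -/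
lemma isIso_idealMap {R R' : CommMon A} {X : Over R'} {Y : Over R} (f : X.left ⟶ Y.left)
    (g : R' ⟶ R) (h : IsPullback f X.hom Y.hom g) : IsIso (idealMap f g h.w) := by
  have sq : IsPullback (und f) (und X.hom) (und Y.hom) (und g) := by
    have := h.map (CommMon.forget A)
    exact this
  have hc : idealι Y ≫ und Y.hom = 0 ≫ und g := by rw [idealι_und, zero_comp]
  refine ⟨idealLift X (sq.lift (idealι Y) 0 hc) (sq.lift_snd _ _ _), ?_, ?_⟩
  · rw [← cancel_mono (idealι X), Category.assoc, idealLift_ι]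
    apply sq.hom_ext
    · simp
    · simp
  · rw [← cancel_mono (idealι Y), Category.assoc, idealMap_ι, ← Category.assoc, idealLift_ι]
    simp

/-- The retractions onto augmentation ideals are compatible with pullbacks. -/
lemma retr_idealMap {R R' : CommMon A} {X : Over R'} {Y : Over R} (f : X.left ⟶ Y.left)
    (g : R' ⟶ R) (h : f ≫ Y.hom = X.hom ≫ g) (s : R' ⟶ X.left) (hs : s ≫ X.hom = 𝟙 R')
    (t : R ⟶ Y.left) (ht : t ≫ Y.hom = 𝟙 R) (hst : s ≫ f = g ≫ t) :
    retr s hs ≫ idealMap f g h = und f ≫ retr t ht := by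
  rw [← cancel_mono (idealι Y), Category.assoc, Category.assoc, idealMap_ι, retr_ι,
    ← Category.assoc, retr_ι, Preadditive.sub_comp, Preadditive.comp_sub, Category.assoc,
    ← und_comp, hst, ← und_comp, ← und_comp, ← und_comp, ← Category.assoc, ← Category.assoc, h]
  simp

end Restriction

namespace Plethory

attribute [local instance] Over.cartesianMonoidalCategory Over.braidedCategory

variable {A : Type u} [Category.{v} A] [MonoidalCategory A] [SymmetricCategory A] {Λ : Plethory A}
  [HasFiniteLimits A] [Preadditive A] [MonoidalPreadditive A] [HasBinaryBiproducts A]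
  [HasCokernels A] [∀ M : A, (tensorLeft M).IsLeftAdjoint] {B : Λ.Ring}

lemma isPullback_abPullback (G : Λ.Ab B) :
    IsPullback (Λ.toCommMon.map (pullback.fst G.toOver.hom (Λ.fromUnit B)))
      (Λ.toCommMon.map (pullback.snd G.toOver.hom (Λ.fromUnit B)))
      (Λ.toCommMon.map G.toOver.hom) (Λ.toCommMon.map (Λ.fromUnit B)) :=
  (IsPullback.of_hasPullback _ _).map Λ.toCommMon

instance isIso_abPullbackComparison (G : Λ.Ab B) : IsIso (Λ.abPullbackComparison B G) :=
  isIso_idealMap (X := ((AbOver.post Λ.toCommMon Λ.unit).obj ((Λ.abPullbackToUnit B).obj G)).toOver)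
    (Y := ((AbOver.post Λ.toCommMon B).obj G).toOver) _ _ (isPullback_abPullback G)

/-- The map of objects of `A` underlying a map of `Λ`-rings. -/
def ringUnd {Y Z : Λ.Ring} (x : Y ⟶ Z) : Y.A.X ⟶ Z.A.X := und (Λ.toCommMon.map x)

lemma ringUnd_comp {Y Z W : Λ.Ring} (x : Y ⟶ Z) (y : Z ⟶ W) :
    ringUnd (x ≫ y) = ringUnd x ≫ ringUnd y := rfl

/-- The inclusion of the ideal of an abelian group object. -/
def ringι (G : Λ.Ab B) : (Λ.abForget B).obj G ⟶ G.toOver.left.A.X :=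
  idealι ((AbOver.post Λ.toCommMon B).obj G).toOver

instance (G : Λ.Ab B) : Mono (ringι G) :=
  inferInstanceAs (Mono (idealι ((AbOver.post Λ.toCommMon B).obj G).toOver))

lemma abForget_map_ringι {G H : Λ.Ab B} (f : G ⟶ H) :
    (Λ.abForget B).map f ≫ ringι H = ringι G ≫ ringUnd (AbOver.homOver f).left :=
  idealOverMap_ι _

/-- The projection of the pullback to the unit. -/
def abFst (G : Λ.Ab B) : ((Λ.abPullbackToUnit B).obj G).toOver.left ⟶ G.toOver.left :=
  pullback.fst G.toOver.hom (Λ.fromUnit B)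

lemma abFst_naturality {G H : Λ.Ab B} (f : G ⟶ H) :
    (AbOver.homOver ((Λ.abPullbackToUnit B).map f)).left ≫ abFst H =
      abFst G ≫ (AbOver.homOver f).left :=
  pullback.lift_fst _ _ _

lemma abPullbackComparison_ringι (G : Λ.Ab B) : Λ.abPullbackComparison B G ≫ ringι G =
    ringι ((Λ.abPullbackToUnit B).obj G) ≫ ringUnd (abFst G) :=
  idealMap_ι _ _ _

lemma abPullbackComparison_naturality {G H : Λ.Ab B} (f : G ⟶ H) :
    (Λ.abForget Λ.unit).map ((Λ.abPullbackToUnit B).map f) ≫ Λ.abPullbackComparison B H =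
      Λ.abPullbackComparison B G ≫ (Λ.abForget B).map f := by
  rw [← cancel_mono (ringι H)]
  have h1 : ((Λ.abForget Λ.unit).map ((Λ.abPullbackToUnit B).map f) ≫
      Λ.abPullbackComparison B H) ≫ ringι H = ringι ((Λ.abPullbackToUnit B).obj G) ≫
        ringUnd ((AbOver.homOver ((Λ.abPullbackToUnit B).map f)).left ≫ abFst H) := by
    rw [Category.assoc, abPullbackComparison_ringι, ← Category.assoc, abForget_map_ringι,
      Category.assoc, ringUnd_comp]
  have h2 : (Λ.abPullbackComparison B G ≫ (Λ.abForget B).map f) ≫ ringι H =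
      ringι ((Λ.abPullbackToUnit B).obj G) ≫ ringUnd (abFst G ≫ (AbOver.homOver f).left) := by
    rw [Category.assoc, abForget_map_ringι, ← Category.assoc, abPullbackComparison_ringι,
      Category.assoc, ringUnd_comp]
  rw [h1, h2, abFst_naturality]

/-- Pullback to the unit does not change augmentation ideals. -/
def abPullbackIso : Λ.abPullbackToUnit B ⋙ Λ.abForget Λ.unit ≅ Λ.abForget B :=
  NatIso.ofComponents (fun G => asIso (Λ.abPullbackComparison B G))
    abPullbackComparison_naturality

/-- The retraction onto the ideal of an abelian group object. -/
def ringRetr (G : Λ.Ab B) : G.toOver.left.A.X ⟶ (Λ.abForget B).obj G :=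
  abRetr ((AbOver.post Λ.toCommMon B).obj G)

lemma ringRetr_naturality {G H : Λ.Ab B} (f : G ⟶ H) :
    ringRetr G ≫ (Λ.abForget B).map f = ringUnd (AbOver.homOver f).left ≫ ringRetr H :=
  abRetr_naturality ((AbOver.post Λ.toCommMon B).map f)

lemma ringRetr_comparison (G : Λ.Ab B) :
    ringRetr ((Λ.abPullbackToUnit B).obj G) ≫ Λ.abPullbackComparison B G =
      ringUnd (abFst G) ≫ ringRetr G :=
  retr_idealMap
    (X := ((AbOver.post Λ.toCommMon Λ.unit).obj ((Λ.abPullbackToUnit B).obj G)).toOver)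
    (Y := ((AbOver.post Λ.toCommMon B).obj G).toOver) (Λ.toCommMon.map (abFst G)) _ _ _
    (AbOver.zero_hom _) _ (AbOver.zero_hom _) (trivialIsInitial.hom_ext _ _)

end Plethory

end Plethysm

end

noncomputable section

namespace Plethysm
-- The monad over B as a composite of two monads
namespace Plethory

open scoped MonObj

attribute [local instance] Over.cartesianMonoidalCategory Over.braidedCategory

variable {A : Type u} [Category.{v} A] [MonoidalCategory A] [SymmetricCategory A] {Λ : Plethory A}
  [HasFiniteLimits A] [Preadditive A] [MonoidalPreadditive A] [HasBinaryBiproducts A]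
  [HasCokernels A] [∀ M : A, (tensorLeft M).IsLeftAdjoint] {B : Λ.Ring}
  {Fr : A ⥤ Λ.Ring} (adjFr : Fr ⊣ Λ.forget)

section
variable {L : A ⥤ Λ.Ab B} (adj : L ⊣ Λ.abForget B)

/-- The map of `Λ`-rings underlying `freeToAb`. -/
def freeToAbLeft (M : A) : Fr.obj M ⟶ (L.obj M).toOver.left :=
  freeAugLeft Λ.toCommMon adjFr (freeToAb adj adjFr M)

lemma transpose_freeToAbLeft (M : A) :
    transpose Λ.toCommMon adjFr (freeToAbLeft adjFr adj M) = adj.unit.app M ≫ ringι (L.obj M) := by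
  refine (freeAugEquiv_ι Λ.toCommMon adjFr B M _ (freeToAb adj adjFr M)).symm.trans ?_
  rw [freeAugEquiv_freeToAb]
  rfl

/-- The universal derivation of a free `Λ`-ring. -/
def freeDer (M : A) : (Fr.obj M).A.X ⟶ (Λ.abForget B).obj (L.obj M) :=
  ringUnd (freeToAbLeft adjFr adj M) ≫ ringRetr (L.obj M)

variable (B) in
/-- The ring underlying a free `Λ`-ring, over the ring underlying `B`. -/
def freeOver (M : A) : Over B.A := Over.mk (Λ.toCommMon.map (freeAugHom Λ.toCommMon adjFr B M))

lemma freeDer_mem (M : A) :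
    freeDer adjFr adj M ∈ der (freeOver B adjFr M) ((Λ.abToModule B).obj (L.obj M)) := by
  have h := derEquiv_coe ((AbOver.post Λ.toCommMon B).obj (L.obj M))
    ((Over.post Λ.toCommMon).map (freeToAb adj adjFr M))
  have h2 : freeDer adjFr adj M = _ := h.symm
  rw [h2]
  exact (derEquiv ((AbOver.post Λ.toCommMon B).obj (L.obj M)) _ _).2

/-- Universality among `Λ`-rings persists for the underlying rings, by `IsFreeAb.post`, where maps
to abelian group objects are derivations into arbitrary modules. No vanishing condition is left,
since derivations kill the image of the unit ring. -/
lemma existsUnique_freeDer (M : A) (N : (tensorMonad B.A).Algebra) (d : (Fr.obj M).A.X ⟶ N.A)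
    (hd : d ∈ der (freeOver B adjFr M) N) :
    ∃! k : (Λ.abToModule B).obj (L.obj M) ⟶ N, freeDer adjFr adj M ≫ k.f = d := by
  have h := (isFreeAb_freeToAb adj adjFr M).post (Adjunction.ofIsLeftAdjoint Λ.toCommMon)
    (fromUnit_uniq _ _ _)
  have hs : Λ.toCommMon.map (Λ.fromUnit ((freeAug adjFr B).obj M).left) ≫
      ((Over.post Λ.toCommMon).obj ((freeAug adjFr B).obj M)).hom =
      Λ.toCommMon.map (Λ.fromUnit B) := trivialIsInitial.hom_ext _ _
  obtain ⟨k, hk, hu⟩ := h.existsUnique_der hs (N := N) ⟨d, hd⟩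
    (fromTrivial_der (X := freeOver B adjFr M) ⟨d, hd⟩ _)
  have h2 : freeDer adjFr adj M = _ := (derEquiv_coe ((AbOver.post Λ.toCommMon B).obj (L.obj M))
    ((Over.post Λ.toCommMon).map (freeToAb adj adjFr M))).symm
  exact ⟨k, (congrArg (· ≫ k.f) h2).trans hk,
    fun k' hk' => hu k' ((congrArg (· ≫ k'.f) h2).symm.trans hk')⟩

end

variable {L₁ : A ⥤ Λ.Ab Λ.unit} (adj : L₁ ⊣ Λ.abForget Λ.unit)
  {L : A ⥤ Λ.Ab B} (adj' : L ⊣ Λ.abForget B)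

/-- The map of monads from the augmented abelian group objects to those over `B`. -/
def pullbackMonadMap : adj.toMonad ⟶ adj'.toMonad := monadMap adj adj' abPullbackIso

/-- Both maps out of the free `Λ`-ring have the same restriction to the generators, because
`liftUnit` was defined by inverting the pullback comparison. -/
lemma freeToAbLeft_eq (M : A) : freeToAbLeft adjFr adj' M = freeToAbLeft adjFr adj M ≫
    (AbOver.homOver (liftUnit adj adj' abPullbackIso M)).left ≫ abFst (L.obj M) := by
  apply (transpose Λ.toCommMon adjFr).injective
  have h := unit_liftUnit adj adj' abPullbackIso M
  have hκ : kinv abPullbackIso (L.obj M) ≫ Λ.abPullbackComparison B (L.obj M) = 𝟙 _ :=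
    kinv_kapp abPullbackIso (L.obj M)
  refine Eq.trans ?_ (transpose_comp Λ.toCommMon adjFr (freeToAbLeft adjFr adj M)
    ((AbOver.homOver (liftUnit adj adj' abPullbackIso M)).left ≫ abFst (L.obj M))).symm
  rw [transpose_freeToAbLeft, transpose_freeToAbLeft]
  change _ = _ ≫ ringUnd ((AbOver.homOver (liftUnit adj adj' abPullbackIso M)).left ≫
    abFst (L.obj M))
  rw [ringUnd_comp, Category.assoc, ← Category.assoc (ringι _), ← abForget_map_ringι,
    Category.assoc, ← abPullbackComparison_ringι, ← Category.assoc, h, Category.assoc,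
    ← Category.assoc (kinv _ _), hκ, Category.id_comp]

/-- The components of `pullbackMonadMap`. -/
def pullbackApp (M : A) : (Λ.abForget Λ.unit).obj (L₁.obj M) ⟶ (Λ.abForget B).obj (L.obj M) :=
  (Λ.abForget Λ.unit).map (liftUnit adj adj' abPullbackIso M) ≫ Λ.abPullbackComparison B (L.obj M)

lemma freeDer_pullbackApp (M : A) :
    freeDer adjFr adj M ≫ pullbackApp adj adj' M = freeDer adjFr adj' M := by
  have h : ringRetr (L₁.obj M) ≫ (Λ.abForget Λ.unit).map (liftUnit adj adj' abPullbackIso M) =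
    ringUnd (AbOver.homOver (liftUnit adj adj' abPullbackIso M)).left ≫
      ringRetr ((Λ.abPullbackToUnit B).obj (L.obj M)) := ringRetr_naturality _
  rw [pullbackApp, freeDer, freeDer, freeToAbLeft_eq adjFr adj adj', Category.assoc,
    ← Category.assoc (ringRetr _)]
  refine (congrArg (fun z => ringUnd (freeToAbLeft adjFr adj M) ≫
    z ≫ Λ.abPullbackComparison B (L.obj M)) h).trans ?_
  rw [Category.assoc, ringRetr_comparison, ringUnd_comp, ringUnd_comp, Category.assoc,
    Category.assoc]

lemma freeAugHom_fromUnit (M : A) : freeAugHom Λ.toCommMon adjFr Λ.unit M ≫ Λ.fromUnit B =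
    freeAugHom Λ.toCommMon adjFr B M := by
  apply (transpose Λ.toCommMon adjFr).injective
  refine (transpose_comp Λ.toCommMon adjFr _ _).trans ?_
  rw [transpose_freeAugHom, transpose_freeAugHom, zero_comp]

/-- The zero augmentation of the free `Λ`-ring to `B` factors through the unit, so the Leibniz rule
sees only the restriction of the module to the unit ring. -/
lemma mem_der_freeOver_iff (M : A) (N : (tensorMonad B.A).Algebra) (d : (Fr.obj M).A.X ⟶ N.A) :
    d ∈ der (freeOver B adjFr M) N ↔ d ∈ der (freeOver Λ.unit adjFr M)
      (restrictModule (Λ.toCommMon.map (Λ.fromUnit B)) N) := by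
  refine mem_der_iff_restrict (Λ.toCommMon.map (Λ.fromUnit B))
    (Λ.toCommMon.map (freeAugHom Λ.toCommMon adjFr Λ.unit M)) _ ?_ N d
  rw [← Λ.toCommMon.map_comp, freeAugHom_fromUnit]

/-- The derivation given by a map out of a free abelian group object. -/
lemma freeDer_comp_mem {C : Λ.Ring} {L : A ⥤ Λ.Ab C} (adj : L ⊣ Λ.abForget C) (M : A)
    (N : (tensorMonad C.A).Algebra) (k : (Λ.abToModule C).obj (L.obj M) ⟶ N) :
    freeDer adjFr adj M ≫ k.f ∈ der (freeOver C adjFr M) N :=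
  (derPostcomp k ⟨_, freeDer_mem adjFr adj M⟩).2

/-- Both sides are the derivations of the free `Λ`-ring with values in `N`: the linear maps by
universality over `B`, the arbitrary maps by universality over the unit, where every map is linear.
In other words, the free abelian group object over `B` is the free `B`-module on the one over the
unit. -/
lemma pullbackApp_bijective {Fr : A ⥤ Λ.Ring} (adjFr : Fr ⊣ Λ.forget) (M : A) (N : (tensorMonad B.A).Algebra) :
    Function.Bijective (fun k : (Λ.abToModule B).obj (L.obj M) ⟶ N =>
      (pullbackApp adj adj' M ≫ k.f : (Λ.abForget Λ.unit).obj (L₁.obj M) ⟶ N.A)) := by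
  have key (k : (Λ.abToModule B).obj (L.obj M) ⟶ N) : freeDer adjFr adj M ≫
      pullbackApp adj adj' M ≫ k.f = freeDer adjFr adj' M ≫ k.f :=
    (Category.assoc _ _ _).symm.trans
      (congrArg (· ≫ k.f) (freeDer_pullbackApp adjFr adj adj' M))
  constructor
  · intro k k' h
    have h1 : freeDer adjFr adj' M ≫ k.f = freeDer adjFr adj' M ≫ k'.f :=
      (key k).symm.trans ((congrArg (freeDer adjFr adj M ≫ ·) h).trans (key k'))
    exact (existsUnique_freeDer adjFr adj' M N _ (freeDer_comp_mem adjFr adj' M N k')).unique h1 rfl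
  · intro b
    let W := (Λ.abToModule Λ.unit).obj (L₁.obj M)
    let N₁ := restrictModule (Λ.toCommMon.map (Λ.fromUnit B)) N
    let lin (c : W.A ⟶ N.A) : W ⟶ N₁ := trivialHom (N := W) (N' := N₁) c
    have hd := freeDer_comp_mem adjFr adj M N₁ (lin b)
    obtain ⟨k, hk, -⟩ := existsUnique_freeDer adjFr adj' M N _
      ((mem_der_freeOver_iff adjFr M N _).2 hd)
    refine ⟨k, ?_⟩
    have h2 : lin (pullbackApp adj adj' M ≫ k.f) = lin b :=
      (existsUnique_freeDer adjFr adj M N₁ _ hd).unique ((key k).trans hk) rfl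
    exact congrArg Monad.Algebra.Hom.f h2

/-- The action of the ring underlying `B`, as a map of monads. -/
def actionMap : tensorMonad B.A ⟶ adj'.toMonad := actionMonadMap (Λ.abToModule B) adj'

lemma prodHom_actionMap (M : A) : prodHom (actionMap adj') (pullbackMonadMap adj adj') M =
    (tensorMonad B.A).map ((pullbackMonadMap adj adj').app M) ≫
      ((Λ.abToModule B).obj (L.obj M)).a := by
  rw [← actionMonadMap_action (Λ.abToModule B) adj']
  rfl

/-- The product map is the linear extension `f` of `β` to the free module on `Δ`; by Yoneda for
modules its invertibility is `pullbackApp_bijective`. -/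
lemma isIso_prodHom (hFr : Λ.forget.IsRightAdjoint) (M : A) :
    IsIso (prodHom (actionMap adj') (pullbackMonadMap adj adj') M) := by
  let T := tensorMonad B.A
  let W := (Λ.abToModule B).obj (L.obj M)
  let Δ : A := adj.toMonad.obj M
  let β : Δ ⟶ W.A := pullbackApp adj adj' M
  let f : T.free.obj Δ ⟶ W := (T.adj.homEquiv Δ W).symm β
  have hf : f.f = prodHom (actionMap adj') (pullbackMonadMap adj adj') M := by
    rw [prodHom_actionMap]
    have : f = T.free.map β ≫ T.adj.counit.app W := T.adj.homEquiv_counit Δ W β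
    rw [this]
    simp [β, W, T]
    rfl
  have : IsIso f := by
    rw [isIso_iff_coyoneda_map_bijective]
    intro N
    have h1 : (fun k : W ⟶ N => f ≫ k) = (T.adj.homEquiv Δ N).symm ∘
        (fun k : W ⟶ N => β ≫ k.f) := by
      funext k
      exact (T.adj.homEquiv_naturality_right_symm β k).symm
    change Function.Bijective (fun k : W ⟶ N => f ≫ k)
    rw [h1]
    exact (Equiv.bijective _).comp (pullbackApp_bijective adj adj' (Adjunction.ofIsRightAdjoint Λ.forget) M N)
  rw [← hf]
  exact inferInstanceAs (IsIso (T.forget.map f))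

/-- The monad of abelian group objects over `B` is a composition of the monad `B ⊗ -` with the
monad of augmented abelian group objects, compatibly with actions. -/
theorem exists_monadComposition_abForget (hFr : Λ.forget.IsRightAdjoint) :
    ∃ (c : MonadComposition (tensorMonad B.A) adj.toMonad) (θ : adj'.toMonad ≅ c.monad),
      ∀ G : Λ.Ab B,
        (c.inl ≫ θ.inv).app ((Λ.abForget B).obj G) ≫ ((Monad.comparison adj').obj G).a =
          ((Λ.abToModule B).obj G).a ∧
        adj.toMonad.map (Λ.abPullbackComparison B G) ≫
            (c.inr ≫ θ.inv).app ((Λ.abForget B).obj G) ≫ ((Monad.comparison adj').obj G).a =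
          ((Monad.comparison adj).obj ((Λ.abPullbackToUnit B).obj G)).a ≫
            Λ.abPullbackComparison B G := by
  obtain ⟨c, θ, h1, h2⟩ := exists_monadComposition (actionMap adj') (pullbackMonadMap adj adj')
    (isIso_prodHom adj adj' hFr)
  refine ⟨c, θ, fun G => ⟨?_, ?_⟩⟩
  · rw [h1]
    exact actionMonadMap_action (Λ.abToModule B) adj' G
  · rw [h2]
    exact monadMapApp_action adj adj' abPullbackIso G

end Plethory
end Plethysm

end

noncomputable section

namespace Plethysm

/-! ### Adjoint functor theorems and free commutative monoids -/

section InitialObjects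

variable {C : Type u} [Category.{w} C]

/-- A locally small category with small limits and a small weakly initial family has an initial
object. -/
lemma hasInitial_of_weaklyInitial [LocallySmall.{v} C] [HasLimitsOfSize.{v, v} C] {ι : Type v}
    (B : ι → C) (hB : ∀ X : C, ∃ i, Nonempty (B i ⟶ X)) : HasInitial C := by
  let e := ShrinkHoms.equivalence.{v} C
  have : HasLimits (ShrinkHoms.{u} C) := Adjunction.has_limits_of_equivalence e.inverse
  obtain ⟨T, hT⟩ := has_weakly_initial_of_weakly_initial_set_and_hasProducts
    (B := fun i => e.functor.obj (B i)) (fun X => by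
      obtain ⟨i, ⟨f⟩⟩ := hB (e.inverse.obj X)
      exact ⟨i, ⟨e.functor.map f ≫ e.counit.app X⟩⟩)
  have : HasInitial (ShrinkHoms.{u} C) := hasInitial_of_weakly_initial_and_hasWideEqualizers hT
  exact Adjunction.hasColimitsOfShape_of_equivalence e.functor

end InitialObjects

section Subring

open scoped MonObj

variable {A : Type u} [Category.{w} A] [MonoidalCategory A] [SymmetricCategory A]

section
variable {S : CommMon A} {I : A} (i : I ⟶ S.X) [Mono i] (e : 𝟙_ A ⟶ I) (he : e ≫ i = η[S.X])
  (m : I ⊗ I ⟶ I) (hm : m ≫ i = tmul i i)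

/-- The monoid structure on a subobject closed under the operations. -/
@[reducible]
def subMon : MonObj I where
  one := e
  mul := m
  one_mul := by
    rw [← cancel_mono i, Category.assoc, hm, whiskerRight_tmul, he, one_tmul]
  mul_one := by
    rw [← cancel_mono i, Category.assoc, hm, whiskerLeft_tmul, he, ← braiding_tmul, one_tmul,
      braiding_leftUnitor_assoc]
  mul_assoc := by
    rw [← cancel_mono i]
    simp only [Category.assoc]
    rw [hm, whiskerRight_tmul, whiskerLeft_tmul, hm, tmul_assoc]

lemma subMon_comm : @IsCommMonObj A _ _ _ I (subMon i e he m hm) :=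
  let := subMon i e he m hm
  { mul_comm := by
      change (β_ I I).hom ≫ m = m
      rw [← cancel_mono i, Category.assoc, hm, braiding_tmul] }

end

variable (M : A)

/-- The tensor powers of an object. -/
def tensorPow : ℕ → A
  | 0 => 𝟙_ A
  | n + 1 => M ⊗ tensorPow n

variable {M} {S : CommMon A} (f : M ⟶ S.X)

/-- The product map from a tensor power to a ring. -/
def powHom : ∀ n, tensorPow M n ⟶ S.X
  | 0 => η[S.X]
  | n + 1 => tmul f (powHom n)

/-- The proof produces the degree `n + k`; leaving it existential avoids transport along equalities
of exponents. -/
lemma tmul_powHom (n k : ℕ) : ∃ (l : ℕ) (a : tensorPow M n ⊗ tensorPow M k ⟶ tensorPow M l),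
    tmul (powHom f n) (powHom f k) = a ≫ powHom f l := by
  induction n with
  | zero => exact ⟨k, (λ_ _).hom, one_tmul _⟩
  | succ n ih =>
    obtain ⟨l, a, h⟩ := ih
    refine ⟨l + 1, (α_ _ _ _).hom ≫ M ◁ a, ?_⟩
    have h1 : tmul (tmul f (powHom f n)) (powHom f k) = _ := tmul_assoc _ _ _
    refine h1.trans ?_
    rw [h, ← whiskerLeft_tmul]
    exact (Category.assoc _ _ _).symm

end Subring

section Small

variable {A : Type u} [Category.{w} A] [MonoidalCategory A]

/-- A multiplication has at most one unit. -/
instance small_monObj [LocallySmall.{v} A] (X : A) : Small.{v} (MonObj X) :=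
  small_of_injective (f := fun m : MonObj X => m.mul) (fun _ _ h => MonObj.ext _ _ h)

end Small

section Separating

variable {A : Type u} [Category.{w} A] {𝒢 : ObjectProperty A} [ObjectProperty.Small.{v} 𝒢]

lemma small_inverseImage_proj {B : Type*} [Category* B] [LocallySmall.{v} B] (F : A ⥤ B) (N : B) :
    ObjectProperty.Small.{v} (𝒢.inverseImage (CostructuredArrow.proj F N)) := by
  have h : 𝒢.inverseImage (CostructuredArrow.proj F N) =
      .ofObj fun f : Σ (G : Subtype 𝒢), F.obj G ⟶ N => CostructuredArrow.mk f.2 := by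
    ext X
    simp only [ObjectProperty.prop_inverseImage_iff, CostructuredArrow.proj_obj,
      ObjectProperty.ofObj_iff, Sigma.exists, Subtype.exists, exists_prop]
    exact ⟨fun h => ⟨_, h, _, rfl⟩, by rintro ⟨_, h, _, rfl⟩; exact h⟩
  rw [h]
  infer_instance

/-- A cocontinuous functor out of an abelian category with a small separating family is a left
adjoint. -/
theorem isLeftAdjoint_of_isSeparating [HasColimitsOfSize.{v, v} A] [Abelian A]
    [LocallySmall.{v} A] (h𝒢 : 𝒢.IsSeparating) {B : Type*} [Category.{w} B]
    [LocallySmall.{v} B] (F : A ⥤ B)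
    [PreservesColimitsOfSize.{v, v} F] : F.IsLeftAdjoint := by
  have : WellPowered.{v} A := wellPowered_of_isDetecting h𝒢.isDetecting
  have : WellPowered.{v} Aᵒᵖ := inferInstance
  have : PreservesColimitsOfSize.{0, 0} F := preservesColimitsOfSize_shrink.{0, v, 0, v} F
  have : PreservesFiniteColimits F := PreservesColimitsOfSize.preservesFiniteColimits F
  have : ∀ N, WellPowered.{v} (CostructuredArrow F N)ᵒᵖ := fun N => inferInstance
  have : ∀ N, ObjectProperty.Small.{v} (𝒢.inverseImage (CostructuredArrow.proj F N)) := fun N =>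
    small_inverseImage_proj F N
  -- The special adjoint functor theorem: each comma category is cocomplete and co-well-powered and
  -- has a small separating family.
  have : ∀ N, HasTerminal (CostructuredArrow F N) := fun N =>
    hasTerminal_of_isSeparating.{v} (CostructuredArrow.isSeparating_inverseImage_proj F N h𝒢)
  exact isLeftAdjoint_of_costructuredArrowTerminals _

end Separating

section Adjoints

open scoped MonObj

variable {A : Type u} [Category.{w} A] [MonoidalCategory A] [SymmetricCategory A]
  [HasColimitsOfSize.{v, v} A] [hl : ∀ X : A, PreservesColimitsOfSize.{v, v} (tensorLeft X)]

lemma tensorLeft_sigma_hom_ext {T : Type v} (X : T → A) {Z W : A} {f g : Z ⊗ (∐ X) ⟶ W}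
    (h : ∀ j, Z ◁ Sigma.ι X j ≫ f = Z ◁ Sigma.ι X j ≫ g) : f = g :=
  (isColimitOfPreserves (tensorLeft Z) (coproductIsCoproduct X)).hom_ext fun ⟨j⟩ => h j

variable [hr : ∀ X : A, PreservesColimitsOfSize.{v, v} (tensorRight X)]

lemma tensorRight_sigma_hom_ext {T : Type v} (X : T → A) {Z W : A} {f g : (∐ X) ⊗ Z ⟶ W}
    (h : ∀ j, Sigma.ι X j ▷ Z ≫ f = Sigma.ι X j ▷ Z ≫ g) : f = g :=
  (isColimitOfPreserves (tensorRight Z) (coproductIsCoproduct X)).hom_ext fun ⟨j⟩ => h j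

lemma epi_tensorHom {X Y : A} (e : X ⟶ Y) [Epi e] : Epi (e ⊗ₘ e) := by
  have h1 : PreservesColimitsOfSize.{0, 0} (tensorLeft Y) := preservesColimitsOfSize_shrink.{0, v, 0, v} _
  have h2 : PreservesColimitsOfSize.{0, 0} (tensorRight X) := preservesColimitsOfSize_shrink.{0, v, 0, v} _
  have : Epi (e ▷ X) := inferInstanceAs (Epi ((tensorRight X).map e))
  have : Epi (Y ◁ e) := inferInstanceAs (Epi ((tensorLeft Y).map e))
  rw [MonoidalCategory.tensorHom_def]
  exact epi_comp _ _

variable [Abelian A] [LocallySmall.{v} A] {𝒢 : ObjectProperty A} [ObjectProperty.Small.{v} 𝒢]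

section
variable {M : A} {S : CommMon A} (f : M ⟶ S.X)

variable (M) in
/-- The sum of the tensor powers. -/
def tensorSum : A := ∐ fun n : ULift.{v} ℕ => tensorPow M n.down

variable (M) in
/-- The inclusion of a tensor power. -/
def tensorSumι (n : ℕ) : tensorPow M n ⟶ tensorSum.{w, v} M :=
  Sigma.ι (fun n : ULift.{v} ℕ => tensorPow M n.down) ⟨n⟩

/-- The product map from the sum of the tensor powers. -/
def sumHom : tensorSum.{w, v} M ⟶ S.X := Sigma.desc fun n => powHom f n.down

lemma tensorSumι_sumHom (n : ℕ) : tensorSumι M n ≫ sumHom.{w, v} f = powHom f n :=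
  Sigma.ι_desc _ _

/-- The image of the sum of the tensor powers is closed under products. -/
lemma tmul_image {I Q : A} (e : tensorSum.{w, v} M ⟶ I) [Epi e] (i : I ⟶ S.X)
    (h : e ≫ i = sumHom f) (π : S.X ⟶ Q) (hπ : i ≫ π = 0) : tmul i i ≫ π = 0 := by
  have := epi_tensorHom.{w, v} e
  -- Since `e ⊗ₘ e` is an epimorphism, products may be tested on pairs of tensor powers, where they
  -- factor through a single tensor power and so through the image.
  rw [← cancel_epi (e ⊗ₘ e), comp_zero, ← Category.assoc, comp_tmul, h]
  apply tensorRight_sigma_hom_ext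
  intro n
  apply tensorLeft_sigma_hom_ext
  intro k
  obtain ⟨l, a, ha⟩ := tmul_powHom f n.down k.down
  have h1 : tensorPow M n.down ◁ tensorSumι.{w, v} M k.down ≫ tensorSumι.{w, v} M n.down ▷ _ ≫
      tmul (sumHom f) (sumHom f) = a ≫ powHom f l := by
    rw [whiskerRight_tmul, whiskerLeft_tmul, tensorSumι_sumHom, tensorSumι_sumHom, ha]
  have h2 : powHom f l ≫ π = 0 := by
    rw [← tensorSumι_sumHom.{w, v} f l, ← h, Category.assoc, Category.assoc, hπ, comp_zero,
      comp_zero]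
  have h3 : tensorPow M n.down ◁ tensorSumι.{w, v} M k.down ≫ tensorSumι.{w, v} M n.down ▷ _ ≫
      tmul (sumHom f) (sumHom f) ≫ π = 0 := by
    rw [← Category.assoc, ← Category.assoc, Category.assoc _ _ (tmul _ _), h1, Category.assoc, h2,
      comp_zero]
  refine h3.trans ?_
  exact (whisker_eq _ comp_zero).trans comp_zero |>.symm

/-- A map to a ring factors through a ring on a quotient of the sum of the tensor powers. -/
lemma exists_factor : ∃ (K : Subobject (tensorSum.{w, v} M)) (_ : MonObj (cokernel K.arrow))
    (_ : IsCommMonObj (cokernel K.arrow)) (g : M ⟶ cokernel K.arrow)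
    (k : CommMon.mk (cokernel K.arrow) ⟶ S), g ≫ und k = f := by
  let p : tensorSum.{w, v} M ⟶ S.X := sumHom f
  -- The subring generated by `M` is the image of `p`. It is presented as a quotient by a subobject
  -- of `tensorSum M`, which does not depend on `S`, so that only a small set of candidates arises.
  let K := Subobject.mk (kernel.ι p)
  have hK : K.arrow ≫ p = 0 := by
    rw [← Subobject.underlyingIso_hom_comp_eq_mk, Category.assoc, kernel.condition, comp_zero]
  let i : cokernel K.arrow ⟶ S.X := cokernel.desc _ p hK
  let e : tensorSum.{w, v} M ⟶ cokernel K.arrow := cokernel.π _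
  have hei : e ≫ i = p := cokernel.π_desc _ _ _
  -- The quotient by `K` is the coimage of `p`, which embeds in the target in an abelian category.
  have : Mono i := by
    have h0 : K.arrow = (Subobject.underlyingIso (kernel.ι p)).hom ≫ kernel.ι p :=
      (Subobject.underlyingIso_hom_comp_eq_mk _).symm
    have h1 : kernel.ι p ≫ e = 0 := by
      rw [← cancel_epi (Subobject.underlyingIso (kernel.ι p)).hom, ← Category.assoc, ← h0,
        cokernel.condition, comp_zero]
    let j : Abelian.coimage p ⟶ cokernel K.arrow := cokernel.desc _ e h1
    have h2 : kernel.ι p ≫ cokernel.π (kernel.ι p) = 0 := cokernel.condition _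
    let j' : cokernel K.arrow ⟶ Abelian.coimage p := cokernel.desc _ (cokernel.π (kernel.ι p)) (by
      rw [h0, Category.assoc, h2, comp_zero])
    have hj : i = j' ≫ Abelian.factorThruCoimage p := by
      apply coequalizer.hom_ext
      change e ≫ i = e ≫ j' ≫ _
      have h3 : e ≫ j' = cokernel.π (kernel.ι p) := cokernel.π_desc _ _ _
      rw [hei, ← Category.assoc, h3]
      exact (Abelian.coimage.fac p).symm
    have hjj : j' ≫ j = 𝟙 _ := by
      apply coequalizer.hom_ext
      change e ≫ j' ≫ j = e ≫ 𝟙 _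
      have h3 : e ≫ j' = cokernel.π (kernel.ι p) := cokernel.π_desc _ _ _
      have h4 : cokernel.π (kernel.ι p) ≫ j = e := cokernel.π_desc _ _ _
      rw [← Category.assoc, h3, h4, Category.comp_id]
    have : Mono j' := mono_of_mono_fac hjj
    rw [hj]
    exact mono_comp _ _
  have hm0 : tmul i i ≫ cokernel.π i = 0 := tmul_image f e i hei _ (cokernel.condition i)
  let m : cokernel K.arrow ⊗ cokernel K.arrow ⟶ cokernel K.arrow := Abelian.monoLift i _ hm0
  have hm : m ≫ i = tmul i i := Abelian.monoLift_comp _ _ _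
  let e0 : 𝟙_ A ⟶ cokernel K.arrow := tensorSumι M 0 ≫ e
  have he0 : e0 ≫ i = η[S.X] := by
    change (tensorSumι M 0 ≫ e) ≫ i = _
    rw [Category.assoc, hei]
    exact tensorSumι_sumHom f 0
  refine ⟨K, subMon i e0 he0 m hm, subMon_comm i e0 he0 m hm,
    (ρ_ M).inv ≫ tensorSumι M 1 ≫ e, ?_⟩
  let : MonObj (cokernel K.arrow) := subMon i e0 he0 m hm
  have : IsCommMonObj (cokernel K.arrow) := subMon_comm i e0 he0 m hm
  refine ⟨ringHom (S := CommMon.mk (cokernel K.arrow)) i he0 hm, ?_⟩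
  let t : M ⊗ 𝟙_ A ⟶ tensorSum.{w, v} M := tensorSumι M 1
  have ht : t ≫ p = tmul f η[S.X] := tensorSumι_sumHom f 1
  change ((ρ_ M).inv ≫ t ≫ e) ≫ i = f
  rw [Category.assoc, Category.assoc, hei, ht]
  rw [← braiding_tmul, one_tmul, braiding_leftUnitor_assoc, Iso.inv_hom_id_assoc]

end

variable [HasLimitsOfSize.{v, v} A]

instance preservesLimitsOfSize_commMonForget : PreservesLimitsOfSize.{v, v} (CommMon.forget A) where
  preservesLimitsOfShape {J _} :=
    inferInstanceAs (PreservesLimitsOfShape J (CommMon.forget₂Mon A ⋙ Mon.forget A))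

instance hasLimitsOfSize_commMon : HasLimitsOfSize.{v, v} (CommMon A) where
  has_limits_of_shape _ _ := commMonHasLimitsOfShape

/-- Free commutative monoids exist. -/
theorem isRightAdjoint_commMonForget (h𝒢 : 𝒢.IsSeparating) :
    (CommMon.forget A).IsRightAdjoint := by
  have : WellPowered.{v} A := wellPowered_of_isDetecting h𝒢.isDetecting
  have : LocallySmall.{v} (CommMon A) := locallySmall_of_faithful (CommMon.forget A)
  have : ∀ M, HasInitial (StructuredArrow M (CommMon.forget A)) := by
    intro M
    -- The solution set: commutative ring structures on quotients of `tensorSum M`, with a map from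
    -- `M`. Well-poweredness and local smallness make it small.
    let T := Σ (K : Subobject (tensorSum.{w, v} M))
      (_ : {m : MonObj (cokernel K.arrow) // IsCommMonObj (cokernel K.arrow)}),
      M ⟶ cokernel K.arrow
    let B (x : T) : StructuredArrow M (CommMon.forget A) :=
      let := x.2.1.1
      have := x.2.1.2
      StructuredArrow.mk (Y := CommMon.mk (cokernel x.1.arrow)) x.2.2
    refine hasInitial_of_weaklyInitial (fun x => B ((equivShrink.{v} T).symm x)) ?_
    intro X
    obtain ⟨K, m, hc, g, k, hk⟩ := exists_factor.{w, v} (S := X.right) X.hom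
    refine ⟨equivShrink.{v} T ⟨K, ⟨m, hc⟩, g⟩, ?_⟩
    rw [Equiv.symm_apply_apply]
    exact ⟨StructuredArrow.homMk k hk⟩
  exact isRightAdjointOfStructuredArrowInitials _

end Adjoints

end Plethysm

end

noncomputable section

namespace Plethysm

/-! ### Modules over the theory form a complete abelian category -/

section Model

variable (P : Type w) [Category.{v} P]

instance isModel_isClosedUnderLimitsOfShape (K : Type v) [SmallCategory K] :
    (isModel P).IsClosedUnderLimitsOfShape K where
  limitsOfShape_le := by
    rintro G ⟨h⟩ J
    have := fun k => h.prop_diag_obj k J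
    have : PreservesLimitsOfShape (Discrete J) h.diag.flip := ⟨fun {F} ↦ ⟨fun {c} hc ↦
      ⟨evaluationJointlyReflectsLimits _
        (fun k' ↦ isLimitOfPreserves (h.diag.obj k') hc)⟩⟩⟩
    have : PreservesLimitsOfShape (Discrete J) (lim (J := K) (C := AddCommGrpCat.{v})) :=
      (constLimAdj (J := K) (C := AddCommGrpCat.{v})).rightAdjoint_preservesLimits.preservesLimitsOfShape
    let e : h.diag.flip ⋙ lim ≅ G :=
      NatIso.ofComponents
        (fun j ↦ (limit.isLimit (h.diag.flip.obj j)).conePointUniqueUpToIso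
          (isLimitOfPreserves ((evaluation _ _).obj j) h.isLimit)) (by
          intro X Y f
          apply (isLimitOfPreserves ((evaluation _ _).obj Y) h.isLimit).hom_ext
          intro k
          have h1 := (limit.isLimit (h.diag.flip.obj Y)).conePointUniqueUpToIso_hom_comp
            (isLimitOfPreserves ((evaluation _ _).obj Y) h.isLimit) k
          have h2 := (limit.isLimit (h.diag.flip.obj X)).conePointUniqueUpToIso_hom_comp
            (isLimitOfPreserves ((evaluation _ _).obj X) h.isLimit) k
          have h3 : G.map f ≫ (h.π.app k).app Y =
            (h.π.app k).app X ≫ (h.diag.obj k).map f := (h.π.app k).naturality f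
          simp only [Functor.mapCone_π_app, evaluation_obj_map] at h1 h2 ⊢
          rw [Category.assoc, h1, Category.assoc, h3, reassoc_of% h2]
          simp)
    exact preservesLimitsOfShape_of_natIso e

variable [HasCoproducts.{v} P]

instance isModel_isClosedUnderKernels : (isModel P).IsClosedUnderKernels where
  kernels_le := by
    rintro _ ⟨f, k, hk, hf⟩
    exact (isModel P).prop_of_isLimit (J := WalkingParallelPair) hk fun j => by
      cases j
      exacts [hf.1, hf.2]

instance isModel_isClosedUnderCokernels : (isModel P).IsClosedUnderCokernels where
  cokernels_le := by
    rintro _ ⟨f, k, hk, hf⟩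
    exact (isModel P).prop_of_isColimit hk fun j => by
      cases j
      exacts [hf.1, hf.2]

instance isModel_isClosedUnderFiniteProducts : (isModel P).IsClosedUnderFiniteProducts where
  isClosedUnderLimitsOfShape J _ := by
    have := Fintype.ofFinite J
    infer_instance

instance isModel_containsZero : (isModel P).ContainsZero where
  exists_zero := ⟨_, isZero_zero _,
    (isModel P).prop_of_isLimit (F := Functor.empty _) (c := asEmptyCone _)
      (isZero_zero (Pᵒᵖ ⥤ AddCommGrpCat.{v})).isTerminal fun j => j.as.elim⟩

instance abelian_lmod : Abelian (LMod P) :=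
  inferInstanceAs (Abelian (isModel P).FullSubcategory)

instance hasLimitsOfSize_lmod : HasLimitsOfSize.{v, v} (LMod P) where
  has_limits_of_shape K _ := inferInstanceAs (HasLimitsOfShape K (isModel P).FullSubcategory)

end Model

/-! ### Elements of modules and the Yoneda lemma -/

section Elements

variable {P : Type w} [Category.{v} P] [HasCoproducts.{v} P]

/-- The group of values of a module at an object. -/
def LMod.val (M : LMod P) (X : P) : AddCommGrpCat.{v} := M.obj.obj (op X)

/-- The restriction map between the values of a module. -/
def LMod.res (M : LMod P) {X Y : P} (f : X ⟶ Y) : M.val Y →+ M.val X := (M.obj.map f.op).hom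

/-- The value of a map of modules. -/
def LMod.app {M N : LMod P} (f : M ⟶ N) (X : P) : M.val X →+ N.val X := (f.hom.app (op X)).hom

lemma LMod.res_id (M : LMod P) {X : P} (x : M.val X) : M.res (𝟙 X) x = x :=
  congrArg (fun f : M.obj.obj (op X) ⟶ M.obj.obj (op X) => f.hom x) (M.obj.map_id (op X))

lemma LMod.res_comp (M : LMod P) {X Y Z : P} (f : X ⟶ Y) (g : Y ⟶ Z) (x : M.val Z) :
    M.res (f ≫ g) x = M.res f (M.res g x) :=
  congrArg (fun f : M.obj.obj (op Z) ⟶ M.obj.obj (op X) => f.hom x) (M.obj.map_comp g.op f.op)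

lemma LMod.app_res {M N : LMod P} (φ : M ⟶ N) {X Y : P} (f : X ⟶ Y) (x : M.val Y) :
    LMod.app φ X (M.res f x) = N.res f (LMod.app φ Y x) :=
  congrArg (fun f : M.obj.obj (op Y) ⟶ N.obj.obj (op X) => f.hom x) (φ.hom.naturality f.op)

lemma LMod.app_comp {M N L : LMod P} (φ : M ⟶ N) (ψ : N ⟶ L) {X : P} (x : M.val X) :
    LMod.app (φ ≫ ψ) X x = LMod.app ψ X (LMod.app φ X x) := rfl

lemma LMod.hom_ext {M N : LMod P} {φ ψ : M ⟶ N}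
    (h : ∀ (X : P) (x : M.val X), LMod.app φ X x = LMod.app ψ X x) : φ = ψ := by
  apply ObjectProperty.hom_ext
  ext X x
  exact h X.unop x

/-- An element of a module at a coproduct is a family of elements. -/
lemma LMod.existsUnique_res (M : LMod P) {J : Type v} (A : J → P) (x : ∀ j, M.val (A j)) :
    ∃! y : M.val (∐ A), ∀ j, M.res (Sigma.ι A j) y = x j := by
  have := M.property J
  let c : Cofan A := Cofan.mk _ (Sigma.ι A)
  have hc : IsColimit c := coproductIsCoproduct A
  have hl := isLimitOfPreserves (M.obj ⋙ CategoryTheory.forget _) (Cofan.IsColimit.op hc)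
  let e := Types.isLimitEquivSections hl
  let s (z : ∀ j, M.val (A j)) : (Discrete.functor (fun j => op (A j)) ⋙ M.obj ⋙ CategoryTheory.forget _).sections :=
    ⟨fun j => z j.as, by
      rintro ⟨j⟩ ⟨k⟩ ⟨⟨h⟩⟩
      change j = k at h
      subst h
      exact M.res_id _⟩
  refine ⟨e.symm (s x), fun j => ?_, fun y hy => ?_⟩
  · exact Types.isLimitEquivSections_symm_apply hl (s x) ⟨j⟩
  · apply e.injective
    refine Eq.trans ?_ (e.apply_symm_apply _).symm
    apply Subtype.ext
    funext j
    exact hy j.as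

lemma LMod.res_ext (M : LMod P) {J : Type v} (A : J → P) {x y : M.val (∐ A)}
    (h : ∀ j, M.res (Sigma.ι A j) x = M.res (Sigma.ι A j) y) : x = y :=
  (M.existsUnique_res A fun j => M.res (Sigma.ι A j) y).unique h fun _ => rfl

variable [Preadditive P]

/-- A model preserves the terminal object and binary products, and such functors between additive
categories are additive. -/
instance additive_of_lmod (M : LMod P) : M.obj.Additive := by
  have : HasFiniteCoproducts P := hasFiniteCoproducts_of_hasCoproducts P
  have : HasBinaryBiproducts P := HasBinaryBiproducts.of_hasBinaryCoproducts
  have : PreservesLimitsOfShape (Discrete WalkingPair) M.obj := by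
    have := M.property (ULift WalkingPair)
    exact preservesLimitsOfShape_of_equiv (Discrete.equivalence Equiv.ulift) _
  have : PreservesLimitsOfShape (Discrete PEmpty.{1}) M.obj := by
    have := M.property (ULift PEmpty.{1})
    exact preservesLimitsOfShape_of_equiv (Discrete.equivalence Equiv.ulift) _
  have : HasZeroObject P := hasZeroObject_of_hasInitial_object
  have : M.obj.PreservesZeroMorphisms := Functor.preservesZeroMorphisms_of_preserves_terminal_object
  exact Functor.additive_of_preserves_binary_products _

lemma LMod.res_add (M : LMod P) {X Y : P} (f g : X ⟶ Y) (x : M.val Y) :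
    M.res (f + g) x = M.res f x + M.res g x :=
  congrArg (fun f : M.obj.obj (op Y) ⟶ M.obj.obj (op X) => f.hom x)
    (M.obj.map_add (f := f.op) (g := g.op))

/-- The map from a representable module given by an element. -/
def LMod.ofElement (M : LMod P) {X : P} (x : M.val X) : (yonedaLMod P).obj X ⟶ M :=
  (isModel P).homMk
    { app Z := AddCommGrpCat.ofHom (AddMonoidHom.mk' (fun f : Z.unop ⟶ X => M.res f x)
        fun f g => M.res_add f g x)
      naturality Y Z f := by
        ext g
        exact M.res_comp f.unop g x }

/-- The identity as an element of a representable module. -/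
def oneElement (X : P) : ((yonedaLMod P).obj X).val X := 𝟙 X

lemma LMod.yoneda_hom_ext {M : LMod P} {X : P} {φ ψ : (yonedaLMod P).obj X ⟶ M}
    (h : LMod.app φ X (oneElement X) = LMod.app ψ X (oneElement X)) : φ = ψ := by
  have key (θ : (yonedaLMod P).obj X ⟶ M) : θ = M.ofElement (LMod.app θ X (oneElement X)) := by
    apply LMod.hom_ext
    intro Z (f : Z ⟶ X)
    refine Eq.trans ?_ (LMod.app_res θ f (oneElement X))
    exact congrArg (LMod.app θ Z) (Category.comp_id f).symm
  rw [key φ, key ψ, h]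

lemma LMod.app_ofElement (M : LMod P) {X : P} (x : M.val X) :
    LMod.app (M.ofElement x) X (oneElement X) = x :=
  M.res_id x

end Elements

end Plethysm

end

noncomputable section

namespace Plethysm

/-! ### Coproducts, generators and adjoints from boundedness -/

section

variable {A : Type u} [Category.{w} A] [Abelian A] {J : Type v}

/-- In an abelian category, objects presented by families with coproducts have a coproduct. -/
lemma hasCoproduct_of_presentation (X R Q : J → A) (q : ∀ j, Q j ⟶ X j) [∀ j, Epi (q j)]
    (r : ∀ j, R j ⟶ kernel (q j)) [∀ j, Epi (r j)] [HasCoproduct R] [HasCoproduct Q] :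
    HasCoproduct X := by
  -- The coproduct of the presented objects is the cokernel of the coproduct of the relations.
  let d : ∐ R ⟶ ∐ Q := Sigma.desc fun j => r j ≫ kernel.ι (q j) ≫ Sigma.ι Q j
  have hd (j) : Sigma.ι R j ≫ d = r j ≫ kernel.ι (q j) ≫ Sigma.ι Q j := Sigma.ι_desc _ _
  have h0 (j) : kernel.ι (q j) ≫ Sigma.ι Q j ≫ cokernel.π d = 0 := by
    rw [← cancel_epi (r j), comp_zero, ← Category.assoc (kernel.ι _), ← Category.assoc, ← hd,
      Category.assoc, cokernel.condition, comp_zero]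
  let i (j) : X j ⟶ cokernel d := Abelian.epiDesc (q j) _ (h0 j)
  have hi (j) : q j ≫ i j = Sigma.ι Q j ≫ cokernel.π d := Abelian.comp_epiDesc _ _ _
  have hs (s : Cofan X) : d ≫ Sigma.desc (fun j => q j ≫ s.inj j) = 0 := by
    apply Sigma.hom_ext
    intro j
    rw [← Category.assoc, hd, Category.assoc, Category.assoc, Sigma.ι_desc, kernel.condition_assoc,
      zero_comp, comp_zero, comp_zero]
  have H : IsColimit (Cofan.mk _ i) := Cofan.IsColimit.mk _ (fun s => cokernel.desc d _ (hs s))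
    (fun s j => by
      change i j ≫ _ = _
      rw [← cancel_epi (q j), ← Category.assoc, hi, Category.assoc, cokernel.π_desc, Sigma.ι_desc])
    (fun s m hm => by
      change cokernel d ⟶ _ at m
      apply coequalizer.hom_ext
      change cokernel.π d ≫ m = cokernel.π d ≫ cokernel.desc _ _ _
      rw [cokernel.π_desc]
      apply Sigma.hom_ext
      intro j
      have h : i j ≫ m = s.inj j := hm j
      rw [Sigma.ι_desc, ← Category.assoc, ← hi, Category.assoc, h])
  exact ⟨⟨⟨_, H⟩⟩⟩

end

section

variable {P : Type w} [Category.{v} P] [HasCoproducts.{v} P]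

/-- A small family of objects whose coproducts have every object as a retract. -/
lemma exists_generators (hP : IsBounded P) : ∃ (I : Type v) (G : I → P),
    ∀ X : P, ∃ (J : Type v) (Y : J → P), (∀ j, ∃ i, Nonempty (Y j ≅ G i)) ∧
      Nonempty (Retract X (∐ Y)) := by
  obtain ⟨κ, P₀, -, h, -, -, hX⟩ := hP.exists_compact_generators
  obtain ⟨Q, _, hQ⟩ := ObjectProperty.EssentiallySmall.exists_small_le'.{v} P₀
  refine ⟨Shrink.{v} (Subtype Q), fun i => ((equivShrink _).symm i).1, fun X => ?_⟩
  obtain ⟨J, Y, hY, hr⟩ := hX X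
  refine ⟨J, Y, fun j => ?_, hr⟩
  obtain ⟨Z, hZ, ⟨e⟩⟩ := hQ _ (hY j)
  refine ⟨equivShrink _ ⟨Z, hZ⟩, ?_⟩
  dsimp only
  rw [Equiv.symm_apply_apply]
  exact ⟨e⟩

variable (P) in
/-- A family of objects is generating if maps of modules are determined by their values on it. -/
def IsGenerating {I : Type v} (G : I → P) : Prop :=
  ∀ ⦃M N : LMod P⦄ (φ ψ : M ⟶ N),
    (∀ i (x : M.val (G i)), LMod.app φ _ x = LMod.app ψ _ x) → φ = ψ

/-- An element at a coproduct is a family of elements at the summands, and one at a retract is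
restricted from the larger object; so values at the small family decide equality. -/
lemma exists_isGenerating (hP : IsBounded P) : ∃ (I : Type v) (G : I → P), IsGenerating P G := by
  obtain ⟨I, G, hG⟩ := exists_generators hP
  refine ⟨I, G, fun M N φ ψ h => LMod.hom_ext fun X x => ?_⟩
  obtain ⟨J, Y, hY, ⟨r⟩⟩ := hG X
  have h1 (j) (y : M.val (Y j)) : LMod.app φ _ y = LMod.app ψ _ y := by
    obtain ⟨i, ⟨e⟩⟩ := hY j
    rw [← M.res_id y, ← e.hom_inv_id, M.res_comp, LMod.app_res φ e.hom, LMod.app_res ψ e.hom, h]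
  have h2 (y : M.val (∐ Y)) : LMod.app φ _ y = LMod.app ψ _ y := by
    apply N.res_ext
    intro j
    rw [← LMod.app_res, ← LMod.app_res, h1]
  rw [← M.res_id x, ← r.retract, M.res_comp, LMod.app_res φ r.i, LMod.app_res ψ r.i, h2]

/-- `P` itself may be large, so smallness of the hom-sets is not automatic; a map is determined by
its values on a small generating family. -/
lemma locallySmall_lmod (hP : IsBounded P) : LocallySmall.{v} (LMod P) where
  hom_small M N := by
    obtain ⟨I, G, hG⟩ := exists_isGenerating hP
    exact small_of_injective
      (f := fun (φ : M ⟶ N) (i : I) (x : M.val (G i)) => (LMod.app φ (G i) x : N.val (G i)))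
      fun φ ψ h => hG φ ψ fun i x => congrFun (congrFun h i) x

variable [Preadditive P]

lemma isSeparating_lmod {I : Type v} {G : I → P} (hG : IsGenerating P G) :
    (ObjectProperty.ofObj fun i => (yonedaLMod P).obj (G i)).IsSeparating := by
  intro M N φ ψ h
  refine hG φ ψ fun i x => ?_
  have := h _ (ObjectProperty.ofObj_apply _ i) (M.ofElement x)
  rw [← M.app_ofElement x, ← LMod.app_comp, this, LMod.app_comp]

/-- Representable modules on coproducts are coproducts. -/
lemma hasCoproduct_yoneda {J : Type v} (A : J → P) :
    HasCoproduct fun j => (yonedaLMod P).obj (A j) := by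
  have key (s : Cofan fun j => (yonedaLMod P).obj (A j)) :
      ∃! y : s.pt.val (∐ A), ∀ j, s.pt.res (Sigma.ι A j) y = LMod.app (s.inj j) _ (oneElement _) :=
    s.pt.existsUnique_res A _
  have H : IsColimit (Cofan.mk ((yonedaLMod P).obj (∐ A)) fun j =>
      (yonedaLMod P).map (Sigma.ι A j)) := Cofan.IsColimit.mk _
    (fun s => s.pt.ofElement (key s).choose)
    (fun s j => by
      apply LMod.yoneda_hom_ext
      refine Eq.trans ?_ ((key s).choose_spec.1 j)
      exact congrArg (fun f => s.pt.res f (key s).choose) (Category.id_comp (Sigma.ι A j)))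
    (fun s m hm => by
      change (yonedaLMod P).obj (∐ A) ⟶ s.pt at m
      apply LMod.yoneda_hom_ext
      refine Eq.trans ?_ (s.pt.app_ofElement _).symm
      refine (key s).choose_spec.2 _ fun j => ?_
      rw [← LMod.app_res, ← hm j]
      refine congrArg (LMod.app m (A j)) ?_
      exact (Category.comp_id _).trans (Category.id_comp _).symm)
  exact ⟨⟨⟨_, H⟩⟩⟩

/-- Every module is a quotient of a representable one. -/
lemma exists_epi (hP : IsBounded P) (M : LMod P) :
    ∃ (Q : P) (q : (yonedaLMod P).obj Q ⟶ M), Epi q := by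
  obtain ⟨I, G, hG⟩ := exists_isGenerating hP
  -- One copy of a generator is taken for each of its elements. The coproduct is formed in `P`, so
  -- the source of the epimorphism is representable.
  let A (t : Σ i, M.val (G i)) : P := G t.1
  obtain ⟨y, hy, -⟩ := M.existsUnique_res A fun t => t.2
  refine ⟨∐ A, M.ofElement y, ⟨fun {N} φ ψ h => hG φ ψ fun i x => ?_⟩⟩
  have h1 : LMod.app φ _ y = LMod.app ψ _ y := by
    rw [← M.app_ofElement y, ← LMod.app_comp, h, LMod.app_comp]
  have h2 : M.res (Sigma.ι A ⟨i, x⟩) y = x := hy ⟨i, x⟩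
  rw [← h2, LMod.app_res, LMod.app_res, h1]

/-- Every module has a presentation by representables, and these have coproducts; coequalizers are
available from cokernels. -/
lemma hasColimitsOfSize_lmod (hP : IsBounded P) : HasColimitsOfSize.{v, v} (LMod P) := by
  have : HasCoproducts.{v} (LMod P) := fun J => by
    refine ⟨fun F => ?_⟩
    have : HasCoproduct (F.obj ∘ Discrete.mk) := by
      choose Q q hq using fun j => exists_epi hP (F.obj ⟨j⟩)
      choose R r hr using fun j => exists_epi hP (kernel (q j))
      have := hasCoproduct_yoneda Q
      have := hasCoproduct_yoneda R
      exact hasCoproduct_of_presentation (F.obj ∘ Discrete.mk) _ _ q r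
    exact hasColimit_of_iso Discrete.natIsoFunctor
  exact has_colimits_of_hasCoequalizers_and_coproducts

end

section

variable {P : Type w} [Category.{v} P] [Preadditive P] [HasCoproducts.{v} P]
  [MonoidalCategory (LMod P)] [SymmetricCategory (LMod P)] [h : SymmetricMonoidalTheory P]

theorem isLeftAdjoint_tensorLeft_lmod (hP : IsBounded P) (M : LMod P) : (tensorLeft M).IsLeftAdjoint := by
  have := hasColimitsOfSize_lmod hP
  have := locallySmall_lmod hP
  have := h.tensorLeft_preservesColimits M
  obtain ⟨I, G, hG⟩ := exists_isGenerating hP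
  exact isLeftAdjoint_of_isSeparating (isSeparating_lmod hG) _

theorem isRightAdjoint_forget_lmod (hP : IsBounded P) : (CommMon.forget (LMod P)).IsRightAdjoint := by
  have := hasColimitsOfSize_lmod hP
  have := locallySmall_lmod hP
  have := h.tensorLeft_preservesColimits
  have := h.tensorRight_preservesColimits
  obtain ⟨I, G, hG⟩ := exists_isGenerating hP
  exact isRightAdjoint_commMonForget (isSeparating_lmod hG)

end

end Plethysm

end

theorem mainTheorem8 {P : Type w} [Category.{v} P] [Preadditive P] [HasCoproducts.{v} P]
    (hP : IsBounded P) [MonoidalCategory (LMod P)] [SymmetricCategory (LMod P)]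
    [SymmetricMonoidalTheory P] (Λ : Plethory (LMod P)) :
    -- abelian group objects in augmented `Λ`-rings are the square-zero extensions of the unit
    ((AbOver.forget Λ.unit).Full ∧ (AbOver.forget Λ.unit).Faithful ∧
      (∀ X : Over Λ.unit, (AbOver.forget Λ.unit).essImage X ↔
        (sqZero (A := LMod P)).essImage ((Over.post Λ.toCommMon).obj X)) ∧
      ∃ e : AbOver.forget Λ.unit ⋙ Over.post Λ.toCommMon ≅ Λ.abForget Λ.unit ⋙ sqZero,
        IsDistributiveSquare e) ∧
    -- they are the modules over an algebra whose underlying bimodule is `Δ(Λ)`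
    (IsPlethystic (Λ.abForget Λ.unit) ∧ Λ.forget.IsRightAdjoint ∧
      ∀ (L : LMod P ⥤ Λ.Ab Λ.unit) (adj : L ⊣ Λ.abForget Λ.unit)
        (Fr : LMod P ⥤ Λ.Ring) (adjFr : Fr ⊣ Λ.forget),
        Nonempty (yonedaLMod P ⋙ adj.toMonad.toFunctor ≅ yonedaLMod P ⋙ Λ.cotangent adjFr)) ∧
    -- abelian group objects over `B` are the modules over the composite `B ⊗ Δ(Λ)`
    ∀ B : Λ.Ring,
      IsPlethystic (Λ.abForget B) ∧ IsPlethystic (Λ.abToModule B) ∧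
      (Λ.underForget B).IsRightAdjoint ∧
      (∀ (L : LMod P ⥤ Λ.Ab B) (adj : L ⊣ Λ.abForget B)
        (Fr : LMod P ⥤ Under B) (adjFr : Fr ⊣ Λ.underForget B),
        Nonempty (yonedaLMod P ⋙ adj.toMonad.toFunctor ≅
          yonedaLMod P ⋙ Λ.cotangentUnder B adjFr)) ∧
      (∀ (L : LMod P ⥤ Λ.Ab Λ.unit) (adj : L ⊣ Λ.abForget Λ.unit)
        (L' : LMod P ⥤ Λ.Ab B) (adj' : L' ⊣ Λ.abForget B),
        ∃ (c : MonadComposition (tensorMonad B.A) adj.toMonad) (θ : adj'.toMonad ≅ c.monad),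
          ∀ G : Λ.Ab B,
            (c.inl ≫ θ.inv).app ((Λ.abForget B).obj G) ≫ ((Monad.comparison adj').obj G).a =
              ((Λ.abToModule B).obj G).a ∧
            adj.toMonad.map (Λ.abPullbackComparison B G) ≫
                (c.inr ≫ θ.inv).app ((Λ.abForget B).obj G) ≫ ((Monad.comparison adj').obj G).a =
              ((Monad.comparison adj).obj ((Λ.abPullbackToUnit B).obj G)).a ≫
                Λ.abPullbackComparison B G) ∧
      IsDistributiveSquare (AbOver.postForgetIso Λ.toCommMon B) := by
  -- Boundedness enters through these two adjoints: right adjoints of tensoring, and free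
  -- commutative monoids.
  have := isLeftAdjoint_tensorLeft_lmod hP
  have := isRightAdjoint_forget_lmod hP
  have hFr : Λ.forget.IsRightAdjoint := Λ.isRightAdjoint_forget
  refine ⟨⟨inferInstance, inferInstance, Λ.essImage_abOverForget_iff, Λ.abUnitSquare,
    Λ.isDistributiveSquare_abUnitSquare⟩, ⟨Λ.isPlethystic_abForget _, hFr, ?_⟩, fun B =>
    ⟨Λ.isPlethystic_abForget B, Λ.isPlethystic_abToModule B, Λ.isRightAdjoint_underForget B, ?_, ?_,
      Λ.isDistributiveSquare_postForgetIso B⟩⟩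
  · intro L adj Fr adjFr
    obtain ⟨i⟩ := Plethory.nonempty_cotangent adj adjFr
    exact ⟨Functor.isoWhiskerLeft (yonedaLMod P) i⟩
  · intro L adj Fr adjFr
    obtain ⟨i⟩ := Plethory.nonempty_cotangentUnder adj adjFr
    exact ⟨Functor.isoWhiskerLeft (yonedaLMod P) i⟩
  · intro L adj L' adj'
    exact Plethory.exists_monadComposition_abForget adj adj' hFr
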